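/- \textbf{The game (Model B3).} Cards have values $0,1,\dots,9$; a $d$-deck shoe has $16d$ cards of value $0$ and $4d$ cards of each value $1,\dots,9$. Cards are dealt without replacement: two to Player, two to Banker. A hand's total is the sum of its card values modulo $10$. A two-card hand is written $(i_1,i_2)$ with $0\le i_1\le i_2\le 9$. If either two-card total is $8$ or $9$ (a natural), play ends. Otherwise Player draws a third card on totals $0$--$4$, stands on $6$ and $7$, and may stand or draw at each of the five hands $(0,5),(1,4),(2,3),(6,9),(7,8)$ of total $5$. Then Banker, knowing his own two cards (one of $44$ hands of total at most $7$) and the value $k\in\{0,\dots,9\}$ of Player's third card ($k=\varnothing$ if Player stands), stands or draws one card. The higher total wins. Banker's profit is $1-\alpha$ if Banker wins, $0$ for a tie and $-1$ if Player wins, so that $\alpha$ is the commission rate on Banker wins. Player's payoff is minus Banker's profit with $\alpha=0$. Taking expectations gives a $2^5\times2^{484}$ bimatrix game: a Player pure strategy is a set of hands of total $5$ at which he draws, a Banker pure strategy is a set of information sets $((j_1,j_2),k)$ at which he draws. S, D, M mean stand, draw, mix. \textbf{Curves.} For an information set $l$, a Player pure strategy $u$ and $v\in\{0,1\}$, let $p_u(l)$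 be the probability that $l$ is reached and $b_{u,v}(l)$ Banker's conditional expected profit at $l$ from standing ($v=0$) or drawing ($v=1$). Let $\Delta_0(l)$ and $\Delta_1(l)$ be $p_u(l)\,[b_{u,1}(l)-b_{u,0}(l)]$ for $u=$ DSSDD and $u=$ DDSDD respectively (moves at $(0,5),(1,4),(2,3),(6,9),(7,8)$), and put $p(l)=\Delta_0(l)/(\Delta_0(l)-\Delta_1(l))$, a function of $d$ and $\alpha$. Let $\beta_1$ denote the $\alpha\in(0,1/10)$ at which $p((8,8),\varnothing)=p((5,8),8)$, and let $\beta_0,\beta_2,\beta_3,\beta_4,\beta_5$ denote the $\alpha\in(0,1/10)$ at which $p((0,6),\varnothing)$ equals, respectively, $p((3,3),6)$, $p((6,9),4)$, $p((0,5),4)$, $p((1,4),4)$, $p((2,3),4)$. \textbf{Banker's table 1} (Banker's two-card total; moves at $k=0,1,\dots,9,\varnothing$): totals $0,1,2$: DDDDDDDDDDD; total $3$: DDDDDDDD$*$DD; $4$: S$*$DDDDDDSSD; $5$: SSSS$*$DDDSSD; $6$: SSSSSS$*$DSS$*$; $7$: SSSSSSSSSSS. \textbf{Banker's table 2}. The five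 asterisks are filled, in the order (total, $k$) $=(3,8)$, $(4,1)$, $(5,4)$, $(6,\varnothing)$, $(6,6)$, by five blocks of moves, each listing the moves at the hands of that total in lexicographic order: total $3$: $(0,3),(1,2),(4,9),(5,8),(6,7)$; total $4$: $(0,4),(1,3),(2,2),(5,9),(6,8),(7,7)$; total $5$: $(0,5),(1,4),(2,3),(6,9),(7,8)$; total $6$: $(0,6),(1,5),(2,4),(3,3),(7,9),(8,8)$. At the entry M, Banker draws with probability $q$. Put $Q(a,b,c,e,f)=\dfrac{a\,d^4-b\,d^3+c\,d^2-e\,d+f}{256\,d^2(11d-1)(52d-5)}$ and $q_A=Q(92160,120128,26336,2000,47)$, $q_B=Q(91776,119968,26320,2000,47)$, $q_C=Q(91904,119680,26064,1932,41)$, $q_E=Q(91648,119488,26032,1932,41)$, $q_F=Q(91520,119520,26048,1932,41)$. \begin{itemize} \item $d=1$: $[0,\beta_1)$: SSDSD-SSSSDD-SSSSS-SSSSSM-DDDSDD, $q=\frac{4519}{10716}$; $(\beta_1,\frac1{10}]$: SSDDD-SSSSDD-SSSSS-SSSSSM-DDDSDD, $q=\frac{3991}{10716}$. \item $d=2$: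 $[0,\beta_2)$: SSSSS-SSSSDD-DSSDD-MSSSSD-DDDSDD, $q=\frac{17431}{64512}$; $(\beta_2,\beta_3)$: SSSSS-SSSSDD-DSSSD-MSSSSD-DDDSDD, $q=\frac{192637}{709632}$; $(\beta_3,\frac1{10}]$: SSSSS-SSSSDD-SSSSD-MSSSSD-DDDSDD, $q=\frac{65407}{236544}$. \item For $d\ge3$ all strategies have the form SSSSS-SSSSSS-$X$-MSSSSD-$Y$; the triples $(X,Y,q)$ are as follows. \item $d=3$: $[0,\frac1{10}]$: (DSSDD, DDDSDD, $q_B$). \item $4\le d\le7$: $[0,\beta_0)$: (DSSDD, DDDDDD, $q_A$); $(\beta_0,\frac1{10}]$: (DSSDD, DDDSDD, $q_B$). \item $d=8$: $[0,\beta_4)$: (DDSDD, DDDDDD, $q_C$); $(\beta_4,\beta_0)$: (DSSDD, DDDDDD, $q_A$); $(\beta_0,\frac1{10}]$: (DSSDD, DDDSDD, $q_B$). \item $d=9$: $[0,\beta_5)$: (DDDDD, DDDDDD, $q_E$); $(\beta_5,\beta_4)$: (DDSDD, DDDDDD, $q_C$); $(\beta_4,\beta_0)$: (DSSDD, DDDDDD,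 $q_A$); $(\beta_0,\frac1{10}]$: (DSSDD, DDDSDD, $q_B$). \item $d=10,11$: $[0,\beta_5)$: (DDDDD, DDDDDD, $q_E$); $(\beta_5,\beta_0)$: (DDSDD, DDDDDD, $q_C$); $(\beta_0,\frac1{10}]$: (DDSDD, DDDSDD, $q_F$). \item $d=12$: $[0,\beta_0)$: (DDDDD, DDDDDD, $q_E$); $(\beta_0,\frac1{10}]$: (DDDDD, DDDSDD, $\frac{1689974681}{2989264896}$). \item $d\ge13$: $[0,\frac1{10}]$: (DDDDD, DDDDDD, $q_E$). \end{itemize} \textbf{Theorem.} Let $d\ge1$ be an integer and $0\le\alpha\le1/10$. Let Player's strategy be to draw at $(0,5)$, $(6,9)$, $(7,8)$, stand at $(2,3)$, and draw at $(1,4)$ with probability $$p=p((0,6),\varnothing)=\frac{(12d-1)(16d^2-14d+1)+8\alpha d(112d^2-24d+1)}{32d^2(11d-1)-16d^2\alpha(12d-1)}\quad(d\ge2),\qquad p=p((8,8),\varnothing)=\frac{4+203\alpha}{2(38-21\alpha)}\quad(d=1),$$ that is, to mix DSSDD and DDSDD with probabilities $1-p$ and $p$. (a) Each $\beta_i$ listed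 in table 2 for $d$ exists and is unique in $(0,1/10)$, and they are ordered as the intervals indicate. Their values, rounded to seven decimals, are: $\beta_0\approx0.0120709$, $0.0392263$, $0.0569147$, $0.0693518$, $0.0785740$, $0.0856851$, $0.0913356$, $0.0959335$, $0.0997480$ ($d=4,\dots,12$); $\beta_1\approx0.0655294$; $\beta_2\approx0.0046904$; $\beta_3\approx0.0281623$; $\beta_4\approx0.0244435$, $0.0763202$ ($d=8,9$); $\beta_5\approx0.0056651$, $0.0544215$, $0.0932285$ ($d=9,10,11$). Their number is three if $d=9$, two if $d\in\{2,8,10,11\}$, one if $d\in\{1,4,5,6,7,12\}$, and zero otherwise. (b) If $\alpha$ lies in one of the intervals of table 2, Player's strategy and Banker's strategy of tables 1 and 2 (a mixture, with weights $1-q$ and $q$, of the two pure strategies with M replaced by S and by D) form a Nash equilibrium. (c) If $\alpha$ equals one of the $\beta_i$ listed for $d$, there are multiple Nash equilibria: exactly four Banker strategies of support size $2$ form a Nash equilibrium with Player's strategy above. The pure strategies in their supports agree with tables 1 and 2 except possibly at the two information sets whose curves define $\beta_i$. Uniqueness of the Nash equilibrium is not claimed. -/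

import Mathlib

namespace Baccara

/-! ### Bimatrix games -/

/-- `(p, q)` is a Nash equilibrium in mixed strategies of the bimatrix game `(A, B)`. -/
def IsNash {I J : Type*} [Fintype I] [Fintype J] (A B : I → J → ℝ) (p : I → ℝ) (q : J → ℝ) :
    Prop :=
  p ∈ stdSimplex ℝ I ∧ q ∈ stdSimplex ℝ J ∧
  (∀ p' ∈ stdSimplex ℝ I, ∑ i, ∑ j, p' i * A i j * q j ≤ ∑ i, ∑ j, p i * A i j * q j) ∧
  (∀ q' ∈ stdSimplex ℝ J, ∑ i, ∑ j, p i * B i j * q' j ≤ ∑ i, ∑ j, p i * B i j * q j)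

/-- The mixed strategy that plays `x` with probability `1 - t` and `y` with probability `t`. -/
noncomputable def mixture {I : Type*} [DecidableEq I] (x y : I) (t : ℝ) : I → ℝ :=
  fun i => (if i = x then 1 - t else 0) + (if i = y then t else 0)

/-! ### Hands, information sets, pure strategies -/

/-- Two-card hands `(i₁, i₂)` with card values `0 ≤ i₁ ≤ i₂ ≤ 9`. -/
abbrev Hand := {h : Fin 10 × Fin 10 // h.1 ≤ h.2}

/-- The total of a two-card hand. -/
def total (h : Hand) : ℕ := (h.1.1.val + h.1.2.val) % 10

/-- The total of the three-card hand consisting of `h` and a card of value `k`. -/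
def total3 (h : Hand) (k : Fin 10) : ℕ := (h.1.1.val + h.1.2.val + k.val) % 10

/-- Two-card hands that are not naturals. -/
abbrev LiveHand := {h : Hand // total h ≤ 7}

/-- The two-card hands with total 5, namely `(0,5), (1,4), (2,3), (6,9), (7,8)`. -/
abbrev FiveHand := {h : Hand // total h = 5}

/-- Banker's information sets: Banker's two-card hand together with the value of Player's third
card (`none`, written `∅`, if Player stands). -/
abbrev InfoSet := LiveHand × Option (Fin 10)

/-- Player's pure strategies: the set of two-card hands of total 5 at which Player draws. -/
abbrev PlayerPure := Finset FiveHand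

/-- Banker's pure strategies: the set of information sets at which Banker draws. -/
abbrev BankerPure := Finset InfoSet

/-- The non-natural hands at which Player draws under the pure strategy `u`. -/
def drawSet (u : PlayerPure) : Finset Hand :=
  Finset.univ.filter fun h => total h ≤ 4 ∨ ∃ x ∈ u, x.1 = h

/-- The non-natural hands at which Player stands under the pure strategy `u`. -/
def standSet (u : PlayerPure) : Finset Hand :=
  Finset.univ.filter fun h => total h ≤ 7 ∧ h ∉ drawSet u

/-! ### Dealing probabilities, without replacement from a `d`-deck shoe -/

/-- Kronecker delta. -/
def delta (i j : Fin 10) : ℝ := if i = j then 1 else 0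

/-- The number of cards of value `i` in a `d`-deck shoe. -/
noncomputable def cards (d : ℕ) (i : Fin 10) : ℝ := 4 * (d : ℝ) * (1 + 3 * delta i 0)

/-- Probability that Player's two-card hand is `i` and Banker's two-card hand is `j`. -/
noncomputable def p4 (d : ℕ) (i j : Hand) : ℝ :=
  (2 - delta i.1.1 i.1.2) * (cards d i.1.1 / (52 * d))
    * ((cards d i.1.2 - delta i.1.2 i.1.1) / (52 * d - 1))
    * ((2 - delta j.1.1 j.1.2)
      * ((cards d j.1.1 - delta j.1.1 i.1.1 - delta j.1.1 i.1.2) / (52 * d - 2)))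
    * ((cards d j.1.2 - delta j.1.2 i.1.1 - delta j.1.2 i.1.2 - delta j.1.2 j.1.1)
      / (52 * d - 3))

/-- Probability that, in addition, the fifth card dealt has value `k`. -/
noncomputable def p5 (d : ℕ) (i j : Hand) (k : Fin 10) : ℝ :=
  p4 d i j
    * ((cards d k - delta k i.1.1 - delta k i.1.2 - delta k j.1.1 - delta k j.1.2) / (52 * d - 4))

/-- Probability that, in addition, the sixth card dealt has value `l`. -/
noncomputable def p6 (d : ℕ) (i j : Hand) (k l : Fin 10) : ℝ :=
  p5 d i j k
    * ((cards d l - delta l i.1.1 - delta l i.1.2 - delta l j.1.1 - delta l j.1.2 - delta l k)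
      / (52 * d - 5))

/-! ### Payoffs -/

/-- Banker's profit, with commission rate `α` on Banker wins, when Banker's final total minus
Player's final total is `x`. -/
noncomputable def profit (α : ℝ) (x : ℤ) : ℝ := if 0 < x then 1 - α else if x = 0 then 0 else -1

/-- The probability that the information set is reached if Player uses the pure strategy `u`. -/
noncomputable def infoProb (d : ℕ) (u : PlayerPure) : InfoSet → ℝ
  | (j, some k) => ∑ i ∈ drawSet u, p5 d i j k
  | (j, none) => ∑ i ∈ standSet u, p4 d i j

/-- Banker's conditional expected profit from standing at the information set. -/
noncomputable def standExp (d : ℕ) (α : ℝ) (u : PlayerPure) : InfoSet → ℝ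
  | (j, some k) =>
    (∑ i ∈ drawSet u, profit α ((total j.1 : ℤ) - (total3 i k : ℤ)) * p5 d i j k)
      / infoProb d u (j, some k)
  | (j, none) =>
    (∑ i ∈ standSet u, profit α ((total j.1 : ℤ) - (total i : ℤ)) * p4 d i j)
      / infoProb d u (j, none)

/-- Banker's conditional expected profit from drawing at the information set. -/
noncomputable def drawExp (d : ℕ) (α : ℝ) (u : PlayerPure) : InfoSet → ℝ
  | (j, some k) =>
    (∑ i ∈ drawSet u, ∑ l, profit α ((total3 j.1 l : ℤ) - (total3 i k : ℤ)) * p6 d i j k l)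
      / infoProb d u (j, some k)
  | (j, none) =>
    (∑ i ∈ standSet u, ∑ l, profit α ((total3 j.1 l : ℤ) - (total i : ℤ)) * p5 d i j l)
      / infoProb d u (j, none)

/-- The contribution of naturals to Banker's expected profit.  By symmetry, wins and losses cancel,
so that only the expected commission on Banker's winning naturals remains. -/
noncomputable def naturalTerm (d : ℕ) (α : ℝ) : ℝ :=
  -α * ∑ i : Hand, ∑ j : Hand, if 8 ≤ total j ∧ total i < total j then p4 d i j else 0

/-- Banker's payoff matrix in the casino game. -/
noncomputable def bankerPayoff (d : ℕ) (α : ℝ) (u : PlayerPure) (T : BankerPure) : ℝ :=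
  naturalTerm d α
    + ∑ l : InfoSet, infoProb d u l * (if l ∈ T then drawExp d α u l else standExp d α u l)

/-- Player's payoff matrix: no commission is paid on Player's bets. -/
noncomputable def playerPayoff (d : ℕ) (u : PlayerPure) (T : BankerPure) : ℝ :=
  -bankerPayoff d 0 u T

/-! ### Player's equilibrium strategy -/

/-- The hand `(a, b)`. -/
abbrev hand (a b : Fin 10) (h : a ≤ b := by decide) : Hand := ⟨(a, b), h⟩

/-- The hand `(a, b)`, not a natural. -/
abbrev live (a b : Fin 10) (h : a ≤ b := by decide) (h' : total (hand a b h) ≤ 7 := by decide) :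
    LiveHand := ⟨hand a b h, h'⟩

/-- The hand `(a, b)`, of total 5. -/
abbrev five (a b : Fin 10) (h : a ≤ b := by decide) (h' : total (hand a b h) = 5 := by decide) :
    FiveHand := ⟨hand a b h, h'⟩

/-- DSSDD: draw at `(0,5), (6,9), (7,8)`, stand at `(1,4), (2,3)`. -/
def pureDSSDD : PlayerPure := {five 0 5, five 6 9, five 7 8}

/-- DDSDD: draw at `(0,5), (1,4), (6,9), (7,8)`, stand at `(2,3)`. -/
def pureDDSDD : PlayerPure := {five 0 5, five 1 4, five 6 9, five 7 8}

/-- Player's equilibrium probability of drawing at `(1,4)`. -/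
noncomputable def playerProb (d : ℕ) (α : ℝ) : ℝ :=
  if d = 1 then (4 + 203 * α) / (2 * (38 - 21 * α))
  else ((12 * d - 1) * (16 * d ^ 2 - 14 * d + 1) + 8 * α * d * (112 * d ^ 2 - 24 * d + 1))
    / (32 * d ^ 2 * (11 * d - 1) - 16 * d ^ 2 * α * (12 * d - 1))

/-- Player's equilibrium strategy DMSDD. -/
noncomputable def playerStrategy (d : ℕ) (α : ℝ) : PlayerPure → ℝ :=
  mixture pureDSSDD pureDDSDD (playerProb d α)

/-! ### Best-response-discontinuity curves -/

/-- The probability of reaching `l` times the advantage to Banker of drawing over standing. -/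
noncomputable def advantage (d : ℕ) (α : ℝ) (u : PlayerPure) (l : InfoSet) : ℝ :=
  infoProb d u l * (drawExp d α u l - standExp d α u l)

/-- `p(l)`, the Player probability of DDSDD (as opposed to DSSDD) at which Banker is indifferent
between standing and drawing at `l`. -/
noncomputable def curve (d : ℕ) (α : ℝ) (l : InfoSet) : ℝ :=
  advantage d α pureDSSDD l / (advantage d α pureDSSDD l - advantage d α pureDDSDD l)

/-- The two curves whose intersection defines `β_i`. -/
def crossing : Fin 6 → InfoSet × InfoSet
  | 0 => ((live 0 6, none), (live 3 3, some 6))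
  | 1 => ((live 8 8, none), (live 5 8, some 8))
  | 2 => ((live 0 6, none), (live 6 9, some 4))
  | 3 => ((live 0 6, none), (live 0 5, some 4))
  | 4 => ((live 0 6, none), (live 1 4, some 4))
  | 5 => ((live 0 6, none), (live 2 3, some 4))

/-- The `β_i` that occur for `d` decks, in increasing order of the `β_i`, each given by its index
`i` and the numerical value of `β_i` rounded to seven decimals. -/
noncomputable def exceptional (d : ℕ) : List (Fin 6 × ℝ) :=
  match d with
  | 1 => [(1, 0.0655294)]
  | 2 => [(2, 0.0046904), (3, 0.0281623)]
  | 4 => [(0, 0.0120709)]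
  | 5 => [(0, 0.0392263)]
  | 6 => [(0, 0.0569147)]
  | 7 => [(0, 0.0693518)]
  | 8 => [(4, 0.0244435), (0, 0.0785740)]
  | 9 => [(5, 0.0056651), (4, 0.0763202), (0, 0.0856851)]
  | 10 => [(5, 0.0544215), (0, 0.0913356)]
  | 11 => [(5, 0.0932285), (0, 0.0959335)]
  | 12 => [(0, 0.0997480)]
  | _ => []

/-! ### Banker's equilibrium strategies -/

/-- Table entries: stand, draw, mix, or (`X`) look the entry up in the second table. -/
inductive Entry
  | S | D | M | X
  deriving DecidableEq

open Entry

/-- First table: Banker's move by Banker's two-card total and Player's third card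
`0, 1, …, 9, ∅`. -/
def summary : ℕ → List Entry
  | 0 => [D, D, D, D, D, D, D, D, D, D, D]
  | 1 => [D, D, D, D, D, D, D, D, D, D, D]
  | 2 => [D, D, D, D, D, D, D, D, D, D, D]
  | 3 => [D, D, D, D, D, D, D, D, X, D, D]
  | 4 => [S, X, D, D, D, D, D, D, S, S, D]
  | 5 => [S, S, S, S, X, D, D, D, S, S, D]
  | 6 => [S, S, S, S, S, S, X, D, S, S, X]
  | _ => [S, S, S, S, S, S, S, S, S, S, S]

/-- The five situations (Banker's two-card total, Player's third card) left open by the first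
table. -/
def openCells : List (ℕ × Option (Fin 10)) :=
  [(3, some 8), (4, some 1), (5, some 4), (6, none), (6, some 6)]

/-- The two-card hands with total 3, 4, 5, 6, in lexicographic order. -/
def handsOfTotal : ℕ → List (Fin 10 × Fin 10)
  | 3 => [(0, 3), (1, 2), (4, 9), (5, 8), (6, 7)]
  | 4 => [(0, 4), (1, 3), (2, 2), (5, 9), (6, 8), (7, 7)]
  | 5 => [(0, 5), (1, 4), (2, 3), (6, 9), (7, 8)]
  | 6 => [(0, 6), (1, 5), (2, 4), (3, 3), (7, 9), (8, 8)]
  | _ => []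

/-- Banker's behavior at `l` if the second table's row shows `pat`: five blocks, for the five open
situations, each listing the moves at the hands with the given total in lexicographic order. -/
def entry (pat : List (List Entry)) (l : InfoSet) : Entry :=
  let t := total l.1.1
  match (summary t).getD (l.2.elim 10 Fin.val) S with
  | X => (pat.getD (openCells.idxOf (t, l.2)) []).getD ((handsOfTotal t).idxOf l.1.1.1) S
  | e => e

/-- The Banker strategy with moves as in `pat`, where at the entry M Banker draws with probability
`q`. -/
noncomputable def bankerStrategy (pat : List (List Entry)) (q : ℝ) : BankerPure → ℝ :=
  mixture (Finset.univ.filter fun l => entry pat l = D)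
    (Finset.univ.filter fun l => entry pat l = D ∨ entry pat l = M) q

/-- The Banker drawing probabilities common to several values of `d`. -/
noncomputable def qForm (d : ℕ) (a b c e f : ℝ) : ℝ :=
  (a * d ^ 4 - b * d ^ 3 + c * d ^ 2 - e * d + f) / (256 * d ^ 2 * (11 * d - 1) * (52 * d - 5))

noncomputable def qA (d : ℕ) : ℝ := qForm d 92160 120128 26336 2000 47
noncomputable def qB (d : ℕ) : ℝ := qForm d 91776 119968 26320 2000 47
noncomputable def qC (d : ℕ) : ℝ := qForm d 91904 119680 26064 1932 41
noncomputable def qE (d : ℕ) : ℝ := qForm d 91648 119488 26032 1932 41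
noncomputable def qF (d : ℕ) : ℝ := qForm d 91520 119520 26048 1932 41

/-- Second table: Banker's strategies and mixing probabilities for `d` decks (`d ≥ 1`), one for
each of the successive `α`-intervals into which the `β_i` of `exceptional d` divide
`[0, 1/10]`. -/
noncomputable def rows (d : ℕ) : List (List (List Entry) × ℝ) :=
  if d = 1 then
    [([[S,S,D,S,D], [S,S,S,S,D,D], [S,S,S,S,S], [S,S,S,S,S,M], [D,D,D,S,D,D]], 4519 / 10716),
     ([[S,S,D,D,D], [S,S,S,S,D,D], [S,S,S,S,S], [S,S,S,S,S,M], [D,D,D,S,D,D]], 3991 / 10716)]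
  else if d = 2 then
    [([[S,S,S,S,S], [S,S,S,S,D,D], [D,S,S,D,D], [M,S,S,S,S,D], [D,D,D,S,D,D]], 17431 / 64512),
     ([[S,S,S,S,S], [S,S,S,S,D,D], [D,S,S,S,D], [M,S,S,S,S,D], [D,D,D,S,D,D]], 192637 / 709632),
     ([[S,S,S,S,S], [S,S,S,S,D,D], [S,S,S,S,D], [M,S,S,S,S,D], [D,D,D,S,D,D]], 65407 / 236544)]
  else if d = 3 then
    [([[S,S,S,S,S], [S,S,S,S,S,S], [D,S,S,D,D], [M,S,S,S,S,D], [D,D,D,S,D,D]], qB d)]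
  else if d ≤ 7 then
    [([[S,S,S,S,S], [S,S,S,S,S,S], [D,S,S,D,D], [M,S,S,S,S,D], [D,D,D,D,D,D]], qA d),
     ([[S,S,S,S,S], [S,S,S,S,S,S], [D,S,S,D,D], [M,S,S,S,S,D], [D,D,D,S,D,D]], qB d)]
  else if d = 8 then
    [([[S,S,S,S,S], [S,S,S,S,S,S], [D,D,S,D,D], [M,S,S,S,S,D], [D,D,D,D,D,D]], qC d),
     ([[S,S,S,S,S], [S,S,S,S,S,S], [D,S,S,D,D], [M,S,S,S,S,D], [D,D,D,D,D,D]], qA d),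
     ([[S,S,S,S,S], [S,S,S,S,S,S], [D,S,S,D,D], [M,S,S,S,S,D], [D,D,D,S,D,D]], qB d)]
  else if d = 9 then
    [([[S,S,S,S,S], [S,S,S,S,S,S], [D,D,D,D,D], [M,S,S,S,S,D], [D,D,D,D,D,D]], qE d),
     ([[S,S,S,S,S], [S,S,S,S,S,S], [D,D,S,D,D], [M,S,S,S,S,D], [D,D,D,D,D,D]], qC d),
     ([[S,S,S,S,S], [S,S,S,S,S,S], [D,S,S,D,D], [M,S,S,S,S,D], [D,D,D,D,D,D]], qA d),
     ([[S,S,S,S,S], [S,S,S,S,S,S], [D,S,S,D,D], [M,S,S,S,S,D], [D,D,D,S,D,D]], qB d)]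
  else if d ≤ 11 then
    [([[S,S,S,S,S], [S,S,S,S,S,S], [D,D,D,D,D], [M,S,S,S,S,D], [D,D,D,D,D,D]], qE d),
     ([[S,S,S,S,S], [S,S,S,S,S,S], [D,D,S,D,D], [M,S,S,S,S,D], [D,D,D,D,D,D]], qC d),
     ([[S,S,S,S,S], [S,S,S,S,S,S], [D,D,S,D,D], [M,S,S,S,S,D], [D,D,D,S,D,D]], qF d)]
  else if d = 12 then
    [([[S,S,S,S,S], [S,S,S,S,S,S], [D,D,D,D,D], [M,S,S,S,S,D], [D,D,D,D,D,D]], qE d),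
     ([[S,S,S,S,S], [S,S,S,S,S,S], [D,D,D,D,D], [M,S,S,S,S,D], [D,D,D,S,D,D]],
       1689974681 / 2989264896)]
  else
    [([[S,S,S,S,S], [S,S,S,S,S,S], [D,D,D,D,D], [M,S,S,S,S,D], [D,D,D,D,D,D]], qE d)]

/-- The number of exceptional values of `α` for `d` decks. -/
def exceptionalCount (d : ℕ) : ℕ :=
  if d = 9 then 3
  else if d = 2 ∨ d = 8 ∨ d = 10 ∨ d = 11 then 2
  else if d = 1 ∨ d = 4 ∨ d = 5 ∨ d = 6 ∨ d = 7 ∨ d = 12 then 1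
  else 0

end Baccara

/-!
Both payoffs separate. Against a fixed Player strategy, Banker's payoff is a constant plus the sum,
over the information sets at which he draws, of his advantages there
(`bankerPayoff_eq_add_sum_advantage`); against a fixed Banker strategy, Player's payoff is a
constant minus the sum, over the hands of total 5 at which he draws, of a gap
(`playerPayoff_eq`). So best replies are read off from signs (`banker_bestReply_iff`,
`player_bestReply_iff`), and the game of size `2^5 × 2^484` never has to be enumerated.

Player's probability `p` is the one that makes Banker indifferent at the set marked M in the table,
so the equilibrium conditions become the following. Banker's advantage against Player's strategy
has, at each other set, the sign that the table shows. Player's gap at `(1,4)` vanishes, which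
determines `q`; at the four other hands of total 5 it has the right sign. At a commission rate
`β_i` a second advantage vanishes, that at the set whose curve meets the curve of M. Banker then has
four pure best replies, given by the moves at these two sets. Player's gap at `(1,4)` is negative
for the two of them that stand at M and positive for the two that draw there. So a mixture of two of
them that leaves Player indifferent must combine one of each kind, and does so with a unique
probability: there are four equilibrium strategies of support size two
(`IsCrossing.setOf_isNash_eq`).

The signs are those of polynomials. A deal of given cards in a given order has probability a
product of affine functions of the number `d` of decks, divided by a product that depends on the
number of cards only, and this probability does not depend on the order (`dealCount_perm_right`).
Dealing the cards known to Banker first, Player's cards last, one sees that the advantage at an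
information set is a positive factor times a polynomial in `d` and `α`, of degree one in `α`
(`advantage_eq_line`); dealing Player's hand first, the same for Player's gap as a polynomial in `d`
(`playerGap_eq`). With Player's mixing probability inserted, the advantage becomes quadratic in `α`
(`mixAdvantage_eq`). All polynomials are integer coefficient lists in the variable `d - 1`, so that
the kernel can compute them. Positivity for `d ≤ 12` is tested by evaluation, and for `d ≥ 13` by
expansion at `13`, where all coefficients turn out to be nonnegative. On the interval `[0, 1/10]`
of commission rates, positivity is tested by means of Bernstein coefficients, and the exceptional
rates are enclosed by a change of sign of a monotone function (`exists_sign_change`). At the sets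
that the first table settles the two pure strategies in Player's mixture already give the same sign,
for all `d` and `α` at once (`robustCheck`).
-/

namespace Baccara

open Finset

/-! ### Best replies in bimatrix games -/

section Bimatrix

variable {I J : Type*} [Fintype I] [Fintype J]

theorem sum_sum_mul_eq_left (A : I → J → ℝ) (p : I → ℝ) (q : J → ℝ) :
    ∑ i, ∑ j, p i * A i j * q j = ∑ i, p i * ∑ j, A i j * q j := by
  simp only [Finset.mul_sum, mul_assoc]

theorem sum_sum_mul_eq_right (A : I → J → ℝ) (p : I → ℝ) (q : J → ℝ) :
    ∑ i, ∑ j, p i * A i j * q j = ∑ j, (∑ i, p i * A i j) * q j := by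
  rw [Finset.sum_comm]
  simp only [Finset.sum_mul]

/-- A linear function is maximal over the simplex at `p` as soon as all its coefficients are at
most `v` and those in the support of `p` equal `v`. -/
theorem sum_mul_le_of_support {p p' : I → ℝ} (hp : p ∈ stdSimplex ℝ I)
    (hp' : p' ∈ stdSimplex ℝ I) {f : I → ℝ} {v : ℝ} (hle : ∀ i, f i ≤ v)
    (heq : ∀ i, p i ≠ 0 → f i = v) : ∑ i, p' i * f i ≤ ∑ i, p i * f i := by
  have h1 : ∑ i, p i * f i = v := by
    have : ∀ i ∈ univ, p i * f i = p i * v := by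
      intro i _
      by_cases h : p i = 0
      · simp [h]
      · rw [heq i h]
    rw [Finset.sum_congr rfl this, ← Finset.sum_mul, hp.2, one_mul]
  rw [h1]
  calc ∑ i, p' i * f i ≤ ∑ i, p' i * v :=
        Finset.sum_le_sum fun i _ => mul_le_mul_of_nonneg_left (hle i) (hp'.1 i)
    _ = v := by rw [← Finset.sum_mul, hp'.2, one_mul]

/-- Conversely, if `p` maximizes a linear function over the simplex, then the coefficients in the
support of `p` are maximal. -/
theorem le_of_support_of_sum_mul_le {p : I → ℝ} [DecidableEq I] (hp : p ∈ stdSimplex ℝ I)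
    {f : I → ℝ} (hmax : ∀ p' ∈ stdSimplex ℝ I, ∑ i, p' i * f i ≤ ∑ i, p i * f i)
    {i : I} (hi : p i ≠ 0) (k : I) : f k ≤ f i := by
  set v := ∑ i, p i * f i with hv
  have hle : ∀ k, f k ≤ v := by
    intro k
    have := hmax _ (single_mem_stdSimplex ℝ k)
    simpa [Pi.single_apply] using this
  have h0 : ∑ k, p k * (v - f k) = 0 := by
    simp only [mul_sub, Finset.sum_sub_distrib, ← Finset.sum_mul, hp.2, one_mul]
    rw [← hv, sub_self]
  have h1 := (Finset.sum_eq_zero_iff_of_nonneg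
    (fun k _ => mul_nonneg (hp.1 k) (sub_nonneg.2 (hle k)))).1 h0 i (Finset.mem_univ i)
  have h2 : f i = v := by
    rcases mul_eq_zero.1 h1 with h | h
    · exact absurd h hi
    · linarith
  rw [h2]; exact hle k

theorem isNash_of_support {A B : I → J → ℝ} {p : I → ℝ} {q : J → ℝ} (hp : p ∈ stdSimplex ℝ I)
    (hq : q ∈ stdSimplex ℝ J)
    (hA : ∀ i, p i ≠ 0 → ∀ i', ∑ j, A i' j * q j ≤ ∑ j, A i j * q j)
    (hB : ∀ j, q j ≠ 0 → ∀ j', ∑ i, p i * B i j' ≤ ∑ i, p i * B i j) : IsNash A B p q := by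
  refine ⟨hp, hq, fun p' hp' => ?_, fun q' hq' => ?_⟩
  · obtain ⟨i₀, hi₀⟩ : ∃ i, p i ≠ 0 := by
      by_contra! h
      have := hp.2
      simp [h] at this
    rw [sum_sum_mul_eq_left, sum_sum_mul_eq_left]
    exact sum_mul_le_of_support hp hp' (fun i => hA i₀ hi₀ i)
      fun i hi => le_antisymm (hA i₀ hi₀ i) (hA i hi i₀)
  · obtain ⟨j₀, hj₀⟩ : ∃ j, q j ≠ 0 := by
      by_contra! h
      have := hq.2
      simp [h] at this
    rw [sum_sum_mul_eq_right, sum_sum_mul_eq_right]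
    simp only [mul_comm _ (q' _), mul_comm _ (q _)]
    exact sum_mul_le_of_support hq hq' (fun j => hB j₀ hj₀ j)
      fun j hj => le_antisymm (hB j₀ hj₀ j) (hB j hj j₀)

theorem IsNash.row_le [DecidableEq I] {A B : I → J → ℝ} {p : I → ℝ} {q : J → ℝ}
    (h : IsNash A B p q) {i : I} (hi : p i ≠ 0) (i' : I) :
    ∑ j, A i' j * q j ≤ ∑ j, A i j * q j := by
  refine le_of_support_of_sum_mul_le h.1 (f := fun i => ∑ j, A i j * q j) (fun p' hp' => ?_) hi i'
  have := h.2.2.1 p' hp'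
  rwa [sum_sum_mul_eq_left, sum_sum_mul_eq_left] at this

theorem IsNash.col_le [DecidableEq J] {A B : I → J → ℝ} {p : I → ℝ} {q : J → ℝ}
    (h : IsNash A B p q) {j : J} (hj : q j ≠ 0) (j' : J) :
    ∑ i, p i * B i j' ≤ ∑ i, p i * B i j := by
  refine le_of_support_of_sum_mul_le h.2.1 (f := fun j => ∑ i, p i * B i j) (fun q' hq' => ?_) hj j'
  have := h.2.2.2 q' hq'
  rw [sum_sum_mul_eq_right, sum_sum_mul_eq_right] at this
  simpa only [mul_comm _ (q' _), mul_comm _ (q _)] using this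

end Bimatrix

section Mixture

variable {I : Type*} [DecidableEq I]

theorem mixture_left {x y : I} (h : x ≠ y) (t : ℝ) : mixture x y t x = 1 - t := by
  simp [mixture, h]

theorem mixture_right {x y : I} (h : x ≠ y) (t : ℝ) : mixture x y t y = t := by
  simp [mixture, h.symm]

theorem mixture_other {x y z : I} (hx : z ≠ x) (hy : z ≠ y) (t : ℝ) : mixture x y t z = 0 := by
  simp [mixture, hx, hy]

theorem sum_mixture_mul [Fintype I] (x y : I) (t : ℝ) (f : I → ℝ) :
    ∑ i, mixture x y t i * f i = (1 - t) * f x + t * f y := by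
  simp [mixture, add_mul, Finset.sum_add_distrib]

theorem mixture_mem_stdSimplex [Fintype I] (x y : I) {t : ℝ} (h0 : 0 ≤ t) (h1 : t ≤ 1) :
    mixture x y t ∈ stdSimplex ℝ I := by
  refine ⟨fun i => ?_, ?_⟩
  · unfold mixture
    split_ifs <;> linarith
  · have := sum_mixture_mul x y t fun _ => 1
    simpa using this

theorem support_mixture {x y : I} (h : x ≠ y) {t : ℝ} (h0 : 0 < t) (h1 : t < 1) :
    Function.support (mixture x y t) = {x, y} := by
  ext z
  by_cases hx : z = x
  · subst hx
    simp [mixture_left h, sub_ne_zero.2 h1.ne']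
  by_cases hy : z = y
  · subst hy
    simp [mixture_right h, h0.ne']
  simp [mixture_other hx hy, hx, hy]

end Mixture

/-! ### Separation of the payoffs -/

theorem four_le_cards {d : ℕ} (hd : 1 ≤ d) (c : Fin 10) : 4 ≤ cards d c := by
  have : (1 : ℝ) ≤ d := by exact_mod_cast hd
  unfold cards delta
  split_ifs <;> nlinarith

theorem delta_le_one (i j : Fin 10) : delta i j ≤ 1 := by unfold delta; split_ifs <;> norm_num

theorem p4_nonneg {d : ℕ} (hd : 1 ≤ d) (i j : Hand) : 0 ≤ p4 d i j := by
  have h1 : (1 : ℝ) ≤ d := by exact_mod_cast hd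
  have hc := four_le_cards hd
  have hδ := delta_le_one
  unfold p4
  refine mul_nonneg (mul_nonneg (mul_nonneg (mul_nonneg ?_ ?_) ?_) (mul_nonneg ?_ ?_)) ?_
  · linarith [hδ i.1.1 i.1.2]
  · exact div_nonneg (by linarith [hc i.1.1]) (by linarith)
  · exact div_nonneg (by linarith [hc i.1.2, hδ i.1.2 i.1.1]) (by linarith)
  · linarith [hδ j.1.1 j.1.2]
  · exact div_nonneg (by linarith [hc j.1.1, hδ j.1.1 i.1.1, hδ j.1.1 i.1.2]) (by linarith)
  · exact div_nonneg (by linarith [hc j.1.2, hδ j.1.2 i.1.1, hδ j.1.2 i.1.2, hδ j.1.2 j.1.1])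
      (by linarith)

theorem p5_nonneg {d : ℕ} (hd : 1 ≤ d) (i j : Hand) (k : Fin 10) : 0 ≤ p5 d i j k := by
  have h1 : (1 : ℝ) ≤ d := by exact_mod_cast hd
  have hδ := delta_le_one k
  refine mul_nonneg (p4_nonneg hd i j) (div_nonneg ?_ (by linarith))
  linarith [four_le_cards hd k, hδ i.1.1, hδ i.1.2, hδ j.1.1, hδ j.1.2]

/-- Probability that Player holds `i` and Banker's information set is `l`, if Player draws or
stands at `i` as `l` says. -/
noncomputable def hitProb (d : ℕ) (i : Hand) : InfoSet → ℝ
  | (j, some k) => p5 d i j k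
  | (j, none) => p4 d i j

/-- The hands of Player that are compatible with `l` if Player uses `u`. -/
def reachSet (u : PlayerPure) : InfoSet → Finset Hand
  | (_, some _) => drawSet u
  | (_, none) => standSet u

/-- Player's final total at `l` with the two-card hand `i`. -/
def playerTotal (i : Hand) : InfoSet → ℕ
  | (_, some k) => total3 i k
  | (_, none) => total i

/-- Contribution of Player's hand `i` to Banker's expected profit from standing at `l`. -/
noncomputable def standTerm (d : ℕ) (α : ℝ) (i : Hand) (l : InfoSet) : ℝ :=
  profit α ((total l.1.1 : ℤ) - (playerTotal i l : ℤ)) * hitProb d i l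

/-- Contribution of Player's hand `i` to Banker's expected profit from drawing at `l`. -/
noncomputable def drawTerm (d : ℕ) (α : ℝ) (i : Hand) : InfoSet → ℝ
  | (j, some k) => ∑ c, profit α ((total3 j.1 c : ℤ) - (total3 i k : ℤ)) * p6 d i j k c
  | (j, none) => ∑ c, profit α ((total3 j.1 c : ℤ) - (total i : ℤ)) * p5 d i j c

/-- Contribution of Player's hand `i` to the advantage of drawing over standing at `l`. -/
noncomputable def gainTerm (d : ℕ) (α : ℝ) (i : Hand) (l : InfoSet) : ℝ :=
  drawTerm d α i l - standTerm d α i l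

theorem hitProb_nonneg {d : ℕ} (hd : 1 ≤ d) (i : Hand) (l : InfoSet) : 0 ≤ hitProb d i l := by
  rcases l with ⟨j, _ | k⟩
  · exact p4_nonneg hd i j
  · exact p5_nonneg hd i j k

theorem infoProb_eq (d : ℕ) (u : PlayerPure) (l : InfoSet) :
    infoProb d u l = ∑ i ∈ reachSet u l, hitProb d i l := by
  rcases l with ⟨j, _ | k⟩ <;> rfl

theorem drawTerm_eq_zero {d : ℕ} {α : ℝ} {i : Hand} {l : InfoSet} (h : hitProb d i l = 0) :
    drawTerm d α i l = 0 := by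
  rcases l with ⟨j, _ | k⟩
  · simp only [hitProb] at h
    simp [drawTerm, p5, h]
  · simp only [hitProb] at h
    simp [drawTerm, p6, h]

/-- Multiplying by the probability of an information set undoes the conditioning; no information
set needs to be excluded, since all the terms vanish where the probability does. -/
theorem mul_sum_div_sum {ι : Type*} (s : Finset ι) {w f : ι → ℝ} (hw : ∀ i ∈ s, 0 ≤ w i)
    (hf : ∀ i ∈ s, w i = 0 → f i = 0) :
    (∑ i ∈ s, w i) * ((∑ i ∈ s, f i) / ∑ i ∈ s, w i) = ∑ i ∈ s, f i := by
  by_cases h : ∑ i ∈ s, w i = 0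
  · have h0 := (Finset.sum_eq_zero_iff_of_nonneg hw).1 h
    rw [h, zero_mul, Finset.sum_eq_zero fun i hi => hf i hi (h0 i hi)]
  · rw [mul_div_cancel₀ _ h]

theorem infoProb_mul_standExp {d : ℕ} (hd : 1 ≤ d) (α : ℝ) (u : PlayerPure) (l : InfoSet) :
    infoProb d u l * standExp d α u l = ∑ i ∈ reachSet u l, standTerm d α i l := by
  have h := mul_sum_div_sum (reachSet u l) (w := fun i => hitProb d i l)
    (f := fun i => standTerm d α i l) (fun i _ => hitProb_nonneg hd i l)
    (fun i _ h => by simp [standTerm, h])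
  rw [← infoProb_eq] at h
  rw [← h]
  rcases l with ⟨j, _ | k⟩ <;> rfl

theorem infoProb_mul_drawExp {d : ℕ} (hd : 1 ≤ d) (α : ℝ) (u : PlayerPure) (l : InfoSet) :
    infoProb d u l * drawExp d α u l = ∑ i ∈ reachSet u l, drawTerm d α i l := by
  have h := mul_sum_div_sum (reachSet u l) (w := fun i => hitProb d i l)
    (f := fun i => drawTerm d α i l) (fun i _ => hitProb_nonneg hd i l)
    (fun i _ h => drawTerm_eq_zero h)
  rw [← infoProb_eq] at h
  rw [← h]
  rcases l with ⟨j, _ | k⟩ <;> rfl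

theorem advantage_eq {d : ℕ} (hd : 1 ≤ d) (α : ℝ) (u : PlayerPure) (l : InfoSet) :
    advantage d α u l = ∑ i ∈ reachSet u l, gainTerm d α i l := by
  simp only [advantage, mul_sub, infoProb_mul_standExp hd, infoProb_mul_drawExp hd, gainTerm,
    Finset.sum_sub_distrib]

theorem bankerPayoff_eq {d : ℕ} (hd : 1 ≤ d) (α : ℝ) (u : PlayerPure) (T : BankerPure) :
    bankerPayoff d α u T = naturalTerm d α + ∑ l : InfoSet, ∑ i ∈ reachSet u l,
      (standTerm d α i l + if l ∈ T then gainTerm d α i l else 0) := by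
  unfold bankerPayoff
  congr 1
  refine Finset.sum_congr rfl fun l _ => ?_
  split_ifs
  · rw [infoProb_mul_drawExp hd]
    exact Finset.sum_congr rfl fun i _ => by unfold gainTerm; ring
  · rw [infoProb_mul_standExp hd]
    simp

/-- Banker's payoff splits over the information sets. -/
theorem bankerPayoff_eq_add_sum_advantage {d : ℕ} (hd : 1 ≤ d) (α : ℝ) (u : PlayerPure)
    (T : BankerPure) :
    bankerPayoff d α u T = bankerPayoff d α u ∅ + ∑ l ∈ T, advantage d α u l := by
  simp only [bankerPayoff_eq hd, Finset.sum_add_distrib, Finset.notMem_empty, if_false,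
    add_zero, add_assoc]
  congr 2
  rw [← Finset.sum_filter_add_sum_filter_not univ (fun l => l ∈ T)]
  have h1 : ∑ l ∈ univ.filter (fun l => ¬ l ∈ T), ∑ i ∈ reachSet u l,
      (if l ∈ T then gainTerm d α i l else 0) = 0 :=
    Finset.sum_eq_zero fun l hl => by simp [(Finset.mem_filter.1 hl).2]
  rw [h1, add_zero, Finset.filter_mem_eq_inter, Finset.univ_inter]
  refine Finset.sum_congr rfl fun l hl => ?_
  simp [hl, advantage_eq hd]

/-- `1` where Player has drawn, `-1` where Player has stood. -/
def side (l : InfoSet) : ℤ := if l.2 = none then -1 else 1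

theorem sum_drawSet (u : PlayerPure) (f : Hand → ℝ) :
    ∑ i ∈ drawSet u, f i = ∑ i ∈ drawSet ∅, f i + ∑ x ∈ u, f x.1 := by
  have h : drawSet u = drawSet ∅ ∪ u.map ⟨Subtype.val, Subtype.val_injective⟩ := by
    ext h; simp [drawSet]
  rw [h, Finset.sum_union, Finset.sum_map]
  · rfl
  · rw [Finset.disjoint_left]
    intro i hi hi'
    obtain ⟨x, _, rfl⟩ := Finset.mem_map.1 hi'
    have := x.2
    simp [drawSet] at hi
    omega

theorem sum_standSet (u : PlayerPure) (f : Hand → ℝ) :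
    ∑ i ∈ standSet u, f i = ∑ i ∈ standSet ∅, f i - ∑ x ∈ u, f x.1 := by
  have h : standSet ∅ = standSet u ∪ u.map ⟨Subtype.val, Subtype.val_injective⟩ := by
    ext h
    simp only [standSet, drawSet, Finset.mem_filter, Finset.mem_univ, true_and,
      Finset.notMem_empty, false_and, exists_false, or_false, not_or, not_le, Finset.mem_union,
      Finset.mem_map, Function.Embedding.coeFn_mk]
    constructor
    · intro ⟨h1, h2⟩
      by_cases h3 : ∃ a ∈ u, a.1 = h
      · exact Or.inr h3
      · exact Or.inl ⟨h1, h2, h3⟩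
    · rintro (h1 | ⟨a, _, rfl⟩)
      · exact ⟨h1.1, h1.2.1⟩
      · have := a.2
        omega
  rw [h, Finset.sum_union, Finset.sum_map]
  · simp
  · rw [Finset.disjoint_left]
    intro i hi hi'
    obtain ⟨x, hx, rfl⟩ := Finset.mem_map.1 hi'
    simp only [standSet, drawSet, Finset.mem_filter, Finset.mem_univ, true_and, not_or] at hi
    exact hi.2.2 ⟨x, hx, rfl⟩

theorem sum_reachSet (u : PlayerPure) (l : InfoSet) (f : Hand → ℝ) :
    ∑ i ∈ reachSet u l, f i = ∑ i ∈ reachSet ∅ l, f i + side l * ∑ x ∈ u, f x.1 := by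
  rcases l with ⟨j, _ | k⟩
  · simp only [reachSet, side, if_true]
    rw [sum_standSet]; push_cast; ring
  · simp only [reachSet, side]
    rw [sum_drawSet]; simp

/-- Increase of Banker's expected profit, without commission, when Player changes from standing to
drawing at the hand `x` of total 5. -/
noncomputable def playerGap (d : ℕ) (x : FiveHand) (T : BankerPure) : ℝ :=
  ∑ l : InfoSet, side l * (standTerm d 0 x.1 l + if l ∈ T then gainTerm d 0 x.1 l else 0)

/-- Player's payoff splits over the hands of total 5. -/
theorem playerPayoff_eq {d : ℕ} (hd : 1 ≤ d) (u : PlayerPure) (T : BankerPure) :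
    playerPayoff d u T = playerPayoff d ∅ T - ∑ x ∈ u, playerGap d x T := by
  unfold playerPayoff
  rw [bankerPayoff_eq hd, bankerPayoff_eq hd 0 ∅]
  simp only [sum_reachSet u, Finset.sum_add_distrib (s := (univ : Finset InfoSet)), playerGap]
  rw [Finset.sum_comm (s := u)]
  simp only [Finset.mul_sum]
  ring

theorem pureDDSDD_eq : pureDDSDD = insert (five 1 4) pureDSSDD := by decide

theorem five_one_four_notMem : five 1 4 ∉ pureDSSDD := by decide

/-- The two pure strategies that Player mixes differ at the hand `(1,4)` only. -/
theorem advantage_pureDDSDD {d : ℕ} (hd : 1 ≤ d) (α : ℝ) (l : InfoSet) :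
    advantage d α pureDDSDD l
      = advantage d α pureDSSDD l + side l * gainTerm d α (hand 1 4) l := by
  rw [advantage_eq hd, advantage_eq hd, sum_reachSet, sum_reachSet pureDSSDD, pureDDSDD_eq,
    Finset.sum_insert five_one_four_notMem]
  ring

/-! ### Integer polynomials as coefficient lists -/

/-- The value at `x` of the polynomial with coefficient list `p`, constant term first. -/
noncomputable def peval (p : List ℤ) (x : ℝ) : ℝ := p.foldr (fun a s => a + x * s) 0

/-- The value at an integer of the polynomial with coefficient list `p`. -/
def zeval (p : List ℤ) (x : ℤ) : ℤ := p.foldr (fun a s => a + x * s) 0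

/-- Sum of coefficient lists. -/
def padd : List ℤ → List ℤ → List ℤ
  | [], q => q
  | a :: p, [] => a :: p
  | a :: p, b :: q => (a + b) :: padd p q

/-- Integer multiple of a coefficient list. -/
def psmul (a : ℤ) (p : List ℤ) : List ℤ := p.map (a * ·)

/-- Product of coefficient lists. -/
def pmul (p q : List ℤ) : List ℤ := p.foldr (fun a s => padd (psmul a q) (0 :: s)) []

/-- Coefficient list of the polynomial `p (x + c)`. -/
def pshift (c : ℤ) (p : List ℤ) : List ℤ := p.foldr (fun a s => padd [a] (pmul [c, 1] s)) []

/-- Sum of a list of coefficient lists. -/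
def psum (L : List (List ℤ)) : List ℤ := L.foldr padd []

@[simp] theorem peval_nil (x : ℝ) : peval [] x = 0 := rfl

@[simp] theorem peval_cons (a : ℤ) (p : List ℤ) (x : ℝ) :
    peval (a :: p) x = a + x * peval p x := rfl

theorem peval_intCast (p : List ℤ) (x : ℤ) : peval p x = zeval p x := by
  induction p with
  | nil => simp [zeval]
  | cons a p ih => rw [peval_cons, ih]; simp [zeval]

@[simp] theorem peval_padd (p q : List ℤ) (x : ℝ) :
    peval (padd p q) x = peval p x + peval q x := by
  induction p generalizing q with
  | nil => simp [padd]
  | cons a p ih =>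
    cases q with
    | nil => simp [padd]
    | cons b q => simp only [padd, peval_cons, ih]; push_cast; ring

@[simp] theorem peval_psmul (a : ℤ) (p : List ℤ) (x : ℝ) :
    peval (psmul a p) x = a * peval p x := by
  induction p with
  | nil => simp [psmul]
  | cons b p ih =>
    have : psmul a (b :: p) = (a * b) :: psmul a p := rfl
    rw [this, peval_cons, ih, peval_cons]; push_cast; ring

@[simp] theorem peval_pmul (p q : List ℤ) (x : ℝ) :
    peval (pmul p q) x = peval p x * peval q x := by
  induction p with
  | nil => simp [pmul]
  | cons a p ih =>
    have : pmul (a :: p) q = padd (psmul a q) (0 :: pmul p q) := rfl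
    rw [this, peval_padd, peval_psmul, peval_cons, ih, peval_cons]; push_cast; ring

@[simp] theorem peval_pshift (c : ℤ) (p : List ℤ) (x : ℝ) :
    peval (pshift c p) x = peval p (x + c) := by
  induction p with
  | nil => simp [pshift]
  | cons a p ih =>
    have : pshift c (a :: p) = padd [a] (pmul [c, 1] (pshift c p)) := rfl
    rw [this, peval_padd, peval_pmul, ih]; simp only [peval_cons, peval_nil]; push_cast; ring

theorem peval_psum (L : List (List ℤ)) (x : ℝ) :
    peval (psum L) x = (L.map fun p => peval p x).sum := by
  induction L with
  | nil => simp [psum]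
  | cons p L ih =>
    have : psum (p :: L) = padd p (psum L) := rfl
    rw [this, peval_padd, ih]; simp

/-- All coefficients are nonnegative and the constant one is positive. -/
def coeffPos : List ℤ → Bool
  | [] => false
  | a :: q => decide (0 < a) && q.all fun b => decide (0 ≤ b)

theorem peval_nonneg {p : List ℤ} (hp : ∀ b ∈ p, 0 ≤ b) {x : ℝ} (hx : 0 ≤ x) :
    0 ≤ peval p x := by
  induction p with
  | nil => simp
  | cons a p ih =>
    rw [peval_cons]
    have h1 : (0 : ℝ) ≤ a := by exact_mod_cast hp a (by simp)
    have h2 := ih fun b hb => hp b (by simp [hb])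
    positivity

theorem peval_pos_of_coeffPos {p : List ℤ} (hp : coeffPos p = true) {x : ℝ} (hx : 0 ≤ x) :
    0 < peval p x := by
  cases p with
  | nil => simp [coeffPos] at hp
  | cons a p =>
    simp only [coeffPos, Bool.and_eq_true, decide_eq_true_eq, List.all_eq_true] at hp
    rw [peval_cons]
    have h1 : (0 : ℝ) < a := by exact_mod_cast hp.1
    have h2 := peval_nonneg hp.2 hx
    positivity

/-- A sufficient condition for positivity, at the number `d` of decks if `d ≤ 12`, and at all
numbers `≥ 13` otherwise; the variable of the polynomial is the number of decks minus one. -/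
def posAt (d : ℕ) (p : List ℤ) : Bool :=
  bif Nat.ble d 12 then decide (0 < zeval p (d - 1)) else coeffPos (pshift 12 p)

/-- A test for vanishing, at the number `d` of decks if `d ≤ 12`, and everywhere otherwise. -/
def zeroAt (d : ℕ) (p : List ℤ) : Bool :=
  bif Nat.ble d 12 then decide (zeval p (d - 1) = 0) else p.all fun b => decide (b = 0)

theorem peval_pos_of_posAt {d : ℕ} {p : List ℤ} (h : posAt (min d 13) p = true) :
    0 < peval p ((d : ℝ) - 1) := by
  rcases le_or_gt d 12 with hd | hd
  · rw [min_eq_left (by omega)] at h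
    have hb : Nat.ble d 12 = true := Nat.ble_eq_true_of_le hd
    simp only [posAt, hb, cond_true, decide_eq_true_eq] at h
    have := peval_intCast p ((d : ℤ) - 1)
    push_cast at this
    rw [this]; exact_mod_cast h
  · rw [min_eq_right (by omega)] at h
    have hb : Nat.ble 13 12 = false := by decide
    simp only [posAt, hb, cond_false] at h
    have hd' : (13 : ℝ) ≤ d := by exact_mod_cast hd
    have := peval_pos_of_coeffPos h (x := (d : ℝ) - 13) (by linarith)
    rw [peval_pshift] at this
    convert this using 2
    push_cast; ring

theorem peval_eq_zero_of_zeroAt {d : ℕ} {p : List ℤ} (h : zeroAt (min d 13) p = true) :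
    peval p ((d : ℝ) - 1) = 0 := by
  rcases le_or_gt d 12 with hd | hd
  · rw [min_eq_left (by omega)] at h
    have hb : Nat.ble d 12 = true := Nat.ble_eq_true_of_le hd
    simp only [zeroAt, hb, cond_true, decide_eq_true_eq] at h
    have := peval_intCast p ((d : ℤ) - 1)
    push_cast at this
    rw [this, h]; simp
  · rw [min_eq_right (by omega)] at h
    have hb : Nat.ble 13 12 = false := by decide
    simp only [zeroAt, hb, cond_false, List.all_eq_true, decide_eq_true_eq] at h
    generalize (d : ℝ) - 1 = x
    induction p with
    | nil => simp
    | cons a p ih =>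
      rw [peval_cons, ih fun b hb => h b (by simp [hb]), h a (by simp)]; simp

/-! ### Dealing from the shoe -/

/-- The number of cards of value `c` left in the shoe after the cards `S` have been dealt. -/
noncomputable def left (d : ℕ) (S : List (Fin 10)) (c : Fin 10) : ℝ :=
  cards d c - (S.map (delta c)).sum

/-- The number of ways to deal cards of the values `cs` in succession, after the cards `S`. -/
noncomputable def dealCount (d : ℕ) : List (Fin 10) → List (Fin 10) → ℝ
  | _, [] => 1
  | S, c :: cs => left d S c * dealCount d (c :: S) cs

theorem left_perm {d : ℕ} {S S' : List (Fin 10)} (h : S.Perm S') (c : Fin 10) :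
    left d S c = left d S' c := by
  unfold left; rw [(h.map _).sum_eq]

theorem dealCount_perm_left {d : ℕ} {S S' : List (Fin 10)} (h : S.Perm S') (cs : List (Fin 10)) :
    dealCount d S cs = dealCount d S' cs := by
  induction cs generalizing S S' with
  | nil => rfl
  | cons c cs ih => rw [dealCount, dealCount, left_perm h, ih (h.cons c)]

/-- The order in which cards are dealt does not matter. -/
theorem dealCount_perm_right {d : ℕ} {cs cs' : List (Fin 10)} (h : cs.Perm cs')
    (S : List (Fin 10)) : dealCount d S cs = dealCount d S cs' := by
  induction h generalizing S with
  | nil => rfl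
  | cons c _ ih => rw [dealCount, dealCount, ih]
  | swap a b cs =>
    simp only [dealCount]
    rw [dealCount_perm_left (List.Perm.swap a b S)]
    by_cases hab : a = b
    · subst hab; ring
    · have h1 : left d (b :: S) a = left d S a := by
        simp [left, delta, hab]
      have h2 : left d (a :: S) b = left d S b := by
        simp [left, delta, Ne.symm hab]
      rw [h1, h2]; ring
  | trans _ _ ih1 ih2 => rw [ih1, ih2]

theorem dealCount_append (d : ℕ) (S cs cs' : List (Fin 10)) :
    dealCount d S (cs ++ cs') = dealCount d S cs * dealCount d (cs ++ S) cs' := by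
  induction cs generalizing S with
  | nil => simp [dealCount]
  | cons c cs ih =>
    rw [List.cons_append, dealCount, dealCount, ih,
      dealCount_perm_left (List.perm_middle (a := c) (l₁ := cs) (l₂ := S)), mul_assoc]
    rfl

/-- The number of orders in which a two-card hand can be dealt. -/
noncomputable def orders (h : Hand) : ℝ := 2 - delta h.1.1 h.1.2

/-- The cards that Banker knows at `l`. -/
def seen (l : InfoSet) : List (Fin 10) := l.1.1.1.1 :: l.1.1.1.2 :: l.2.toList

/-- The cards on the table at `l` if Player holds `i`. -/
def table (i : Hand) (l : InfoSet) : List (Fin 10) := i.1.1 :: i.1.2 :: seen l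

/-- The number of ways to deal `n` cards in succession. -/
noncomputable def dealAll (d n : ℕ) : ℝ := ∏ m ∈ Finset.range n, (52 * (d : ℝ) - m)

theorem hitProb_eq (d : ℕ) (i : Hand) (l : InfoSet) :
    hitProb d i l = orders i * orders l.1.1 * dealCount d [] (table i l)
      / dealAll d (table i l).length := by
  rcases l with ⟨j, _ | k⟩
  · simp only [hitProb, p4, orders, table, seen, Option.toList, dealCount, left, dealAll,
      List.length_cons, List.length_nil, Finset.prod_range_succ, Finset.prod_range_zero,
      List.map_cons, List.map_nil, List.sum_cons, List.sum_nil, div_eq_mul_inv, mul_inv]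
    push_cast
    simp only [sub_zero, add_zero, one_mul, mul_one, sub_add_eq_sub_sub_swap, inv_one,
      mul_inv]
    ring
  · simp only [hitProb, p5, p4, orders, table, seen, Option.toList, dealCount, left, dealAll,
      List.length_cons, List.length_nil, Finset.prod_range_succ, Finset.prod_range_zero,
      List.map_cons, List.map_nil, List.sum_cons, List.sum_nil, div_eq_mul_inv, mul_inv]
    push_cast
    simp only [sub_zero, add_zero, one_mul, mul_one, sub_add_eq_sub_sub_swap, inv_one,
      mul_inv]
    ring

/-- Expected change of `f`, times the number of cards left in the shoe, if a card is added to a hand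
of total `s`, where `t` is the opponent's total and the cards `S` have been dealt. -/
noncomputable def edge (d : ℕ) (f : ℕ → ℕ → ℝ) (s t : ℕ) (S : List (Fin 10)) : ℝ :=
  ∑ c : Fin 10, f ((s + c) % 10) t * left d S c - f s t * (52 * d - S.length)

theorem total3_eq (h : Hand) (k : Fin 10) : total3 h k = (total h + k) % 10 := by
  unfold total3 total; omega

theorem gainTerm_eq (d : ℕ) (hd : 1 ≤ d) (α : ℝ) (i : Hand) (l : InfoSet) :
    gainTerm d α i l = hitProb d i l / (52 * d - (table i l).length)
      * edge d (fun a t => profit α ((a : ℤ) - t)) (total l.1.1) (playerTotal i l) (table i l) := by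
  have h1 : (1 : ℝ) ≤ d := by exact_mod_cast hd
  rcases l with ⟨j, _ | k⟩
  · have h2 : (52 * (d : ℝ) - 4) ≠ 0 := by linarith
    simp only [gainTerm, drawTerm, standTerm, hitProb, playerTotal, edge, p5, table, seen,
      Option.toList, List.length_cons, List.length_nil, total3_eq, left,
      List.map_cons, List.map_nil, List.sum_cons, List.sum_nil]
    push_cast
    rw [mul_sub, Finset.mul_sum]
    congr 1
    · refine Finset.sum_congr rfl fun c _ => ?_
      ring
    · field_simp
  · have h2 : (52 * (d : ℝ) - 5) ≠ 0 := by linarith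
    simp only [gainTerm, drawTerm, standTerm, hitProb, playerTotal, edge, p6, table, seen,
      Option.toList, List.length_cons, List.length_nil, total3_eq, left,
      List.map_cons, List.map_nil, List.sum_cons, List.sum_nil]
    push_cast
    rw [mul_sub, Finset.mul_sum]
    congr 1
    · refine Finset.sum_congr rfl fun c _ => ?_
      ring
    · field_simp

/-! ### Counting polynomials

The variable of all polynomials is the number of decks minus one, which makes the polynomials that
count deals have nonnegative coefficients. -/

/-- `1` if a total `a` beats a total `t`. -/
def win (a t : ℕ) : ℕ := bif Nat.blt t a then 1 else 0

/-- `1` if a total `a` does not lose to a total `t`. -/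
def geq (a t : ℕ) : ℕ := bif Nat.ble t a then 1 else 0

/-- One more than the profit without commission. -/
def score (a t : ℕ) : ℕ := geq a t + win a t

theorem profit_eq (α : ℝ) (a t : ℕ) :
    profit α ((a : ℤ) - t) = geq a t - 1 + (1 - α) * win a t := by
  rcases lt_trichotomy t a with h | h | h
  · have h1 : Nat.blt t a = true := by simpa [Nat.blt_eq] using h
    have h2 : Nat.ble t a = true := by simpa using h.le
    have h3 : (0 : ℤ) < a - t := by omega
    simp only [profit, win, geq, h1, h2, if_pos h3, cond_true]
    push_cast; ring
  · subst h
    have h1 : Nat.blt t t = false := by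
      rw [Bool.eq_false_iff, Ne, Nat.blt_eq]; omega
    have h2 : Nat.ble t t = true := by simp
    simp [profit, win, geq, h1, h2]
  · have h1 : Nat.blt t a = false := by
      rw [Bool.eq_false_iff, Ne, Nat.blt_eq]; omega
    have h2 : Nat.ble t a = false := by
      rw [Bool.eq_false_iff, Ne, Nat.ble_eq]; omega
    have h3 : ¬ (0 : ℤ) < a - t := by omega
    have h4 : ¬ (a : ℤ) - t = 0 := by omega
    simp only [profit, win, geq, h1, h2, if_neg h3, if_neg h4, cond_false]
    push_cast; ring

theorem profit_zero_eq (a t : ℕ) : profit 0 ((a : ℤ) - t) = score a t - 1 := by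
  rw [profit_eq, score]; push_cast; ring

/-- The number of occurrences of `c` in `cs`. -/
def cnt (c : ℕ) (cs : List ℕ) : ℕ := cs.foldr (fun x n => bif Nat.beq x c then n + 1 else n) 0

/-- The number of cards of value `c` per deck, times four. -/
def mult (c : ℕ) : ℕ := bif Nat.beq c 0 then 16 else 4

theorem left_eq (d : ℕ) (S : List (Fin 10)) (c : Fin 10) :
    left d S c = (mult c - cnt c (S.map Fin.val)) + mult c * ((d : ℝ) - 1) := by
  have h1 : cards d c = mult c * d := by
    by_cases hc : c = 0
    · subst hc
      simp [cards, delta, mult]; ring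
    · have : Nat.beq c 0 = false := by
        rw [Bool.eq_false_iff]
        simp only [ne_eq, Nat.beq_eq]
        exact fun h => hc (Fin.ext h)
      simp only [cards, delta, mult, this, hc, if_false, cond_false]
      push_cast; ring
  have h2 : (S.map (delta c)).sum = cnt c (S.map Fin.val) := by
    induction S with
    | nil => simp [cnt]
    | cons x S ih =>
      have h3 : cnt c ((x :: S).map Fin.val)
          = bif Nat.beq x c then cnt c (S.map Fin.val) + 1 else cnt c (S.map Fin.val) := rfl
      rw [List.map_cons, List.sum_cons, ih, h3]
      by_cases hc : c = x
      · subst hc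
        simp [delta]; ring
      · have : Nat.beq x c = false := by
          rw [Bool.eq_false_iff]
          simp only [ne_eq, Nat.beq_eq]
          exact fun h => hc (Fin.ext h.symm)
        simp [delta, hc, this]
  rw [left, h1, h2]; ring

theorem cnt_le_length (c : ℕ) (cs : List ℕ) : cnt c cs ≤ cs.length := by
  induction cs with
  | nil => simp [cnt]
  | cons x cs ih =>
    have h : cnt c (x :: cs) = bif Nat.beq x c then cnt c cs + 1 else cnt c cs := rfl
    rw [h, List.length_cons]
    cases Nat.beq x c <;> simp <;> omega

theorem four_le_mult (c : ℕ) : 4 ≤ mult c := by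
  unfold mult; cases Nat.beq c 0 <;> simp

/-- Number of cards of value `c` left after the cards `S`. -/
def leftPoly (S : List ℕ) (c : ℕ) : List ℤ := [(mult c : ℤ) - (cnt c S : ℤ), (mult c : ℤ)]

/-- Number of ways to deal the values `cs` in succession after the cards `S`. -/
def dealPoly : List ℕ → List ℕ → List ℤ
  | _, [] => [1]
  | S, c :: cs => pmul (leftPoly S c) (dealPoly (c :: S) cs)

theorem peval_dealPoly (d : ℕ) (S cs : List (Fin 10)) :
    peval (dealPoly (S.map Fin.val) (cs.map Fin.val)) ((d : ℝ) - 1) = dealCount d S cs := by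
  induction cs generalizing S with
  | nil => simp [dealPoly, dealCount]
  | cons c cs ih =>
    have := ih (c :: S)
    rw [List.map_cons] at this
    rw [List.map_cons, dealPoly, dealCount, peval_pmul, this, left_eq]
    simp only [leftPoly, peval_cons, peval_nil]
    push_cast; ring

/-- The polynomial of `edge`, where `g t` is the sum of `f x t` over the ten totals `x`, and where
`n` cards have been dealt, those that `cs` lists among them. -/
def edgePoly (f : ℕ → ℕ → ℕ) (g : ℕ → ℕ) (s t n : ℕ) (cs : List ℕ) : List ℤ :=
  let u : ℤ := 4 * (g t : ℤ) - 40 * (f s t : ℤ)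
  [u + ((n * f s t : ℕ) : ℤ) - (cs.foldr (fun c z => f ((s + c) % 10) t + z) 0 : ℕ), u]

theorem sum_mul_sum_delta (F : Fin 10 → ℝ) (S : List (Fin 10)) :
    ∑ c, F c * (S.map (delta c)).sum = (S.map F).sum := by
  induction S with
  | nil => simp
  | cons x S ih =>
    simp only [List.map_cons, List.sum_cons, mul_add, Finset.sum_add_distrib, ih]
    simp [delta]

theorem sum_rotate (F : ℕ → ℝ) {s : ℕ} (hs : s < 10) :
    ∑ c : Fin 10, F ((s + c) % 10) = ∑ x ∈ range 10, F x := by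
  interval_cases s <;> simp [Fin.sum_univ_succ, Finset.sum_range_succ] <;> ring

theorem edge_eq (d : ℕ) {f : ℕ → ℕ → ℕ} {g : ℕ → ℕ} {s t : ℕ} (hs : s < 10)
    (hg : g t = ∑ x ∈ range 10, f x t) (S : List (Fin 10)) :
    edge d (fun a t => (f a t : ℝ)) s t S
      = peval (edgePoly f g s t S.length (S.map Fin.val)) ((d : ℝ) - 1) := by
  have h1 : ∀ c : Fin 10, ((f ((s + c) % 10) t : ℕ) : ℝ) * left d S c
      = 4 * d * (f ((s + c) % 10) t : ℕ) + (12 * d * (f s t : ℕ)) * (if c = 0 then 1 else 0)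
        - (fun c : Fin 10 => ((f ((s + c) % 10) t : ℕ) : ℝ)) c * (S.map (delta c)).sum := by
    intro c
    unfold left cards
    by_cases hc : c = 0
    · subst hc
      simp only [delta, Fin.val_zero, add_zero, Nat.mod_eq_of_lt hs, if_true]; ring
    · simp only [delta, hc, if_false]; ring
  have h2 : ∑ c : Fin 10, ((f ((s + c) % 10) t : ℕ) : ℝ) = g t := by
    rw [sum_rotate (fun x => (f x t : ℝ)) hs, hg]; push_cast; rfl
  have h3 : (S.map fun c : Fin 10 => ((f ((s + c) % 10) t : ℕ) : ℝ)).sum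
      = (((S.map Fin.val).foldr (fun c z => f ((s + c) % 10) t + z) 0 : ℕ) : ℝ) := by
    clear h1
    induction S with
    | nil => simp
    | cons x S ih => simp [ih]
  rw [edge, Finset.sum_congr rfl fun c _ => h1 c, Finset.sum_sub_distrib, Finset.sum_add_distrib,
    ← Finset.mul_sum, h2, sum_mul_sum_delta, h3, ← Finset.mul_sum]
  simp only [Finset.sum_ite_eq', Finset.mem_univ, if_true, edgePoly, peval_cons, peval_nil]
  push_cast
  ring

theorem edge_add_mul (d : ℕ) (f f' : ℕ → ℕ → ℝ) (a : ℝ) (s t : ℕ) (S : List (Fin 10)) :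
    edge d (fun x y => f x y + a * f' x y) s t S = edge d f s t S + a * edge d f' s t S := by
  simp only [edge, add_mul, Finset.sum_add_distrib, mul_assoc, ← Finset.mul_sum]
  ring

theorem sum_left (d : ℕ) (S : List (Fin 10)) : ∑ c, left d S c = 52 * d - S.length := by
  have h1 : ∑ c, cards d c = 52 * d := by
    simp only [cards, delta, ← Finset.mul_sum, Finset.sum_add_distrib, Finset.sum_ite_eq',
      Finset.mem_univ, if_true]
    simp; ring
  have h2 := sum_mul_sum_delta (fun _ => 1) S
  simp only [one_mul, List.map_const', List.sum_replicate, nsmul_eq_mul, mul_one] at h2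
  simp only [left, Finset.sum_sub_distrib, h1, h2]

theorem edge_one (d : ℕ) (s t : ℕ) (S : List (Fin 10)) : edge d (fun _ _ => 1) s t S = 0 := by
  simp [edge, sum_left]

theorem edge_profit (d : ℕ) (α : ℝ) (s t : ℕ) (S : List (Fin 10)) :
    edge d (fun a t => profit α ((a : ℤ) - t)) s t S
      = edge d (fun a t => (geq a t : ℝ)) s t S
        + (1 - α) * edge d (fun a t => (win a t : ℝ)) s t S := by
  have h : (fun a t : ℕ => profit α ((a : ℤ) - t))
      = fun a t => ((geq a t : ℝ) + (-1) * 1) + (1 - α) * (win a t : ℝ) := by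
    funext a t; rw [profit_eq]; ring
  rw [h, edge_add_mul d (fun a t => (geq a t : ℝ) + (-1) * 1),
    edge_add_mul d (fun a t => (geq a t : ℝ)), edge_one]
  ring

theorem edge_profit_zero (d : ℕ) (s t : ℕ) (S : List (Fin 10)) :
    edge d (fun a t => profit 0 ((a : ℤ) - t)) s t S
      = edge d (fun a t => (score a t : ℝ)) s t S := by
  have h : (fun a t : ℕ => profit 0 ((a : ℤ) - t))
      = fun a t => (score a t : ℝ) + (-1) * 1 := by
    funext a t; rw [profit_zero_eq]; ring
  rw [h, edge_add_mul d (fun a t => (score a t : ℝ)), edge_one]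
  ring

/-! ### Banker's advantage at an information set -/

/-- Coefficients of `(a + A x) * (b + B x)`. -/
def combine (a b A B : ℕ) : List ℕ := [a * b, a * B + b * A, A * B]

/-- Number of ways to deal the two-card hand `h` after the at most three cards `cs`. -/
def pairWeight (cs : List ℕ) (h : ℕ × ℕ) : List ℕ :=
  bif Nat.beq h.1 h.2 then
    combine (mult h.1 - cnt h.1 cs) (mult h.1 - 1 - cnt h.1 cs) (mult h.1) (mult h.1)
  else combine (2 * (mult h.1 - cnt h.1 cs)) (mult h.2 - cnt h.2 cs) (2 * mult h.1) (mult h.2)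

/-- Coefficientwise sum of `w h`, with multiplicities `f h`, over the hands `hs`. -/
def weightSum (w : ℕ × ℕ → List ℕ) (f : ℕ × ℕ → ℕ) (hs : List (ℕ × ℕ)) : List ℕ :=
  hs.foldr (fun h s => bif Nat.beq (f h) 0 then s else
    List.zipWith (· + ·) ((w h).map (f h * ·)) s) [0, 0, 0]

/-- The polynomial of Banker's advantage from drawing at a total `s` after the cards `cs`, if the
profit function is `f` and Player's two-card hand is one of `hs`, with final total `t`. -/
def groupPoly (f : ℕ → ℕ → ℕ) (g : ℕ → ℕ) (s t : ℕ) (cs : List ℕ) (hs : List (ℕ × ℕ)) : List ℤ :=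
  padd (pmul (edgePoly f g s t (cs.length + 2) cs)
      ((weightSum (pairWeight cs) (fun _ => 1) hs).map Int.ofNat))
    (psmul (-1) ((weightSum (pairWeight cs)
      (fun h => f ((s + h.1) % 10) t + f ((s + h.2) % 10) t) hs).map Int.ofNat))

theorem peval_pairWeight (d : ℕ) {S : List (Fin 10)} (hS : S.length ≤ 3) (h : Hand) :
    peval ((pairWeight (S.map Fin.val) (h.1.1.val, h.1.2.val)).map Int.ofNat) ((d : ℝ) - 1)
      = orders h * dealCount d S [h.1.1, h.1.2] := by
  obtain ⟨⟨a, b⟩, hab⟩ := h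
  have ha := cnt_le_length a (S.map Fin.val)
  have hb := cnt_le_length b (S.map Fin.val)
  have ha' := four_le_mult a
  have hb' := four_le_mult b
  rw [List.length_map] at ha hb
  simp only [dealCount, left_eq, orders, pairWeight, List.map_cons]
  by_cases h : a = b
  · subst h
    have h1 : Nat.beq a a = true := by simp
    have h2 : cnt a ((a : ℕ) :: S.map Fin.val) = cnt a (S.map Fin.val) + 1 := by
      simp [cnt]
    simp only [h1, cond_true, combine, List.map_cons, List.map_nil, peval_cons, peval_nil, h2,
      delta, if_true, Int.ofNat_eq_natCast]
    rw [Nat.sub_sub]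
    push_cast [Nat.cast_sub (show cnt a (S.map Fin.val) ≤ mult a by omega),
      Nat.cast_sub (show 1 + cnt a (S.map Fin.val) ≤ mult a by omega)]
    ring
  · have h1 : Nat.beq a b = false := by
      rw [Bool.eq_false_iff]
      simp only [ne_eq, Nat.beq_eq]
      exact fun h' => h (Fin.ext h')
    have h2 : cnt b ((a : ℕ) :: S.map Fin.val) = cnt b (S.map Fin.val) := by
      simp [cnt, h1]
    simp only [h1, cond_false, combine, List.map_cons, List.map_nil, peval_cons, peval_nil, h2,
      delta, h, if_false, Int.ofNat_eq_natCast]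
    push_cast [Nat.cast_sub (show cnt a (S.map Fin.val) ≤ mult a by omega),
      Nat.cast_sub (show cnt b (S.map Fin.val) ≤ mult b by omega)]
    ring

theorem length_pairWeight (cs : List ℕ) (h : ℕ × ℕ) : (pairWeight cs h).length = 3 := by
  unfold pairWeight; cases Nat.beq h.1 h.2 <;> rfl

theorem peval_zipWith {p q : List ℕ} (h : p.length = q.length) (x : ℝ) :
    peval ((List.zipWith (· + ·) p q).map Int.ofNat) x
      = peval (p.map Int.ofNat) x + peval (q.map Int.ofNat) x := by
  induction p generalizing q with
  | nil =>
    obtain rfl : q = [] := by simpa using h.symm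
    simp
  | cons a p ih =>
    cases q with
    | nil => simp at h
    | cons b q =>
      simp only [List.zipWith_cons_cons, List.map_cons, peval_cons,
        ih (by simpa using h), Int.ofNat_eq_natCast]
      push_cast; ring

theorem peval_map_mul (a : ℕ) (p : List ℕ) (x : ℝ) :
    peval ((p.map (a * ·)).map Int.ofNat) x = a * peval (p.map Int.ofNat) x := by
  induction p with
  | nil => simp
  | cons b p ih =>
    simp only [List.map_cons, peval_cons, ih, Int.ofNat_eq_natCast]; push_cast; ring

theorem length_weightSum {w : ℕ × ℕ → List ℕ} (hw : ∀ h, (w h).length = 3) (f : ℕ × ℕ → ℕ)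
    (hs : List (ℕ × ℕ)) : (weightSum w f hs).length = 3 := by
  induction hs with
  | nil => rfl
  | cons h hs ih =>
    have : weightSum w f (h :: hs) = bif Nat.beq (f h) 0 then weightSum w f hs else
      List.zipWith (· + ·) ((w h).map (f h * ·)) (weightSum w f hs) := rfl
    rw [this]
    cases Nat.beq (f h) 0 <;> simp [ih, hw]

theorem peval_weightSum {w : ℕ × ℕ → List ℕ} (hw : ∀ h, (w h).length = 3) (f : ℕ × ℕ → ℕ)
    (hs : List (ℕ × ℕ)) (x : ℝ) :
    peval ((weightSum w f hs).map Int.ofNat) x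
      = (hs.map fun h => f h * peval ((w h).map Int.ofNat) x).sum := by
  induction hs with
  | nil => simp [weightSum]
  | cons h hs ih =>
    have h1 : weightSum w f (h :: hs) = bif Nat.beq (f h) 0 then weightSum w f hs else
      List.zipWith (· + ·) ((w h).map (f h * ·)) (weightSum w f hs) := rfl
    rw [h1, List.map_cons, List.sum_cons, ← ih]
    by_cases h0 : f h = 0
    · have : Nat.beq (f h) 0 = true := by simp [h0]
      rw [this, cond_true, h0]; simp
    · have : Nat.beq (f h) 0 = false := by
        rw [Bool.eq_false_iff]; simpa using h0
      rw [this, cond_false, peval_zipWith (by rw [List.length_map, hw, length_weightSum hw]),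
        peval_map_mul]

/-- The values of the cards of a hand. -/
def faces (h : Hand) : ℕ × ℕ := (h.1.1.val, h.1.2.val)

theorem peval_groupPoly (d : ℕ) {f : ℕ → ℕ → ℕ} {g : ℕ → ℕ} {s t : ℕ} (hs : s < 10)
    (hg : g t = ∑ x ∈ range 10, f x t) {S : List (Fin 10)} (hS : S.length ≤ 3) (L : List Hand) :
    peval (groupPoly f g s t (S.map Fin.val) (L.map faces)) ((d : ℝ) - 1)
      = (L.map fun i => orders i * dealCount d S [i.1.1, i.1.2]
          * edge d (fun a t => (f a t : ℝ)) s t (i.1.1 :: i.1.2 :: S)).sum := by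
  have hw := fun h => length_pairWeight (S.map Fin.val) h
  rw [groupPoly, peval_padd, peval_pmul, peval_psmul, peval_weightSum hw, peval_weightSum hw]
  induction L with
  | nil => simp
  | cons i L ih =>
    have h1 : edge d (fun a t => (f a t : ℝ)) s t (i.1.1 :: i.1.2 :: S)
        = peval (edgePoly f g s t ((S.map Fin.val).length + 2) (S.map Fin.val)) ((d : ℝ) - 1)
          - (f ((s + i.1.1) % 10) t + f ((s + i.1.2) % 10) t : ℕ) := by
      rw [edge_eq d hs hg]
      simp [edgePoly]
      ring
    simp only [List.map_cons, List.sum_cons]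
    rw [h1, ← ih, ← peval_pairWeight d hS i]
    simp only [faces]
    push_cast
    ring

/-! ### Polynomials for Banker's advantages and for Player's gaps -/

/-- Player's hands compatible with DSSDD, grouped by their totals, if Player has stood (`none`) or
drawn. -/
def reach : Option (Fin 10) → List (ℕ × List Hand)
  | none =>
    [(5, [hand 1 4, hand 2 3]),
     (6, [hand 0 6, hand 1 5, hand 2 4, hand 3 3, hand 7 9, hand 8 8]),
     (7, [hand 0 7, hand 1 6, hand 2 5, hand 3 4, hand 8 9])]
  | some _ =>
    [(0, [hand 0 0, hand 1 9, hand 2 8, hand 3 7, hand 4 6, hand 5 5]),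
     (1, [hand 0 1, hand 2 9, hand 3 8, hand 4 7, hand 5 6]),
     (2, [hand 0 2, hand 1 1, hand 3 9, hand 4 8, hand 5 7, hand 6 6]),
     (3, [hand 0 3, hand 1 2, hand 4 9, hand 5 8, hand 6 7]),
     (4, [hand 0 4, hand 1 3, hand 2 2, hand 5 9, hand 6 8, hand 7 7]),
     (5, [hand 0 5, hand 6 9, hand 7 8])]

/-- Player's final total with two-card total `s` and third card `k`. -/
def finalTotal (s : ℕ) : Option (Fin 10) → ℕ
  | none => s
  | some k => (s + k) % 10

/-- The polynomial of Banker's advantage from drawing at `l` if the profit function is `f` and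
Player's hand is in one of the groups `r`. -/
def bankerPoly (f : ℕ → ℕ → ℕ) (g : ℕ → ℕ) (r : List (ℕ × List Hand)) (l : InfoSet) : List ℤ :=
  psum (r.map fun h => groupPoly f g (total l.1.1) (finalTotal h.1 l.2) ((seen l).map Fin.val)
    (h.2.map faces))

/-- Banker's advantage as a polynomial of degree one in the commission rate, whose coefficients are
polynomials in the number of decks minus one. -/
def bankerLine (r : List (ℕ × List Hand)) (l : InfoSet) : List ℤ × List ℤ :=
  (padd (bankerPoly geq (fun t => 10 - t) r l) (bankerPoly win (fun t => 9 - t) r l),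
    psmul (-1) (bankerPoly win (fun t => 9 - t) r l))

/-- Banker's advantage at `l` against DSSDD. -/
def baseLine (l : InfoSet) : List ℤ × List ℤ := bankerLine (reach l.2) l

/-- Change of Banker's advantage at `l` from DSSDD to DDSDD. -/
def pivotLine (l : InfoSet) : List ℤ × List ℤ :=
  (psmul (side l) (bankerLine [(5, [hand 1 4])] l).1,
    psmul (side l) (bankerLine [(5, [hand 1 4])] l).2)

/-- Numerator and denominator of Player's equilibrium probability. -/
def probLines (d : ℕ) : (List ℤ × List ℤ) × (List ℤ × List ℤ) :=
  bif Nat.beq d 1 then (([4], [203]), ([76], [-42]))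
  else ((pshift 1 (pmul [-1, 12] [1, -14, 16]), pshift 1 [0, 8, -192, 896]),
    (pshift 1 [0, 0, -32, 352], pshift 1 [0, 0, 16, -192]))

/-- Coefficients of the quadratic polynomial `e * a + n * b` in the commission rate. -/
def quadratic (n e a b : List ℤ × List ℤ) : List ℤ × List ℤ × List ℤ :=
  (padd (pmul e.1 a.1) (pmul n.1 b.1),
    padd (padd (pmul e.1 a.2) (pmul e.2 a.1)) (padd (pmul n.1 b.2) (pmul n.2 b.1)),
    padd (pmul e.2 a.2) (pmul n.2 b.2))

/-- Banker's advantage at `l` against Player's equilibrium strategy, up to a positive factor. -/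
def mixQuadratic (d : ℕ) (l : InfoSet) : List ℤ × List ℤ × List ℤ :=
  quadratic (probLines d).1 (probLines d).2 (baseLine l) (pivotLine l)

/-- The number of ways to deal the cards that are still missing, when Player's third card is
known. -/
def restPoly : Option (Fin 10) → List ℤ
  | none => [47, 52]
  | some _ => [1]

/-- The number of ways to deal what Banker knows at `l` after Player's hand `x`. -/
def gapWeight (x : FiveHand) (l : InfoSet) : List ℤ :=
  psmul (bif Nat.beq l.1.1.1.1 l.1.1.1.2 then 1 else 2)
    (dealPoly [x.1.1.1, x.1.1.2] ((seen l).map Fin.val))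

/-- Contribution of `l` to `playerGap` if Banker stands. -/
def gapStand (x : FiveHand) (l : InfoSet) : List ℤ :=
  psmul (side l * ((score (total l.1.1) (finalTotal 5 l.2) : ℤ) - 1))
    (pmul (pmul [50 - ((seen l).length : ℤ), 52] (restPoly l.2)) (gapWeight x l))

/-- Change of the contribution of `l` to `playerGap` if Banker draws. -/
def gapGain (x : FiveHand) (l : InfoSet) : List ℤ :=
  psmul (side l) (pmul (pmul (edgePoly score (fun t => 19 - 2 * t) (total l.1.1)
    (finalTotal 5 l.2) ((seen l).length + 2) (x.1.1.1 :: x.1.1.2 :: (seen l).map Fin.val))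
      (restPoly l.2)) (gapWeight x l))

/-! ### Lists of information sets -/

/-- All card values. -/
def digits : List (Fin 10) := [0, 1, 2, 3, 4, 5, 6, 7, 8, 9]

/-- All two-card hands. -/
def handList : List Hand :=
  digits.flatMap fun a => digits.filterMap fun b => if h : a ≤ b then some ⟨(a, b), h⟩ else none

/-- All two-card hands that are not naturals. -/
def liveList : List LiveHand :=
  handList.filterMap fun h => if h' : total h ≤ 7 then some ⟨h, h'⟩ else none

/-- All information sets. -/
def infoList : List InfoSet := liveList ×ˢ (none :: digits.map some)

/-- The information sets that the first table leaves open. -/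
def openList : List InfoSet :=
  openCells.flatMap fun c => (liveList.filter fun j => total j.1 = c.1).map fun j => (j, c.2)

/-! ### The two tables over the integers -/

open Entry

/-- The set at which Banker mixes. -/
def mixCell (d : ℕ) : InfoSet := bif Nat.beq d 1 then (live 8 8, none) else (live 0 6, none)

/-- The list `exceptional`, with values in units of `10⁻⁷`. -/
def exceptionalZ : ℕ → List (Fin 6 × ℤ)
  | 1 => [(1, 655294)]
  | 2 => [(2, 46904), (3, 281623)]
  | 4 => [(0, 120709)]
  | 5 => [(0, 392263)]
  | 6 => [(0, 569147)]
  | 7 => [(0, 693518)]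
  | 8 => [(4, 244435), (0, 785740)]
  | 9 => [(5, 56651), (4, 763202), (0, 856851)]
  | 10 => [(5, 544215), (0, 913356)]
  | 11 => [(5, 932285), (0, 959335)]
  | 12 => [(0, 997480)]
  | _ => []

/-- Numerator of `qForm`. -/
def qNum (a b c e f : ℤ) : List ℤ := pshift 1 [f, -e, c, -b, a]

/-- Denominator of `qForm`. -/
def qDen : List ℤ := pshift 1 (pmul [0, 0, 256] (pmul [-1, 11] [-5, 52]))

/-- The list `rows`, with numerators and denominators of the mixing probabilities as
polynomials. -/
def rowsZ : ℕ → List (List (List Entry) × List ℤ × List ℤ)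
  | 1 =>
    [([[S,S,D,S,D], [S,S,S,S,D,D], [S,S,S,S,S], [S,S,S,S,S,M], [D,D,D,S,D,D]], [4519], [10716]),
     ([[S,S,D,D,D], [S,S,S,S,D,D], [S,S,S,S,S], [S,S,S,S,S,M], [D,D,D,S,D,D]], [3991], [10716])]
  | 2 =>
    [([[S,S,S,S,S], [S,S,S,S,D,D], [D,S,S,D,D], [M,S,S,S,S,D], [D,D,D,S,D,D]], [17431], [64512]),
     ([[S,S,S,S,S], [S,S,S,S,D,D], [D,S,S,S,D], [M,S,S,S,S,D], [D,D,D,S,D,D]], [192637], [709632]),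
     ([[S,S,S,S,S], [S,S,S,S,D,D], [S,S,S,S,D], [M,S,S,S,S,D], [D,D,D,S,D,D]], [65407], [236544])]
  | 3 => [(row [D,S,S,D,D] [D,D,D,S,D,D], qB, qDen)]
  | 4 | 5 | 6 | 7 =>
    [(row [D,S,S,D,D] [D,D,D,D,D,D], qA, qDen), (row [D,S,S,D,D] [D,D,D,S,D,D], qB, qDen)]
  | 8 =>
    [(row [D,D,S,D,D] [D,D,D,D,D,D], qC, qDen), (row [D,S,S,D,D] [D,D,D,D,D,D], qA, qDen),
     (row [D,S,S,D,D] [D,D,D,S,D,D], qB, qDen)]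
  | 9 =>
    [(row [D,D,D,D,D] [D,D,D,D,D,D], qE, qDen), (row [D,D,S,D,D] [D,D,D,D,D,D], qC, qDen),
     (row [D,S,S,D,D] [D,D,D,D,D,D], qA, qDen), (row [D,S,S,D,D] [D,D,D,S,D,D], qB, qDen)]
  | 10 | 11 =>
    [(row [D,D,D,D,D] [D,D,D,D,D,D], qE, qDen), (row [D,D,S,D,D] [D,D,D,D,D,D], qC, qDen),
     (row [D,D,S,D,D] [D,D,D,S,D,D], qF, qDen)]
  | 12 =>
    [(row [D,D,D,D,D] [D,D,D,D,D,D], qE, qDen),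
     (row [D,D,D,D,D] [D,D,D,S,D,D], [1689974681], [2989264896])]
  | _ => [(row [D,D,D,D,D] [D,D,D,D,D,D], qE, qDen)]
where
  row (X Y : List Entry) : List (List Entry) :=
    [[S,S,S,S,S], [S,S,S,S,S,S], X, [M,S,S,S,S,D], Y]
  qA := qNum 92160 120128 26336 2000 47
  qB := qNum 91776 119968 26320 2000 47
  qC := qNum 91904 119680 26064 1932 41
  qE := qNum 91648 119488 26032 1932 41
  qF := qNum 91520 119520 26048 1932 41

/-- The numbers of decks that stand for all others. -/
def decks : List ℕ := [1, 2, 3, 4, 5, 6, 7, 8, 9, 10, 11, 12, 13]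

/-! ### The finite checks -/

/-- The sign that Banker's advantage must have where the table says `e`. -/
def drawSign (e : Entry) : ℤ := if e = D then 1 else -1

/-- Test for a sign of Banker's advantage at `l` that is the same for all numbers of decks, all
commission rates, and all mixtures of Player's two strategies. -/
def robustCheck (s : ℤ) (a b : List ℤ × List ℤ) : Bool :=
  coeffPos (psmul s a.1) && coeffPos (psmul s (padd (psmul 10 a.1) a.2))
    && coeffPos (psmul s (padd a.1 b.1))
    && coeffPos (psmul s (padd (psmul 10 (padd a.1 b.1)) (padd a.2 b.2)))

/-- The check of the closed part of the first table. -/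
def closedCheck (l : InfoSet) : Bool :=
  decide ((total l.1.1, l.2) ∈ openCells) ||
    (decide (entry [] l ≠ M) &&
      robustCheck (drawSign (entry [] l)) (baseLine l) (pivotLine l))

/-- Test that a linear polynomial in the commission rate is positive on `[0, 1/10]`. -/
def lineCheck (d : ℕ) (a : List ℤ × List ℤ) : Bool :=
  posAt d a.1 && posAt d (padd (psmul 10 a.1) a.2)

/-- Test, by means of the Bernstein coefficients, that a quadratic polynomial in the commission rate
has the sign `s` on `[0, 1/10]`. -/
def quadraticCheck (d : ℕ) (s : ℤ) (a : List ℤ × List ℤ × List ℤ) : Bool :=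
  posAt d (psmul s a.1) && posAt d (psmul s (padd (psmul 20 a.1) a.2.1)) &&
    posAt d (psmul s (padd (psmul 100 a.1) (padd (psmul 10 a.2.1) a.2.2)))

/-- `(2 * 10 ^ 7) ^ 2` times the value of the quadratic polynomial `a` at `v / (2 * 10 ^ 7)`. -/
def scaledValue (a : List ℤ × List ℤ × List ℤ) (v : ℤ) : List ℤ :=
  padd (psmul (20000000 ^ 2) a.1) (padd (psmul (20000000 * v) a.2.1) (psmul (v ^ 2) a.2.2))

/-- Test that Player's probability lies strictly between `0` and `1`. -/
def probCheck (d : ℕ) : Bool :=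
  lineCheck d (probLines d).1 && lineCheck d (probLines d).2 &&
    lineCheck d (padd (probLines d).2.1 (psmul (-1) (probLines d).1.1),
      padd (probLines d).2.2 (psmul (-1) (probLines d).1.2))

/-- Test that a linear polynomial in the commission rate has no zero in `[0, 1/10]`. -/
def lineNonzeroCheck (d : ℕ) (a : List ℤ × List ℤ) : Bool :=
  lineCheck d a || lineCheck d (psmul (-1) a.1, psmul (-1) a.2)

/-- Test that Banker is indifferent at the set where he mixes. -/
def mixCheck (d : ℕ) : Bool :=
  zeroAt d (mixQuadratic d (mixCell d)).1 && zeroAt d (mixQuadratic d (mixCell d)).2.1 &&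
    zeroAt d (mixQuadratic d (mixCell d)).2.2 && lineNonzeroCheck d (pivotLine (mixCell d))

/-- The row `n` of the table for `d` decks. -/
def patZ (d n : ℕ) : List (List Entry) := ((rowsZ d).getD n ([], [], [])).1

/-- Test that `e` bounds a zero of Banker's advantage at the second member of a crossing pair, and
that this is the only zero, the advantage having the sign `s` before and `-s` after. -/
def crossCheck (d : ℕ) (s : ℤ) (e : Fin 6 × ℤ) : Bool :=
  let a := mixQuadratic d (crossing e.1).2
  decide (1 < 2 * e.2) && decide (2 * e.2 + 1 < 2000000) &&
  posAt d (psmul s (scaledValue a (2 * e.2 - 1))) &&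
  posAt d (psmul (-s) (scaledValue a (2 * e.2 + 1))) &&
  posAt d (psmul (-s) a.2.1) && posAt d (psmul (-s) (padd (psmul 5 a.2.1) a.2.2)) &&
  lineNonzeroCheck d (pivotLine (crossing e.1).2)

/-- Test that Banker's advantage at `l` has the same sign, that of the table, for all commission
rates, unless `l` is exempted. -/
def openCheck (d : ℕ) (l : InfoSet) : Bool :=
  decide (l = mixCell d) || decide (l ∈ (exceptionalZ d).map fun e => (crossing e.1).2) ||
    quadraticCheck d (drawSign (entry (patZ d 0) l)) (mixQuadratic d l)

/-- The polynomial of `playerGap` if Banker plays the closed part of the first table, and stands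
elsewhere. -/
def gapBase (x : FiveHand) : List ℤ :=
  psum (infoList.map fun l => padd (gapStand x l) (if entry [] l = D then gapGain x l else []))

/-- The hands of total 5 at which Player does not mix, with the sign that `playerGap` must have
there, and with the values of `gapBase`, written out because they enter many checks. -/
def pureHands : List (FiveHand × ℤ × List ℤ) :=
  [(five 0 5, -1, [-217624, -877708, -1315952, -867648, -211712]),
   (five 2 3, 1, [-2594, -169768, -537968, -582272, -211712]),
   (five 6 9, -1, [-203134, -832696, -1269488, -851712, -211712]),
   (five 7 8, -1, [-220466, -883360, -1318800, -867712, -211712])]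

/-- The value of `gapBase` at the hand `(1,4)`, where Player mixes. -/
def pivotBase : List ℤ := [-7702, -187656, -560080, -591744, -211712]

/-- The polynomial of `playerGap` if Banker plays `pat`, standing at M, where `base` is the value of
`gapBase`. -/
def gapRow (base : List ℤ) (pat : List (List Entry)) (x : FiveHand) : List ℤ :=
  padd base (psum (openList.map fun l => if entry pat l = D then gapGain x l else []))

/-- The polynomial of `playerGap` if Banker plays `pat`, drawing at M. -/
def gapRowDraw (d : ℕ) (base : List ℤ) (pat : List (List Entry)) (x : FiveHand) : List ℤ :=
  padd (gapRow base pat x) (gapGain x (mixCell d))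

/-- Test that Player's strategy is a best reply to the mixture of the rows `pat`, with standing at
M, and `pat'`, with drawing at M, that makes Player indifferent at `(1,4)`. -/
def gapCheck (d : ℕ) (pat pat' : List (List Entry)) : Bool :=
  let g := gapRow pivotBase pat (five 1 4)
  let g' := gapRowDraw d pivotBase pat' (five 1 4)
  posAt d (psmul (-1) g) && posAt d g' &&
  pureHands.all fun x => posAt d (psmul x.2.1 (padd (pmul g' (gapRow x.2.2 pat x.1))
    (psmul (-1) (pmul g (gapRowDraw d x.2.2 pat' x.1)))))

/-- Test that the mixing probability of a row makes Player indifferent at `(1,4)`. -/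
def mixProbCheck (d : ℕ) (r : List (List Entry) × List ℤ × List ℤ) : Bool :=
  posAt d r.2.2 &&
    zeroAt d (padd (pmul (padd r.2.2 (psmul (-1) r.2.1)) (gapRow pivotBase r.1 (five 1 4)))
      (pmul r.2.1 (gapRowDraw d pivotBase r.1 (five 1 4))))

/-- The checks on the rows of the second table that concern Player. -/
def playerCheck (d : ℕ) : Bool :=
  ((rowsZ d).all fun r => mixProbCheck d r && gapCheck d r.1 r.1) &&
    (List.range (exceptionalZ d).length).all fun n =>
      gapCheck d (patZ d n) (patZ d (n + 1)) && gapCheck d (patZ d (n + 1)) (patZ d n)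

/-- The checks on the entries of the second table, as far as they do not involve payoffs. -/
def tableCheck (d : ℕ) : Bool :=
  decide ((rowsZ d).length = (exceptionalZ d).length + 1) && decide (mixCell d ∈ openList) &&
  ((rowsZ d).all fun r => openList.all fun l =>
    decide (entry r.1 l = M ↔ l = mixCell d) &&
    (decide (l ∈ (exceptionalZ d).map fun e => (crossing e.1).2) ||
      decide (entry r.1 l = D ↔ entry (patZ d 0) l = D))) &&
  (exceptionalZ d).zipIdx.all fun e =>
    decide ((crossing e.1.1).1 = mixCell d) && decide ((crossing e.1.1).2 ∈ openList) &&
    decide ((crossing e.1.1).2 ≠ mixCell d) &&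
    (rowsZ d).zipIdx.all fun r => decide (entry r.1.1 (crossing e.1.1).2 = D ↔
      (r.2 ≤ e.2 ↔ entry (patZ d e.2) (crossing e.1.1).2 = D))

/-- All checks for `d` decks except those of Banker's advantages at fixed information sets. -/
def deckCheck (d : ℕ) : Bool :=
  probCheck d && mixCheck d && tableCheck d &&
    (exceptionalZ d).zipIdx.all fun e =>
      crossCheck d (drawSign (entry (patZ d e.2) (crossing e.1.1).2)) e.1

/-! ### The polynomials compute what they should -/

theorem left_pos {d : ℕ} (hd : 1 ≤ d) {S : List (Fin 10)} (hS : S.length ≤ 3) (c : Fin 10) :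
    0 < left d S c := by
  have h1 := four_le_cards hd c
  have h2 : (S.map (delta c)).sum ≤ S.length := by
    clear hS
    induction S with
    | nil => simp
    | cons x S ih =>
      simp only [List.map_cons, List.sum_cons, List.length_cons]
      push_cast
      linarith [delta_le_one c x]
  have h3 : (S.length : ℝ) ≤ 3 := by exact_mod_cast hS
  unfold left; linarith

theorem dealCount_pos {d : ℕ} (hd : 1 ≤ d) {S cs : List (Fin 10)}
    (h : S.length + cs.length ≤ 4) : 0 < dealCount d S cs := by
  induction cs generalizing S with
  | nil => exact one_pos
  | cons c cs ih =>
    simp only [List.length_cons] at h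
    exact mul_pos (left_pos hd (by omega) c) (ih (by simp only [List.length_cons]; omega))

theorem orders_pos (h : Hand) : 0 < orders h := by
  unfold orders; linarith [delta_le_one h.1.1 h.1.2]

theorem dealAll_pos {d : ℕ} (hd : 1 ≤ d) {n : ℕ} (hn : n ≤ 6) : 0 < dealAll d n := by
  refine Finset.prod_pos fun m hm => ?_
  have h1 : (1 : ℝ) ≤ d := by exact_mod_cast hd
  have h2 : (m : ℝ) ≤ 6 := by
    have := Finset.mem_range.1 hm
    exact_mod_cast (by omega : m ≤ 6)
  linarith

theorem length_seen (l : InfoSet) : (seen l).length = if l.2 = none then 2 else 3 := by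
  rcases l with ⟨j, _ | k⟩ <;> rfl

theorem length_seen_le (l : InfoSet) : (seen l).length ≤ 3 := by
  rw [length_seen]; split_ifs <;> omega

theorem total_lt (h : Hand) : total h < 10 := Nat.mod_lt _ (by norm_num)

theorem finalTotal_lt {s : ℕ} (hs : s < 10) (k : Option (Fin 10)) : finalTotal s k < 10 := by
  cases k with
  | none => exact hs
  | some k => exact Nat.mod_lt _ (by norm_num)

theorem playerTotal_eq (i : Hand) (l : InfoSet) : playerTotal i l = finalTotal (total i) l.2 := by
  rcases l with ⟨j, _ | k⟩
  · rfl
  · exact total3_eq i k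

theorem sum_geq : ∀ t < 10, 10 - t = ∑ x ∈ range 10, geq x t := by decide

theorem sum_win : ∀ t < 10, 9 - t = ∑ x ∈ range 10, win x t := by decide

theorem sum_score : ∀ t < 10, 19 - 2 * t = ∑ x ∈ range 10, score x t := by decide

theorem peval_bankerPoly (d : ℕ) {f : ℕ → ℕ → ℕ} {g : ℕ → ℕ}
    (hg : ∀ t < 10, g t = ∑ x ∈ range 10, f x t) {r : List (ℕ × List Hand)}
    (hr : ∀ h ∈ r, ∀ i ∈ h.2, total i = h.1) (hr' : ∀ h ∈ r, h.1 < 10) (l : InfoSet) :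
    peval (bankerPoly f g r l) ((d : ℝ) - 1)
      = (r.map fun h => (h.2.map fun i => orders i * dealCount d (seen l) [i.1.1, i.1.2]
          * edge d (fun a t => (f a t : ℝ)) (total l.1.1) (playerTotal i l)
            (table i l)).sum).sum := by
  rw [bankerPoly, peval_psum, List.map_map]
  refine congrArg List.sum (List.map_congr_left fun h hh => ?_)
  rw [Function.comp_apply, peval_groupPoly d (total_lt _) (hg _ (finalTotal_lt (hr' h hh) _))
    (length_seen_le l)]
  refine congrArg List.sum (List.map_congr_left fun i hi => ?_)
  rw [playerTotal_eq, hr h hh i hi]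
  rfl

/-- Dealing Banker's known cards first shows that the contributions of Player's hands to Banker's
advantage at `l` have a common factor. -/
theorem gainTerm_eq_of_banker {d : ℕ} (hd : 1 ≤ d) (l : InfoSet) :
    ∃ κ : ℝ, 0 < κ ∧ ∀ (α : ℝ) (i : Hand), gainTerm d α i l
      = κ * (orders i * dealCount d (seen l) [i.1.1, i.1.2]
        * edge d (fun a t => profit α ((a : ℤ) - t)) (total l.1.1) (playerTotal i l)
          (table i l)) := by
  have h1 : (1 : ℝ) ≤ d := by exact_mod_cast hd
  have hn := length_seen_le l
  have hn' : ((seen l).length : ℝ) ≤ 3 := by exact_mod_cast hn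
  have hl : ∀ i, (table i l).length = (seen l).length + 2 := fun i => rfl
  refine ⟨orders l.1.1 * dealCount d [] (seen l) / dealAll d ((seen l).length + 2)
    / (52 * d - ((seen l).length + 2 : ℕ)), ?_, fun α i => ?_⟩
  · refine div_pos (div_pos (mul_pos (orders_pos _) (dealCount_pos hd ?_))
      (dealAll_pos hd (by omega))) ?_
    · rw [List.length_nil]; omega
    · push_cast; linarith
  · have h2 : (table i l).Perm (seen l ++ [i.1.1, i.1.2]) :=
      List.perm_append_comm (l₁ := [i.1.1, i.1.2]) (l₂ := seen l)
    rw [gainTerm_eq d hd, hitProb_eq, hl, dealCount_perm_right h2, dealCount_append,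
      List.append_nil]
    ring

theorem sum_gainTerm {d : ℕ} (hd : 1 ≤ d) (l : InfoSet) :
    ∃ κ : ℝ, 0 < κ ∧ ∀ (r : List (ℕ × List Hand)), (∀ h ∈ r, ∀ i ∈ h.2, total i = h.1) →
      (∀ h ∈ r, h.1 < 10) → ∀ α : ℝ,
      (r.map fun h => (h.2.map fun i => gainTerm d α i l).sum).sum
        = κ * (peval (bankerLine r l).1 ((d : ℝ) - 1)
          + peval (bankerLine r l).2 ((d : ℝ) - 1) * α) := by
  obtain ⟨κ, hκ, h⟩ := gainTerm_eq_of_banker hd l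
  refine ⟨κ, hκ, fun r hr hr' α => ?_⟩
  simp only [bankerLine, peval_padd, peval_psmul, peval_bankerPoly d sum_geq hr hr',
    peval_bankerPoly d sum_win hr hr', h, edge_profit, mul_add, List.sum_map_add,
    mul_left_comm _ (1 - α) _, List.sum_map_mul_left]
  push_cast
  ring

theorem sum_map_flatMap {ι κ : Type*} (L : List ι) (g : ι → List κ) (F : κ → ℝ) :
    ((L.flatMap g).map F).sum = (L.map fun a => ((g a).map F).sum).sum := by
  induction L with
  | nil => simp
  | cons a L ih => simp [ih]

theorem total_of_mem_reach (k : Option (Fin 10)) :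
    (∀ h ∈ reach k, ∀ i ∈ h.2, total i = h.1) ∧ ∀ h ∈ reach k, h.1 < 10 := by
  cases k with
  | none => simp only [reach]; decide
  | some k => simp only [reach]; decide

theorem reachSet_pureDSSDD (l : InfoSet) :
    reachSet pureDSSDD l = ((reach l.2).flatMap Prod.snd).toFinset ∧
      ((reach l.2).flatMap Prod.snd).Nodup := by
  rcases l with ⟨j, _ | k⟩
  · simp only [reachSet, reach]; decide +kernel
  · simp only [reachSet, reach]; decide +kernel

/-- Banker's advantages against DSSDD and DDSDD as polynomials. -/
theorem advantage_eq_line {d : ℕ} (hd : 1 ≤ d) (l : InfoSet) :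
    ∃ κ : ℝ, 0 < κ ∧ ∀ α : ℝ,
      advantage d α pureDSSDD l = κ * (peval (baseLine l).1 ((d : ℝ) - 1)
        + peval (baseLine l).2 ((d : ℝ) - 1) * α) ∧
      advantage d α pureDDSDD l = advantage d α pureDSSDD l
        + κ * (peval (pivotLine l).1 ((d : ℝ) - 1) + peval (pivotLine l).2 ((d : ℝ) - 1) * α) := by
  obtain ⟨κ, hκ, h⟩ := sum_gainTerm hd l
  refine ⟨κ, hκ, fun α => ⟨?_, ?_⟩⟩
  · have h1 := h _ (total_of_mem_reach l.2).1 (total_of_mem_reach l.2).2 α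
    rw [advantage_eq hd, (reachSet_pureDSSDD l).1, List.sum_toFinset _ (reachSet_pureDSSDD l).2,
      baseLine, ← h1, sum_map_flatMap]
  · have h1 := h [(5, [hand 1 4])] (by decide) (by decide) α
    simp only [List.map_cons, List.map_nil, List.sum_cons, List.sum_nil, add_zero] at h1
    rw [advantage_pureDDSDD hd, h1, pivotLine]
    simp only [peval_psmul]
    ring

theorem peval_gapWeight (d : ℕ) (x : FiveHand) (l : InfoSet) :
    peval (gapWeight x l) ((d : ℝ) - 1)
      = orders l.1.1 * dealCount d [x.1.1.1, x.1.1.2] (seen l) := by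
  have h := peval_dealPoly d [x.1.1.1, x.1.1.2] (seen l)
  simp only [List.map_cons, List.map_nil] at h
  rw [gapWeight, peval_psmul, h]
  congr 1
  by_cases hj : l.1.1.1.1 = l.1.1.1.2
  · simp [orders, delta, hj]; norm_num
  · have : Nat.beq l.1.1.1.1 l.1.1.1.2 = false := by
      rw [Bool.eq_false_iff]
      simp only [ne_eq, Nat.beq_eq]
      exact fun h' => hj (Fin.ext h')
    simp [orders, delta, hj, this]

theorem dealAll_six (d : ℕ) (l : InfoSet) :
    dealAll d 6 = dealAll d ((seen l).length + 2) * ((52 * d - ((seen l).length + 2 : ℕ))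
      * peval (restPoly l.2) ((d : ℝ) - 1)) := by
  rcases l with ⟨j, _ | k⟩
  · simp only [dealAll, seen, Option.toList, List.length_cons, List.length_nil, restPoly,
      peval_cons, peval_nil, Finset.prod_range_succ]
    push_cast; ring
  · simp only [dealAll, seen, Option.toList, List.length_cons, List.length_nil, restPoly,
      peval_cons, peval_nil, Finset.prod_range_succ]
    push_cast; ring

/-- Dealing Player's hand first shows that the terms of `playerGap` have a common factor. -/
theorem gap_terms_eq {d : ℕ} (hd : 1 ≤ d) (x : FiveHand) :
    ∃ κ : ℝ, 0 < κ ∧ ∀ l : InfoSet,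
      side l * standTerm d 0 x.1 l = κ * peval (gapStand x l) ((d : ℝ) - 1) ∧
      side l * gainTerm d 0 x.1 l = κ * peval (gapGain x l) ((d : ℝ) - 1) := by
  have h1 : (1 : ℝ) ≤ d := by exact_mod_cast hd
  have h6 := dealAll_pos hd le_rfl
  refine ⟨orders x.1 * dealCount d [] [x.1.1.1, x.1.1.2] / dealAll d 6,
    div_pos (mul_pos (orders_pos _) (dealCount_pos hd (by simp))) h6, fun l => ?_⟩
  have hn := length_seen_le l
  have hn' : ((seen l).length : ℝ) ≤ 3 := by exact_mod_cast hn
  have hlen : (table x.1 l).length = (seen l).length + 2 := rfl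
  have htab : table x.1 l = [x.1.1.1, x.1.1.2] ++ seen l := rfl
  have hD := (dealAll_pos hd (show (seen l).length + 2 ≤ 6 by omega)).ne'
  have hc : (52 * (d : ℝ) - ((seen l).length + 2 : ℕ)) ≠ 0 := by
    push_cast; linarith
  have hr : peval (restPoly l.2) ((d : ℝ) - 1) ≠ 0 := by
    intro h0
    rw [dealAll_six d l, h0] at h6
    simp at h6
  have hp : hitProb d x.1 l = orders x.1 * dealCount d [] [x.1.1.1, x.1.1.2] / dealAll d 6
      * ((52 * d - ((seen l).length + 2 : ℕ)) * peval (restPoly l.2) ((d : ℝ) - 1)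
        * peval (gapWeight x l) ((d : ℝ) - 1)) := by
    rw [peval_gapWeight, hitProb_eq, hlen, htab, dealCount_append, List.append_nil,
      dealAll_six d l]
    field_simp
  have ht : playerTotal x.1 l = finalTotal 5 l.2 := by rw [playerTotal_eq, x.2]
  constructor
  · rw [standTerm, profit_zero_eq, ht, hp, gapStand]
    simp only [peval_psmul, peval_pmul, peval_cons, peval_nil]
    push_cast
    ring
  · have he : edge d (fun a t => profit 0 ((a : ℤ) - t)) (total l.1.1) (playerTotal x.1 l)
        (table x.1 l) = peval (edgePoly score (fun t => 19 - 2 * t) (total l.1.1)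
          (finalTotal 5 l.2) ((seen l).length + 2)
            (x.1.1.1 :: x.1.1.2 :: (seen l).map Fin.val)) ((d : ℝ) - 1) := by
      rw [edge_profit_zero, ht, edge_eq d (g := fun t => 19 - 2 * t) (total_lt _)
        (sum_score (finalTotal 5 l.2) (finalTotal_lt (by norm_num) _))]
      rfl
    rw [gainTerm_eq d hd, he, hp, gapGain, hlen]
    simp only [peval_psmul, peval_pmul]
    field_simp

/-! ### The lists of information sets are complete -/

theorem mem_digits (a : Fin 10) : a ∈ digits := by revert a; decide

theorem mem_handList (h : Hand) : h ∈ handList := by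
  obtain ⟨⟨a, b⟩, hab⟩ := h
  simp only [handList, List.mem_flatMap, List.mem_filterMap]
  exact ⟨a, mem_digits a, b, mem_digits b, by rw [dif_pos hab]⟩

theorem mem_liveList (j : LiveHand) : j ∈ liveList := by
  obtain ⟨h, hh⟩ := j
  simp only [liveList, List.mem_filterMap]
  exact ⟨h, mem_handList h, by rw [dif_pos hh]⟩

theorem mem_infoList (l : InfoSet) : l ∈ infoList := by
  obtain ⟨j, k⟩ := l
  refine List.mem_product.2 ⟨mem_liveList j, ?_⟩
  cases k with
  | none => simp
  | some k => simp [mem_digits]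

theorem nodup_infoList : infoList.Nodup := by
  have h1 : liveList.Nodup := by decide +kernel
  have h2 : (none :: digits.map some).Nodup := by decide +kernel
  exact h1.product h2

theorem sum_infoSet (f : InfoSet → ℝ) : ∑ l, f l = (infoList.map f).sum := by
  have h : (Finset.univ : Finset InfoSet) = infoList.toFinset :=
    (Finset.eq_univ_of_forall fun l => List.mem_toFinset.2 (mem_infoList l)).symm
  rw [← List.sum_toFinset f nodup_infoList, h]

theorem mem_openList (l : InfoSet) : l ∈ openList ↔ (total l.1.1, l.2) ∈ openCells := by
  simp only [openList, List.mem_flatMap, List.mem_map, List.mem_filter, decide_eq_true_eq]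
  constructor
  · rintro ⟨c, hc, j, ⟨_, hj⟩, rfl⟩
    have : (total j.1, c.2) = c := Prod.ext hj rfl
    rwa [this]
  · intro h
    exact ⟨_, h, l.1, ⟨mem_liveList _, rfl⟩, rfl⟩

theorem nodup_openList : openList.Nodup := by decide +kernel

/-- The second table matters at the open sets only. -/
theorem entry_eq_of_notMem {l : InfoSet} (h : l ∉ openList) (pat : List (List Entry)) :
    entry pat l = entry [] l := by
  have key : ∀ (t : Fin 8) (k : Option (Fin 10)),
      (summary t).getD (k.elim 10 Fin.val) S = X → ((t : ℕ), k) ∈ openCells := by decide +kernel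
  have h1 := key ⟨total l.1.1, by have := l.1.2; omega⟩ l.2
  rw [mem_openList] at h
  unfold entry
  simp only
  cases h2 : (summary (total l.1.1)).getD (l.2.elim 10 Fin.val) S <;> simp_all

/-- The first table alone draws at no open set. -/
theorem entry_nil_of_mem {l : InfoSet} (h : l ∈ openList) : entry [] l = S := by
  have key : ∀ l ∈ openList, entry [] l = S := by decide +kernel
  exact key l h

/-- `playerGap` as a polynomial, if Banker uses a pure strategy that agrees with the first table
where that is not open. -/
theorem playerGap_eq {d : ℕ} (hd : 1 ≤ d) (x : FiveHand) :
    ∃ κ : ℝ, 0 < κ ∧ ∀ (pat : List (List Entry)) (T : BankerPure),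
      ((∀ l, l ∈ T ↔ entry pat l = D) →
        playerGap d x T = κ * peval (gapRow (gapBase x) pat x) ((d : ℝ) - 1)) ∧
      (entry pat (mixCell (min d 13)) ≠ D →
        (∀ l, l ∈ T ↔ entry pat l = D ∨ l = mixCell (min d 13)) →
        playerGap d x T
          = κ * peval (gapRowDraw (min d 13) (gapBase x) pat x) ((d : ℝ) - 1)) := by
  obtain ⟨κ, hκ, h⟩ := gap_terms_eq hd x
  have main : ∀ (pat : List (List Entry)) (T : BankerPure), (∀ l, l ∈ T ↔ entry pat l = D) →
      playerGap d x T = κ * peval (gapRow (gapBase x) pat x) ((d : ℝ) - 1) := by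
    intro pat T hT
    have h1 : ∀ l : InfoSet,
        side l * (standTerm d 0 x.1 l + if l ∈ T then gainTerm d 0 x.1 l else 0)
        = κ * peval (padd (gapStand x l) (if entry [] l = D then gapGain x l else [])) (d - 1)
          + (if l ∈ openList.toFinset then
              κ * peval (if entry pat l = D then gapGain x l else []) (d - 1) else 0) := by
      intro l
      rw [mul_add, (h l).1, peval_padd, mul_add, add_assoc]
      congr 1
      by_cases hl : l ∈ openList
      · have h2 : entry [] l ≠ D := by rw [entry_nil_of_mem hl]; decide
        rw [if_pos (List.mem_toFinset.2 hl), if_neg h2, peval_nil, mul_zero, zero_add]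
        by_cases h3 : entry pat l = D
        · rw [if_pos ((hT l).2 h3), if_pos h3, (h l).2]
        · rw [if_neg (mt (hT l).1 h3), if_neg h3, peval_nil]; simp
      · rw [if_neg (mt List.mem_toFinset.1 hl), add_zero, ← entry_eq_of_notMem hl pat]
        by_cases h3 : entry pat l = D
        · rw [if_pos ((hT l).2 h3), if_pos h3, (h l).2]
        · rw [if_neg (mt (hT l).1 h3), if_neg h3, peval_nil]; simp
    rw [playerGap, Finset.sum_congr rfl fun l _ => h1 l, Finset.sum_add_distrib,
      Finset.sum_ite_mem, Finset.univ_inter, List.sum_toFinset _ nodup_openList, sum_infoSet,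
      List.sum_map_mul_left, List.sum_map_mul_left, gapRow, peval_padd, peval_psum, gapBase,
      peval_psum, List.map_map, List.map_map]
    rw [mul_add]
    rfl
  refine ⟨κ, hκ, fun pat T => ⟨main pat T, fun hM hT => ?_⟩⟩
  set c := mixCell (min d 13) with hc
  -- drawing at M adds the gain there to the gap of the strategy that stands at M
  have h1 := main pat (T.erase c) (fun l => by
    rw [Finset.mem_erase, hT]
    constructor
    · rintro ⟨h1, h2 | h2⟩
      · exact h2
      · exact absurd h2 h1
    · intro h1
      exact ⟨fun h2 => hM (h2 ▸ h1), Or.inl h1⟩)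
  have h2 : playerGap d x T = playerGap d x (T.erase c) + side c * gainTerm d 0 x.1 c := by
    have h3 : ∀ l, side l * (standTerm d 0 x.1 l + if l ∈ T then gainTerm d 0 x.1 l else 0)
        = side l * (standTerm d 0 x.1 l + if l ∈ T.erase c then gainTerm d 0 x.1 l else 0)
          + if l = c then side c * gainTerm d 0 x.1 c else 0 := by
      intro l
      by_cases hl : l = c
      · subst hl
        rw [if_pos ((hT _).2 (Or.inr hc)), if_neg (Finset.notMem_erase _ _), if_pos rfl]; ring
      · simp [hl]
    rw [playerGap, Finset.sum_congr rfl fun l _ => h3 l, Finset.sum_add_distrib,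
      Finset.sum_ite_eq', if_pos (Finset.mem_univ _), playerGap]
  rw [h2, h1, (h c).2, gapRowDraw, peval_padd, mul_add]

/-! ### The finite checks hold -/

theorem closedCheck_all : infoList.all closedCheck = true := by decide +kernel

theorem openCheck_all : (openList.all fun l => decks.all fun d => openCheck d l) = true := by
  decide +kernel

theorem deckCheck_all : decks.all deckCheck = true := by decide +kernel

theorem playerCheck_all : decks.all playerCheck = true := by decide +kernel

theorem gapBase_pureHands : (pureHands.all fun x => decide (gapBase x.1 = x.2.2)) = true := by
  decide +kernel

theorem gapBase_one_four : gapBase (five 1 4) = pivotBase := by decide +kernel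

theorem exceptionalZ_pairwise :
    (decks.all fun d => decide ((exceptionalZ d).Pairwise fun e e' => e.2 < e'.2)) = true := by
  decide +kernel

theorem length_exceptionalZ :
    (decks.all fun d => decide ((exceptionalZ d).length = exceptionalCount d)) = true := by
  decide +kernel

/-! ### The two tables and their integer forms -/

theorem peval_qNum (d : ℕ) (a b c e f : ℤ) :
    peval (qNum a b c e f) ((d : ℝ) - 1) = a * d ^ 4 - b * d ^ 3 + c * d ^ 2 - e * d + f := by
  simp only [qNum, peval_pshift, peval_cons, peval_nil]
  push_cast
  ring

theorem peval_qDen (d : ℕ) :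
    peval qDen ((d : ℝ) - 1) = 256 * d ^ 2 * (11 * d - 1) * (52 * d - 5) := by
  simp only [qDen, peval_pshift, peval_pmul, peval_cons, peval_nil]
  push_cast
  ring

/-- A row of `rowsZ`, with its mixing probability as a real number. -/
noncomputable def realRow (d : ℕ) (r : List (List Entry) × List ℤ × List ℤ) :
    List (List Entry) × ℝ :=
  (r.1, peval r.2.1 ((d : ℝ) - 1) / peval r.2.2 ((d : ℝ) - 1))

theorem rows_eq {d : ℕ} (hd : 1 ≤ d) : rows d = (rowsZ (min d 13)).map (realRow d) := by
  rcases le_or_gt d 12 with h | h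
  · rw [min_eq_left (by omega)]
    interval_cases d <;>
    simp [rows, rowsZ, realRow, rowsZ.row, rowsZ.qA, rowsZ.qB, rowsZ.qC, rowsZ.qE, rowsZ.qF,
      -Nat.cast_ofNat, -Nat.cast_one, peval_qNum, peval_qDen, qA, qB, qC, qE, qF, qForm]
  · rw [min_eq_right (by omega)]
    have h1 : d ≠ 1 := by omega
    have h2 : d ≠ 2 := by omega
    have h3 : d ≠ 3 := by omega
    have h7 : ¬ d ≤ 7 := by omega
    have h8 : d ≠ 8 := by omega
    have h9 : d ≠ 9 := by omega
    have h11 : ¬ d ≤ 11 := by omega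
    have h12 : d ≠ 12 := by omega
    simp [rows, rowsZ, realRow, rowsZ.row, rowsZ.qE, peval_qNum, peval_qDen, qE, qForm, h1, h2, h3,
      h7, h8, h9, h11, h12]

/-- An entry of `exceptionalZ`, with its value as a real number. -/
noncomputable def realValue (e : Fin 6 × ℤ) : Fin 6 × ℝ := (e.1, e.2 / 10 ^ 7)

theorem exceptional_eq (d : ℕ) : exceptional d = (exceptionalZ (min d 13)).map realValue := by
  rcases le_or_gt d 12 with h | h
  · rw [min_eq_left (by omega)]
    interval_cases d <;> simp [exceptional, exceptionalZ, realValue] <;> norm_num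
  · rw [min_eq_right (by omega)]
    have : exceptionalZ 13 = [] := rfl
    rw [this, List.map_nil]
    unfold exceptional
    split <;> first | omega | rfl

/-- As regards the tables, `13` stands for all larger numbers of decks. -/
theorem exceptionalCount_min (d : ℕ) : exceptionalCount (min d 13) = exceptionalCount d := by
  unfold exceptionalCount
  split_ifs <;> omega

theorem min_mem_decks {d : ℕ} (hd : 1 ≤ d) : min d 13 ∈ decks := by
  have h1 : 1 ≤ min d 13 := by omega
  have h2 : min d 13 ≤ 13 := by omega
  generalize min d 13 = c at *
  interval_cases c <;> decide

/-! ### Signs of linear and quadratic polynomials in the commission rate -/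

/-- The value of a linear polynomial in the commission rate. -/
noncomputable def lineVal (d : ℕ) (a : List ℤ × List ℤ) (α : ℝ) : ℝ :=
  peval a.1 ((d : ℝ) - 1) + peval a.2 ((d : ℝ) - 1) * α

/-- The value of a quadratic polynomial in the commission rate. -/
noncomputable def quadVal (d : ℕ) (a : List ℤ × List ℤ × List ℤ) (α : ℝ) : ℝ :=
  peval a.1 ((d : ℝ) - 1) + peval a.2.1 ((d : ℝ) - 1) * α + peval a.2.2 ((d : ℝ) - 1) * α ^ 2

theorem line_pos {a b α : ℝ} (hα : α ∈ Set.Icc (0 : ℝ) (1 / 10)) (h0 : 0 < a)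
    (h1 : 0 < 10 * a + b) : 0 < a + b * α := by
  have h : a + b * α = (1 - 10 * α) * a + α * (10 * a + b) := by ring
  rw [h]
  rcases hα.1.eq_or_lt with h2 | h2
  · rw [← h2]; linarith
  · have := mul_pos h2 h1
    have := mul_nonneg (show 0 ≤ 1 - 10 * α by linarith [hα.2]) h0.le
    linarith

theorem lineVal_pos {d : ℕ} {a : List ℤ × List ℤ} (h : lineCheck (min d 13) a = true) {α : ℝ}
    (hα : α ∈ Set.Icc (0 : ℝ) (1 / 10)) : 0 < lineVal d a α := by
  simp only [lineCheck, Bool.and_eq_true] at h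
  have h1 := peval_pos_of_posAt h.2
  simp only [peval_padd, peval_psmul] at h1
  exact line_pos hα (peval_pos_of_posAt h.1) (by exact_mod_cast h1)

theorem lineVal_ne_zero {d : ℕ} {a : List ℤ × List ℤ}
    (h : lineNonzeroCheck (min d 13) a = true) {α : ℝ} (hα : α ∈ Set.Icc (0 : ℝ) (1 / 10)) :
    lineVal d a α ≠ 0 := by
  rw [lineNonzeroCheck, Bool.or_eq_true] at h
  rcases h with h | h
  · exact (lineVal_pos h hα).ne'
  · have h1 := lineVal_pos h hα
    simp only [lineVal, peval_psmul] at h1 ⊢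
    push_cast at h1
    intro h2
    linarith

theorem quadVal_pos {d : ℕ} {s : ℤ} {a : List ℤ × List ℤ × List ℤ}
    (h : quadraticCheck (min d 13) s a = true) {α : ℝ} (hα : α ∈ Set.Icc (0 : ℝ) (1 / 10)) :
    0 < s * quadVal d a α := by
  simp only [quadraticCheck, Bool.and_eq_true] at h
  obtain ⟨⟨h0, h1⟩, h2⟩ := h
  replace h0 := peval_pos_of_posAt h0
  replace h1 := peval_pos_of_posAt h1
  replace h2 := peval_pos_of_posAt h2
  simp only [peval_padd, peval_psmul] at h0 h1 h2
  push_cast at h1 h2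
  set a₀ := peval a.1 ((d : ℝ) - 1)
  set a₁ := peval a.2.1 ((d : ℝ) - 1)
  set a₂ := peval a.2.2 ((d : ℝ) - 1)
  -- the Bernstein form of the quadratic polynomial on `[0, 1/10]`
  have h : s * quadVal d a α = (1 - 10 * α) ^ 2 * (s * a₀)
      + (1 - 10 * α) * α * (s * (20 * a₀ + a₁)) + α ^ 2 * (s * (100 * a₀ + (10 * a₁ + a₂))) := by
    unfold quadVal; ring
  rw [h]
  have hβ : 0 ≤ 1 - 10 * α := by linarith [hα.2]
  rcases hα.1.eq_or_lt with h3 | h3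
  · rw [← h3]; simpa using h0
  · have := mul_pos (pow_pos h3 2) h2
    have := mul_nonneg (mul_nonneg hβ h3.le) h1.le
    have := mul_nonneg (sq_nonneg (1 - 10 * α)) h0.le
    linarith

/-- What `crossCheck` means: a unique, simple change of sign. -/
theorem exists_sign_change {d : ℕ} {s : ℤ} {e : Fin 6 × ℤ}
    (h : crossCheck (min d 13) s e = true) :
    ∃ β ∈ Set.Ioo (0 : ℝ) (1 / 10), |β - e.2 / 10 ^ 7| < 5 / 10 ^ 8 ∧
      quadVal d (mixQuadratic (min d 13) (crossing e.1).2) β = 0 ∧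
      (∀ α ∈ Set.Icc (0 : ℝ) (1 / 10), α < β →
        0 < s * quadVal d (mixQuadratic (min d 13) (crossing e.1).2) α) ∧
      (∀ α ∈ Set.Icc (0 : ℝ) (1 / 10), β < α →
        s * quadVal d (mixQuadratic (min d 13) (crossing e.1).2) α < 0) := by
  simp only [crossCheck, Bool.and_eq_true, decide_eq_true_eq] at h
  obtain ⟨⟨⟨⟨⟨⟨hlo, hhi⟩, h0⟩, h1⟩, h2⟩, h3⟩, -⟩ := h
  generalize mixQuadratic (min d 13) (crossing e.1).2 = a at *
  replace h0 := peval_pos_of_posAt h0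
  replace h1 := peval_pos_of_posAt h1
  replace h2 := peval_pos_of_posAt h2
  replace h3 := peval_pos_of_posAt h3
  simp only [scaledValue, peval_padd, peval_psmul] at h0 h1 h2 h3
  push_cast at h0 h1 h2 h3
  have hlo' : (1 : ℝ) < 2 * e.2 := by exact_mod_cast hlo
  have hhi' : (2 : ℝ) * e.2 + 1 < 2000000 := by exact_mod_cast hhi
  set a₀ := peval a.1 ((d : ℝ) - 1) with ha₀
  set a₁ := peval a.2.1 ((d : ℝ) - 1) with ha₁
  set a₂ := peval a.2.2 ((d : ℝ) - 1) with ha₂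
  set v : ℝ := (e.2 : ℝ)
  set f : ℝ → ℝ := fun α => s * quadVal d a α with hf
  have hfe : ∀ α, f α = s * (a₀ + a₁ * α + a₂ * α ^ 2) := fun α => rfl
  have hanti : ∀ α ∈ Set.Icc (0 : ℝ) (1 / 10), ∀ β ∈ Set.Icc (0 : ℝ) (1 / 10), α < β →
      f β < f α := by
    intro α hα β hβ hαβ
    -- the slope of the secant is the derivative at the midpoint
    have h4 := line_pos (a := -s * a₁) (b := -s * (2 * a₂)) (α := (α + β) / 2)
      ⟨by linarith [hα.1, hβ.1], by linarith [hα.2, hβ.2]⟩ h2 (by linarith)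
    have h5 : f α - f β = (β - α) * (-s * a₁ + -s * (2 * a₂) * ((α + β) / 2)) := by
      rw [hfe, hfe]; ring
    have := mul_pos (sub_pos.2 hαβ) h4
    linarith
  have hlo0 : 0 < f ((2 * v - 1) / 20000000) := by
    have : f ((2 * v - 1) / 20000000) = s * (400000000000000 * a₀
        + (20000000 * (2 * v - 1) * a₁ + (2 * v - 1) ^ 2 * a₂)) / 20000000 ^ 2 := by
      rw [hfe]; ring
    rw [this]; exact div_pos h0 (by norm_num)
  have hhi0 : f ((2 * v + 1) / 20000000) < 0 := by
    have : f ((2 * v + 1) / 20000000) = -(-s * (400000000000000 * a₀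
        + (20000000 * (2 * v + 1) * a₁ + (2 * v + 1) ^ 2 * a₂)) / 20000000 ^ 2) := by
      rw [hfe]; ring
    rw [this]
    exact neg_neg_of_pos (div_pos h1 (by norm_num))
  have hcont : ContinuousOn f
      (Set.Icc ((2 * v - 1) / 20000000) ((2 * v + 1) / 20000000)) := by
    have : f = fun α => s * (a₀ + a₁ * α + a₂ * α ^ 2) := funext hfe
    rw [this]; fun_prop
  obtain ⟨β, hβ, hβ0⟩ := intermediate_value_Ioo' (by linarith) hcont ⟨hhi0, hlo0⟩
  obtain ⟨hβ1, hβ2⟩ := hβ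
  rw [div_lt_iff₀ (by norm_num)] at hβ1
  rw [lt_div_iff₀ (by norm_num)] at hβ2
  have hβ' : β ∈ Set.Ioo (0 : ℝ) (1 / 10) := ⟨by linarith, by linarith⟩
  have hβI : β ∈ Set.Icc (0 : ℝ) (1 / 10) := ⟨hβ'.1.le, hβ'.2.le⟩
  have hs : (s : ℝ) ≠ 0 := by
    intro h0; rw [h0] at h2; simp at h2
  refine ⟨β, hβ', ?_, ?_, ?_, ?_⟩
  · rw [abs_lt]; constructor <;> linarith
  · exact (mul_eq_zero.1 hβ0).resolve_left hs
  · intro α hα h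
    have := hanti α hα β hβI h
    rw [hβ0] at this
    exact this
  · intro α hα h
    have := hanti β hβI α hα h
    rw [hβ0] at this
    exact this

/-! ### Player's probability and Banker's advantages -/

theorem min_thirteen_beq_one (d : ℕ) : Nat.beq (min d 13) 1 = decide (d = 1) := by
  by_cases h : d = 1
  · subst h; rfl
  · rw [decide_eq_false h, Bool.eq_false_iff]
    simp only [ne_eq, Nat.beq_eq]
    omega

theorem mixCell_min (d : ℕ) :
    mixCell (min d 13) = if d = 1 then (live 8 8, none) else (live 0 6, none) := by
  rw [mixCell, min_thirteen_beq_one]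
  by_cases h : d = 1 <;> simp [h]

theorem playerProb_eq (d : ℕ) (α : ℝ) :
    playerProb d α
      = lineVal d (probLines (min d 13)).1 α / lineVal d (probLines (min d 13)).2 α := by
  rw [probLines, min_thirteen_beq_one, playerProb]
  by_cases h : d = 1
  · simp [h, lineVal]; ring
  · simp only [h, if_false, decide_false, cond_false, lineVal, peval_pshift, peval_pmul,
      peval_cons, peval_nil]
    push_cast
    congr 1 <;> ring

theorem playerProb_mem {d : ℕ} (h : probCheck (min d 13) = true) {α : ℝ}
    (hα : α ∈ Set.Icc (0 : ℝ) (1 / 10)) :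
    0 < lineVal d (probLines (min d 13)).2 α ∧ 0 < playerProb d α ∧ playerProb d α < 1 := by
  simp only [probCheck, Bool.and_eq_true] at h
  obtain ⟨⟨h1, h2⟩, h3⟩ := h
  replace h1 := lineVal_pos h1 hα
  replace h2 := lineVal_pos h2 hα
  replace h3 := lineVal_pos h3 hα
  refine ⟨h2, ?_, ?_⟩
  · rw [playerProb_eq]; exact div_pos h1 h2
  · rw [playerProb_eq, div_lt_one h2]
    simp only [lineVal, peval_padd, peval_psmul] at h3 ⊢
    push_cast at h3
    linarith

/-- Banker's advantage from drawing at `l` if Player uses the equilibrium strategy. -/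
noncomputable def mixAdvantage (d : ℕ) (α : ℝ) (l : InfoSet) : ℝ :=
  (1 - playerProb d α) * advantage d α pureDSSDD l + playerProb d α * advantage d α pureDDSDD l

theorem mixAdvantage_eq {d : ℕ} (hd : 1 ≤ d) (h : probCheck (min d 13) = true) {α : ℝ}
    (hα : α ∈ Set.Icc (0 : ℝ) (1 / 10)) (l : InfoSet) :
    ∃ κ : ℝ, 0 < κ ∧ mixAdvantage d α l = κ * quadVal d (mixQuadratic (min d 13) l) α := by
  obtain ⟨κ, hκ, hl⟩ := advantage_eq_line hd l
  obtain ⟨he, -, -⟩ := playerProb_mem h hα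
  refine ⟨κ / lineVal d (probLines (min d 13)).2 α, div_pos hκ he, ?_⟩
  rw [mixAdvantage, (hl α).2, (hl α).1, playerProb_eq]
  have h1 : quadVal d (mixQuadratic (min d 13) l) α
      = lineVal d (probLines (min d 13)).2 α * lineVal d (baseLine l) α
        + lineVal d (probLines (min d 13)).1 α * lineVal d (pivotLine l) α := by
    simp only [mixQuadratic, quadratic, quadVal, lineVal, peval_padd, peval_pmul]
    ring
  rw [h1]
  simp only [← lineVal.eq_1]
  field_simp
  ring

theorem curve_eq_iff {d : ℕ} (hd : 1 ≤ d) {α : ℝ} (hα : α ∈ Set.Icc (0 : ℝ) (1 / 10))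
    {l : InfoSet} (h : lineNonzeroCheck (min d 13) (pivotLine l) = true) :
    curve d α l = playerProb d α ↔ mixAdvantage d α l = 0 := by
  obtain ⟨κ, hκ, hl⟩ := advantage_eq_line hd l
  have h1 : advantage d α pureDSSDD l - advantage d α pureDDSDD l ≠ 0 := by
    have h2 := mul_ne_zero hκ.ne' (lineVal_ne_zero h hα)
    rw [(hl α).2]
    intro h3
    apply h2
    rw [lineVal]
    linarith
  rw [curve, div_eq_iff h1, mixAdvantage]
  constructor <;> intro h2 <;> linarith

theorem drawSign_mul_pos_of_robustCheck {d : ℕ} (hd : 1 ≤ d) (h : probCheck (min d 13) = true)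
    {α : ℝ} (hα : α ∈ Set.Icc (0 : ℝ) (1 / 10)) {s : ℤ} {l : InfoSet}
    (hr : robustCheck s (baseLine l) (pivotLine l) = true) : 0 < s * mixAdvantage d α l := by
  obtain ⟨κ, hκ, hl⟩ := advantage_eq_line hd l
  obtain ⟨-, hp0, hp1⟩ := playerProb_mem h hα
  have hx : (0 : ℝ) ≤ (d : ℝ) - 1 := by
    have : (1 : ℝ) ≤ d := by exact_mod_cast hd
    linarith
  simp only [robustCheck, Bool.and_eq_true] at hr
  obtain ⟨⟨⟨h0, h1⟩, h2⟩, h3⟩ := hr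
  replace h0 := peval_pos_of_coeffPos h0 hx
  replace h1 := peval_pos_of_coeffPos h1 hx
  replace h2 := peval_pos_of_coeffPos h2 hx
  replace h3 := peval_pos_of_coeffPos h3 hx
  simp only [peval_padd, peval_psmul] at h0 h1 h2 h3
  push_cast at h1 h3
  have h4 := line_pos hα h0 (b := s * peval (baseLine l).2 ((d : ℝ) - 1)) (by linarith)
  have h5 := line_pos hα h2
    (b := s * (peval (baseLine l).2 ((d : ℝ) - 1) + peval (pivotLine l).2 ((d : ℝ) - 1)))
    (by linarith)
  have h6 := mul_pos hκ (add_pos (mul_pos (sub_pos.2 hp1) h4) (mul_pos hp0 h5))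
  rw [mixAdvantage, (hl α).2, (hl α).1]
  exact lt_of_lt_of_eq h6 (by ring)

/-! ### Best replies of a player whose payoff is a sum over a set -/

/-- A set maximizes a sum over it if and only if it contains all positive terms and no negative
ones. -/
theorem sum_maximal_iff {ι : Type*} [Fintype ι] [DecidableEq ι] (f : ι → ℝ) (T : Finset ι) :
    (∀ T' : Finset ι, ∑ l ∈ T', f l ≤ ∑ l ∈ T, f l)
      ↔ ∀ l, (0 < f l → l ∈ T) ∧ (f l < 0 → l ∉ T) := by
  constructor
  · intro h l
    constructor
    · intro hl
      by_contra hT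
      have := h (insert l T)
      rw [Finset.sum_insert hT] at this
      linarith
    · intro hl hT
      have := h (T.erase l)
      have h2 := Finset.add_sum_erase T f hT
      linarith
  · intro h T'
    have h1 : ∀ S : Finset ι, ∑ l ∈ S, f l = ∑ l, if l ∈ S then f l else 0 := by
      intro S; rw [Finset.sum_ite_mem, Finset.univ_inter]
    rw [h1, h1]
    refine Finset.sum_le_sum fun l _ => ?_
    rcases lt_trichotomy (f l) 0 with hl | hl | hl
    · rw [if_neg ((h l).2 hl)]
      split_ifs <;> linarith
    · simp [hl]
    · rw [if_pos ((h l).1 hl)]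
      split_ifs <;> linarith

theorem sum_playerStrategy {d : ℕ} (hd : 1 ≤ d) (α : ℝ) (T : BankerPure) :
    ∑ u, playerStrategy d α u * bankerPayoff d α u T
      = ∑ u, playerStrategy d α u * bankerPayoff d α u ∅ + ∑ l ∈ T, mixAdvantage d α l := by
  simp only [playerStrategy, sum_mixture_mul, mixAdvantage, Finset.sum_add_distrib,
    ← Finset.mul_sum]
  rw [bankerPayoff_eq_add_sum_advantage hd α pureDSSDD,
    bankerPayoff_eq_add_sum_advantage hd α pureDDSDD]
  ring

/-- Banker's best replies to Player's equilibrium strategy. -/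
theorem banker_bestReply_iff {d : ℕ} (hd : 1 ≤ d) (α : ℝ) (T : BankerPure) :
    (∀ T', ∑ u, playerStrategy d α u * bankerPayoff d α u T'
        ≤ ∑ u, playerStrategy d α u * bankerPayoff d α u T)
      ↔ ∀ l, (0 < mixAdvantage d α l → l ∈ T) ∧ (mixAdvantage d α l < 0 → l ∉ T) := by
  rw [← sum_maximal_iff]
  exact forall_congr' fun T' => by
    rw [sum_playerStrategy hd α T', sum_playerStrategy hd α T, add_le_add_iff_left]

/-- The gap at `x` against a mixed strategy of Banker. -/
noncomputable def mixGap (d : ℕ) (q : BankerPure → ℝ) (x : FiveHand) : ℝ :=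
  ∑ T, q T * playerGap d x T

theorem sum_playerPayoff {d : ℕ} (hd : 1 ≤ d) (q : BankerPure → ℝ) (u : PlayerPure) :
    ∑ T, playerPayoff d u T * q T
      = ∑ T, playerPayoff d ∅ T * q T + ∑ x ∈ u, -mixGap d q x := by
  have h : ∀ T, playerPayoff d u T * q T
      = playerPayoff d ∅ T * q T - ∑ x ∈ u, q T * playerGap d x T := by
    intro T
    rw [playerPayoff_eq hd u T, ← Finset.mul_sum]; ring
  rw [Finset.sum_congr rfl fun T _ => h T, Finset.sum_sub_distrib, Finset.sum_comm,
    Finset.sum_neg_distrib]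
  rfl

/-- Player's best replies to a mixed strategy of Banker. -/
theorem player_bestReply_iff {d : ℕ} (hd : 1 ≤ d) (q : BankerPure → ℝ) (u : PlayerPure) :
    (∀ u', ∑ T, playerPayoff d u' T * q T ≤ ∑ T, playerPayoff d u T * q T)
      ↔ ∀ x, (mixGap d q x < 0 → x ∈ u) ∧ (0 < mixGap d q x → x ∉ u) := by
  have h := sum_maximal_iff (fun x => -mixGap d q x) u
  simp only [Left.neg_pos_iff, Left.neg_neg_iff] at h
  rw [← h]
  exact forall_congr' fun u' => by
    rw [sum_playerPayoff hd q u', sum_playerPayoff hd q u, add_le_add_iff_left]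

/-! ### Consequences of the checks -/

section Checks

variable {d : ℕ}

theorem deckCheck_of (hd : 1 ≤ d) : deckCheck (min d 13) = true :=
  List.all_eq_true.1 deckCheck_all _ (min_mem_decks hd)

theorem probCheck_of (hd : 1 ≤ d) : probCheck (min d 13) = true := by
  have h := deckCheck_of hd
  simp only [deckCheck, Bool.and_eq_true] at h
  exact h.1.1.1

theorem mixCheck_of (hd : 1 ≤ d) : mixCheck (min d 13) = true := by
  have h := deckCheck_of hd
  simp only [deckCheck, Bool.and_eq_true] at h
  exact h.1.1.2

theorem tableCheck_of (hd : 1 ≤ d) : tableCheck (min d 13) = true := by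
  have h := deckCheck_of hd
  simp only [deckCheck, Bool.and_eq_true] at h
  exact h.1.2

theorem crossCheck_of (hd : 1 ≤ d) {n : ℕ} {e : Fin 6 × ℤ}
    (he : (exceptionalZ (min d 13))[n]? = some e) :
    crossCheck (min d 13) (drawSign (entry (patZ (min d 13) n) (crossing e.1).2)) e = true := by
  have h := deckCheck_of hd
  simp only [deckCheck, Bool.and_eq_true, List.all_eq_true] at h
  exact h.2 (e, n) (List.mem_zipIdx_iff_getElem?.2 he)

theorem length_rowsZ (hd : 1 ≤ d) :
    (rowsZ (min d 13)).length = (exceptionalZ (min d 13)).length + 1 := by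
  have h := tableCheck_of hd
  simp only [tableCheck, Bool.and_eq_true, decide_eq_true_eq] at h
  exact h.1.1.1

theorem mixCell_mem_openList (hd : 1 ≤ d) : mixCell (min d 13) ∈ openList := by
  have h := tableCheck_of hd
  simp only [tableCheck, Bool.and_eq_true, decide_eq_true_eq] at h
  exact h.1.1.2

theorem patZ_eq {n : ℕ} {r : List (List Entry) × List ℤ × List ℤ}
    (hr : (rowsZ (min d 13))[n]? = some r) : patZ (min d 13) n = r.1 := by
  rw [patZ, List.getD_eq_getElem?_getD, hr]; rfl

theorem exists_row (hd : 1 ≤ d) {n : ℕ} (hn : n ≤ (exceptionalZ (min d 13)).length) :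
    ∃ r, (rowsZ (min d 13))[n]? = some r :=
  ⟨_, List.getElem?_eq_getElem (by rw [length_rowsZ hd]; omega)⟩

theorem entry_eq_M_iff (hd : 1 ≤ d) {n : ℕ} (hn : n ≤ (exceptionalZ (min d 13)).length)
    (l : InfoSet) : entry (patZ (min d 13) n) l = M ↔ l = mixCell (min d 13) := by
  obtain ⟨r, hr⟩ := exists_row hd hn
  rw [patZ_eq hr]
  by_cases hl : l ∈ openList
  · have h := tableCheck_of hd
    simp only [tableCheck, Bool.and_eq_true, List.all_eq_true, decide_eq_true_eq] at h
    exact (h.1.2 r (List.mem_of_getElem? hr) l hl).1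
  · rw [entry_eq_of_notMem hl]
    have h := List.all_eq_true.1 closedCheck_all l (mem_infoList l)
    rw [mem_openList] at hl
    simp only [closedCheck, hl, decide_false, Bool.false_or, Bool.and_eq_true,
      decide_eq_true_eq] at h
    refine ⟨fun h1 => absurd h1 h.1, fun h1 => absurd (mixCell_mem_openList hd) ?_⟩
    rw [← h1, mem_openList]; exact hl

theorem crossing_facts (hd : 1 ≤ d) {n : ℕ} {e : Fin 6 × ℤ}
    (he : (exceptionalZ (min d 13))[n]? = some e) :
    (crossing e.1).1 = mixCell (min d 13) ∧ (crossing e.1).2 ≠ mixCell (min d 13) ∧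
      ∀ m ≤ (exceptionalZ (min d 13)).length,
        (entry (patZ (min d 13) m) (crossing e.1).2 = D
          ↔ (m ≤ n ↔ entry (patZ (min d 13) n) (crossing e.1).2 = D)) := by
  have h := tableCheck_of hd
  simp only [tableCheck, Bool.and_eq_true, List.all_eq_true, decide_eq_true_eq] at h
  have h1 := h.2 (e, n) (List.mem_zipIdx_iff_getElem?.2 he)
  refine ⟨h1.1.1.1, h1.1.2, fun m hm => ?_⟩
  obtain ⟨r, hr⟩ := exists_row hd hm
  rw [patZ_eq hr]
  exact h1.2 (r, m) (List.mem_zipIdx_iff_getElem?.2 hr)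

/-- Away from the crossing sets all rows agree. -/
theorem entry_eq_D_iff_zero (hd : 1 ≤ d) {n : ℕ} (hn : n ≤ (exceptionalZ (min d 13)).length)
    {l : InfoSet} (hl : ∀ e ∈ exceptionalZ (min d 13), l ≠ (crossing e.1).2) :
    entry (patZ (min d 13) n) l = D ↔ entry (patZ (min d 13) 0) l = D := by
  by_cases ho : l ∈ openList
  · obtain ⟨r, hr⟩ := exists_row hd hn
    rw [patZ_eq hr]
    have h := tableCheck_of hd
    simp only [tableCheck, Bool.and_eq_true, Bool.or_eq_true, List.all_eq_true,
      decide_eq_true_eq] at h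
    refine (h.1.2 r (List.mem_of_getElem? hr) l ho).2.resolve_left fun hm => ?_
    obtain ⟨e, he, rfl⟩ := List.mem_map.1 hm
    exact hl e he rfl
  · rw [entry_eq_of_notMem ho (patZ _ n), entry_eq_of_notMem ho (patZ _ 0)]

theorem mixAdvantage_mixCell (hd : 1 ≤ d) {α : ℝ} (hα : α ∈ Set.Icc (0 : ℝ) (1 / 10)) :
    mixAdvantage d α (mixCell (min d 13)) = 0 := by
  obtain ⟨κ, -, h⟩ := mixAdvantage_eq hd (probCheck_of hd) hα (mixCell (min d 13))
  have h1 := mixCheck_of hd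
  simp only [mixCheck, Bool.and_eq_true] at h1
  rw [h, quadVal, peval_eq_zero_of_zeroAt h1.1.1.1, peval_eq_zero_of_zeroAt h1.1.1.2,
    peval_eq_zero_of_zeroAt h1.1.2]
  ring

theorem lineNonzeroCheck_mixCell (hd : 1 ≤ d) :
    lineNonzeroCheck (min d 13) (pivotLine (mixCell (min d 13))) = true := by
  have h1 := mixCheck_of hd
  simp only [mixCheck, Bool.and_eq_true] at h1
  exact h1.2

theorem drawSign_congr {e e' : Entry} (h : e = D ↔ e' = D) : drawSign e = drawSign e' := by
  unfold drawSign; simp only [h]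

theorem drawSign_congr_neg {e e' : Entry} (h : e = D ↔ ¬ e' = D) :
    drawSign e = -drawSign e' := by
  unfold drawSign
  by_cases h' : e' = D <;> simp [h, h']

/-- Banker's advantage has the sign that the table says, away from the crossing sets. -/
theorem drawSign_mul_mixAdvantage_pos (hd : 1 ≤ d) {α : ℝ}
    (hα : α ∈ Set.Icc (0 : ℝ) (1 / 10)) {n : ℕ} (hn : n ≤ (exceptionalZ (min d 13)).length)
    {l : InfoSet} (hl : l ≠ mixCell (min d 13))
    (hl' : ∀ e ∈ exceptionalZ (min d 13), l ≠ (crossing e.1).2) :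
    0 < drawSign (entry (patZ (min d 13) n) l) * mixAdvantage d α l := by
  rw [drawSign_congr (entry_eq_D_iff_zero hd hn hl')]
  by_cases ho : l ∈ openList
  · have h := List.all_eq_true.1 (List.all_eq_true.1 openCheck_all l ho) _ (min_mem_decks hd)
    simp only [openCheck, Bool.or_eq_true, decide_eq_true_eq] at h
    have h1 := h.resolve_left (by
      rintro (h2 | h2)
      · exact hl h2
      · obtain ⟨e, he, rfl⟩ := List.mem_map.1 h2
        exact hl' e he rfl)
    obtain ⟨κ, hκ, h3⟩ := mixAdvantage_eq hd (probCheck_of hd) hα l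
    rw [h3, mul_left_comm]
    exact mul_pos hκ (quadVal_pos h1 hα)
  · rw [entry_eq_of_notMem ho]
    have h := List.all_eq_true.1 closedCheck_all l (mem_infoList l)
    rw [mem_openList] at ho
    simp only [closedCheck, ho, decide_false, Bool.false_or, Bool.and_eq_true] at h
    exact drawSign_mul_pos_of_robustCheck hd (probCheck_of hd) hα h.2

/-- Banker's advantage at a crossing set changes its sign at a single commission rate. -/
theorem exists_crossing_value (hd : 1 ≤ d) {n : ℕ} {e : Fin 6 × ℤ}
    (he : (exceptionalZ (min d 13))[n]? = some e) :
    ∃ β ∈ Set.Ioo (0 : ℝ) (1 / 10), |β - e.2 / 10 ^ 7| < 5 / 10 ^ 8 ∧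
      mixAdvantage d β (crossing e.1).2 = 0 ∧
      (∀ α ∈ Set.Icc (0 : ℝ) (1 / 10), α < β →
        0 < drawSign (entry (patZ (min d 13) n) (crossing e.1).2)
          * mixAdvantage d α (crossing e.1).2) ∧
      (∀ α ∈ Set.Icc (0 : ℝ) (1 / 10), β < α →
        drawSign (entry (patZ (min d 13) n) (crossing e.1).2)
          * mixAdvantage d α (crossing e.1).2 < 0) := by
  obtain ⟨β, hβ, hv, h0, h1, h2⟩ := exists_sign_change (crossCheck_of hd he)
  refine ⟨β, hβ, hv, ?_, fun α hα h => ?_, fun α hα h => ?_⟩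
  · obtain ⟨κ, -, h3⟩ := mixAdvantage_eq hd (probCheck_of hd) ⟨hβ.1.le, hβ.2.le⟩ (crossing e.1).2
    rw [h3, h0, mul_zero]
  · obtain ⟨κ, hκ, h3⟩ := mixAdvantage_eq hd (probCheck_of hd) hα (crossing e.1).2
    rw [h3, mul_left_comm]
    exact mul_pos hκ (h1 α hα h)
  · obtain ⟨κ, hκ, h3⟩ := mixAdvantage_eq hd (probCheck_of hd) hα (crossing e.1).2
    rw [h3, mul_left_comm]
    exact mul_neg_of_pos_of_neg hκ (h2 α hα h)

end Checks

/-! ### Nash equilibria from the tables -/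

/-- Banker's pure strategy that follows `pat` and stands at M. -/
def lowSet (pat : List (List Entry)) : BankerPure := univ.filter fun l => entry pat l = D

/-- Banker's pure strategy that follows `pat` and draws at M. -/
def highSet (pat : List (List Entry)) : BankerPure :=
  univ.filter fun l => entry pat l = D ∨ entry pat l = M

theorem mem_lowSet {pat : List (List Entry)} {l : InfoSet} :
    l ∈ lowSet pat ↔ entry pat l = D := by simp [lowSet]

theorem fiveHand_cases (x : FiveHand) :
    x = five 0 5 ∨ x = five 1 4 ∨ x = five 2 3 ∨ x = five 6 9 ∨ x = five 7 8 := by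
  revert x; decide +kernel

section Tables

variable {d : ℕ}

theorem mem_highSet (hd : 1 ≤ d) {n : ℕ} (hn : n ≤ (exceptionalZ (min d 13)).length)
    {l : InfoSet} : l ∈ highSet (patZ (min d 13) n)
      ↔ entry (patZ (min d 13) n) l = D ∨ l = mixCell (min d 13) := by
  simp [highSet, entry_eq_M_iff hd hn]

theorem entry_mixCell_ne (hd : 1 ≤ d) {n : ℕ} (hn : n ≤ (exceptionalZ (min d 13)).length) :
    entry (patZ (min d 13) n) (mixCell (min d 13)) ≠ D := by
  rw [(entry_eq_M_iff hd hn _).2 rfl]; decide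

theorem mixCell_notMem_lowSet (hd : 1 ≤ d) {n : ℕ} (hn : n ≤ (exceptionalZ (min d 13)).length) :
    mixCell (min d 13) ∉ lowSet (patZ (min d 13) n) :=
  fun h => entry_mixCell_ne hd hn (mem_lowSet.1 h)

theorem mixCell_mem_highSet (hd : 1 ≤ d) {n : ℕ} (hn : n ≤ (exceptionalZ (min d 13)).length) :
    mixCell (min d 13) ∈ highSet (patZ (min d 13) n) := (mem_highSet hd hn).2 (Or.inr rfl)

theorem lowSet_ne_highSet (hd : 1 ≤ d) {n m : ℕ} (hn : n ≤ (exceptionalZ (min d 13)).length)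
    (hm : m ≤ (exceptionalZ (min d 13)).length) :
    lowSet (patZ (min d 13) n) ≠ highSet (patZ (min d 13) m) := fun h =>
  mixCell_notMem_lowSet hd hn (h ▸ mixCell_mem_highSet hd hm)

/-- `playerGap` at the two pure strategies of a row, up to a common factor. -/
theorem playerGap_row (hd : 1 ≤ d) {x : FiveHand} {base : List ℤ} (hb : gapBase x = base) :
    ∃ κ : ℝ, 0 < κ ∧ ∀ n ≤ (exceptionalZ (min d 13)).length,
      playerGap d x (lowSet (patZ (min d 13) n))
        = κ * peval (gapRow base (patZ (min d 13) n) x) ((d : ℝ) - 1) ∧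
      playerGap d x (highSet (patZ (min d 13) n))
        = κ * peval (gapRowDraw (min d 13) base (patZ (min d 13) n) x) ((d : ℝ) - 1) := by
  subst hb
  obtain ⟨κ, hκ, h⟩ := playerGap_eq hd x
  exact ⟨κ, hκ, fun n hn => ⟨(h _ _).1 fun l => mem_lowSet,
    (h _ _).2 (entry_mixCell_ne hd hn) fun l => mem_highSet hd hn⟩⟩

theorem gapCheck_facts (hd : 1 ≤ d) {n m : ℕ} (hn : n ≤ (exceptionalZ (min d 13)).length)
    (hm : m ≤ (exceptionalZ (min d 13)).length)
    (h : gapCheck (min d 13) (patZ (min d 13) n) (patZ (min d 13) m) = true) :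
    playerGap d (five 1 4) (lowSet (patZ (min d 13) n)) < 0 ∧
    0 < playerGap d (five 1 4) (highSet (patZ (min d 13) m)) ∧
    ∀ x ∈ pureHands, 0 < (x.2.1 : ℝ) *
      (playerGap d (five 1 4) (highSet (patZ (min d 13) m))
          * playerGap d x.1 (lowSet (patZ (min d 13) n))
        - playerGap d (five 1 4) (lowSet (patZ (min d 13) n))
          * playerGap d x.1 (highSet (patZ (min d 13) m))) := by
  obtain ⟨κ, hκ, hg⟩ := playerGap_row hd gapBase_one_four
  simp only [gapCheck, Bool.and_eq_true, List.all_eq_true] at h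
  obtain ⟨⟨h0, h1⟩, h2⟩ := h
  replace h0 := peval_pos_of_posAt h0
  replace h1 := peval_pos_of_posAt h1
  rw [peval_psmul] at h0
  push_cast at h0
  rw [(hg n hn).1, (hg m hm).2]
  refine ⟨mul_neg_of_pos_of_neg hκ (by linarith), mul_pos hκ h1, fun x hx => ?_⟩
  have hb := List.all_eq_true.1 gapBase_pureHands x hx
  rw [decide_eq_true_eq] at hb
  obtain ⟨κ', hκ', hg'⟩ := playerGap_row hd hb
  have h3 := peval_pos_of_posAt (h2 x hx)
  simp only [peval_psmul, peval_padd, peval_pmul] at h3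
  push_cast at h3
  rw [(hg' n hn).1, (hg' m hm).2]
  exact lt_of_lt_of_eq (mul_pos (mul_pos hκ hκ') h3) (by ring)

theorem mixGap_mixture (q : ℝ) (T T' : BankerPure) (x : FiveHand) :
    mixGap d (mixture T T' q) x = (1 - q) * playerGap d x T + q * playerGap d x T' :=
  sum_mixture_mul _ _ _ _

theorem support_playerStrategy (hd : 1 ≤ d) {α : ℝ} (hα : α ∈ Set.Icc (0 : ℝ) (1 / 10)) :
    Function.support (playerStrategy d α) = {pureDSSDD, pureDDSDD} := by
  obtain ⟨-, h0, h1⟩ := playerProb_mem (probCheck_of hd) hα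
  exact support_mixture (by decide) h0 h1

/-- The mixture of the low set of one row and the high set of another, with the probability that
makes Player indifferent at `(1,4)`, is an equilibrium strategy as soon as it is a best reply. -/
theorem isNash_mixture (hd : 1 ≤ d) {α : ℝ} (hα : α ∈ Set.Icc (0 : ℝ) (1 / 10)) {n m : ℕ}
    (hn : n ≤ (exceptionalZ (min d 13)).length) (hm : m ≤ (exceptionalZ (min d 13)).length)
    (h : gapCheck (min d 13) (patZ (min d 13) n) (patZ (min d 13) m) = true) {q : ℝ}
    (hq : (1 - q) * playerGap d (five 1 4) (lowSet (patZ (min d 13) n))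
      + q * playerGap d (five 1 4) (highSet (patZ (min d 13) m)) = 0)
    (hBn : ∀ l, l ≠ mixCell (min d 13) →
      0 ≤ drawSign (entry (patZ (min d 13) n) l) * mixAdvantage d α l)
    (hBm : ∀ l, l ≠ mixCell (min d 13) →
      0 ≤ drawSign (entry (patZ (min d 13) m) l) * mixAdvantage d α l) :
    0 < q ∧ q < 1 ∧ IsNash (playerPayoff d) (bankerPayoff d α) (playerStrategy d α)
      (mixture (lowSet (patZ (min d 13) n)) (highSet (patZ (min d 13) m)) q) := by
  obtain ⟨hg, hg', hx⟩ := gapCheck_facts hd hn hm h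
  set g := playerGap d (five 1 4) (lowSet (patZ (min d 13) n)) with hgdef
  set g' := playerGap d (five 1 4) (highSet (patZ (min d 13) m)) with hg'def
  -- the two weights are proportional to `g'` and `-g`, as in `gapCheck`
  have hqg : q * (g' - g) = -g := by linarith
  have hqg' : (1 - q) * (g' - g) = g' := by linarith
  have hq0 : 0 < q := by
    by_contra hq0
    have := mul_nonneg (sub_nonneg.2 (not_lt.1 hq0)) (show 0 ≤ g' - g by linarith)
    linarith
  have hq1 : q < 1 := by
    by_contra hq1
    have := mul_nonneg (sub_nonneg.2 (not_lt.1 hq1)) (show 0 ≤ g' - g by linarith)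
    linarith
  obtain ⟨-, hp0, hp1⟩ := playerProb_mem (probCheck_of hd) hα
  have hne := lowSet_ne_highSet hd hn hm
  have hsign : ∀ x ∈ pureHands, 0 < (x.2.1 : ℝ) * mixGap d (mixture
      (lowSet (patZ (min d 13) n)) (highSet (patZ (min d 13) m)) q) x.1 := by
    intro x hx'
    have h1 := hx x hx'
    rw [mixGap_mixture]
    have h2 : (x.2.1 : ℝ) * (g' * playerGap d x.1 (lowSet (patZ (min d 13) n))
        - g * playerGap d x.1 (highSet (patZ (min d 13) m)))
        = (g' - g) * (x.2.1 * ((1 - q) * playerGap d x.1 (lowSet (patZ (min d 13) n))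
          + q * playerGap d x.1 (highSet (patZ (min d 13) m)))) := by
      rw [show g' * playerGap d x.1 (lowSet (patZ (min d 13) n))
        = (1 - q) * (g' - g) * playerGap d x.1 (lowSet (patZ (min d 13) n)) by rw [hqg'],
        show g * playerGap d x.1 (highSet (patZ (min d 13) m))
        = -(q * (g' - g)) * playerGap d x.1 (highSet (patZ (min d 13) m)) by rw [hqg]; ring]
      ring
    rw [h2] at h1
    exact pos_of_mul_pos_right h1 (by linarith)
  refine ⟨hq0, hq1, isNash_of_support
    (mixture_mem_stdSimplex _ _ hp0.le hp1.le) (mixture_mem_stdSimplex _ _ hq0.le hq1.le) ?_ ?_⟩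
  · intro u hu
    have hu' : u = pureDSSDD ∨ u = pureDDSDD := by
      have : u ∈ Function.support (playerStrategy d α) := hu
      rwa [support_playerStrategy hd hα] at this
    rw [player_bestReply_iff hd]
    have h05 := hsign _ (show (five 0 5, (-1 : ℤ), _) ∈ pureHands from List.mem_cons_self)
    have h23 := hsign _ (show (five 2 3, (1 : ℤ), _) ∈ pureHands from
      List.mem_cons_of_mem _ List.mem_cons_self)
    have h69 := hsign _ (show (five 6 9, (-1 : ℤ), _) ∈ pureHands from
      List.mem_cons_of_mem _ (List.mem_cons_of_mem _ List.mem_cons_self))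
    have h78 := hsign _ (show (five 7 8, (-1 : ℤ), _) ∈ pureHands from
      List.mem_cons_of_mem _ (List.mem_cons_of_mem _ (List.mem_cons_of_mem _ List.mem_cons_self)))
    push_cast at h05 h23 h69 h78
    have h14 := mixGap_mixture (d := d) q (lowSet (patZ (min d 13) n))
      (highSet (patZ (min d 13) m)) (five 1 4)
    rw [hq] at h14
    have hin : five 0 5 ∈ u ∧ five 2 3 ∉ u ∧ five 6 9 ∈ u ∧ five 7 8 ∈ u := by
      rcases hu' with rfl | rfl <;> decide
    intro x
    rcases fiveHand_cases x with rfl | rfl | rfl | rfl | rfl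
    · exact ⟨fun _ => hin.1, fun h => absurd h (by linarith)⟩
    · exact ⟨fun h => absurd h (by linarith), fun h => absurd h (by linarith)⟩
    · exact ⟨fun h => absurd h (by linarith), fun _ => hin.2.1⟩
    · exact ⟨fun _ => hin.2.2.1, fun h => absurd h (by linarith)⟩
    · exact ⟨fun _ => hin.2.2.2, fun h => absurd h (by linarith)⟩
  · intro T hT
    have hT' : T = lowSet (patZ (min d 13) n) ∨ T = highSet (patZ (min d 13) m) := by
      have : T ∈ Function.support (mixture
        (lowSet (patZ (min d 13) n)) (highSet (patZ (min d 13) m)) q) := hT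
      rwa [support_mixture hne hq0 hq1] at this
    rw [banker_bestReply_iff hd]
    have h0 := mixAdvantage_mixCell hd hα
    have key : ∀ (e : Entry) (a : ℝ), 0 ≤ drawSign e * a → (0 < a → e = D) ∧ (a < 0 → e ≠ D) := by
      intro e a hea
      by_cases he : e = D
      · simp only [drawSign, he, if_true, Int.cast_one, one_mul] at hea
        exact ⟨fun _ => he, fun h => absurd h (by linarith)⟩
      · simp only [drawSign, he, if_false] at hea
        push_cast at hea
        exact ⟨fun h => absurd h (by linarith), fun _ => he⟩
    intro l
    by_cases hl : l = mixCell (min d 13)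
    · rw [hl, h0]
      exact ⟨fun h => absurd h (lt_irrefl _), fun h => absurd h (lt_irrefl _)⟩
    · rcases hT' with rfl | rfl
      · rw [mem_lowSet]
        exact key _ _ (hBn l hl)
      · rw [mem_highSet hd hm]
        simp only [hl, or_false]
        exact key _ _ (hBm l hl)

/-! ### The exceptional commission rates -/

/-- `β` assigns to each index that occurs for `d` decks the commission rate at which Banker's
advantage at the crossing set changes its sign. -/
def IsCrossing (d : ℕ) (β : Fin 6 → ℝ) : Prop :=
  ∀ (n : ℕ) (e : Fin 6 × ℤ), (exceptionalZ (min d 13))[n]? = some e →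
    β e.1 ∈ Set.Ioo (0 : ℝ) (1 / 10) ∧ |β e.1 - e.2 / 10 ^ 7| < 5 / 10 ^ 8 ∧
      mixAdvantage d (β e.1) (crossing e.1).2 = 0 ∧
      (∀ α ∈ Set.Icc (0 : ℝ) (1 / 10), α < β e.1 →
        0 < drawSign (entry (patZ (min d 13) n) (crossing e.1).2)
          * mixAdvantage d α (crossing e.1).2) ∧
      (∀ α ∈ Set.Icc (0 : ℝ) (1 / 10), β e.1 < α →
        drawSign (entry (patZ (min d 13) n) (crossing e.1).2)
          * mixAdvantage d α (crossing e.1).2 < 0)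

theorem exists_isCrossing (hd : 1 ≤ d) : ∃ β, IsCrossing d β := by
  classical
  refine ⟨fun i => if h : ∃ b ∈ Set.Ioo (0 : ℝ) (1 / 10), mixAdvantage d b (crossing i).2 = 0
    then h.choose else 0, fun n e he => ?_⟩
  obtain ⟨b, hb, hv, h0, h1, h2⟩ := exists_crossing_value hd he
  have h : ∃ b ∈ Set.Ioo (0 : ℝ) (1 / 10), mixAdvantage d b (crossing e.1).2 = 0 := ⟨b, hb, h0⟩
  have hc := h.choose_spec
  have hcb : h.choose = b := by
    rcases lt_trichotomy h.choose b with h3 | h3 | h3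
    · have := h1 _ ⟨hc.1.1.le, hc.1.2.le⟩ h3
      rw [hc.2] at this; simp at this
    · exact h3
    · have := h2 _ ⟨hc.1.1.le, hc.1.2.le⟩ h3
      rw [hc.2] at this; simp at this
  simp only [dif_pos h, hcb]
  exact ⟨hb, hv, h0, h1, h2⟩

variable {β : Fin 6 → ℝ}

theorem IsCrossing.lt (hβ : IsCrossing d β) (hd : 1 ≤ d) {n m : ℕ} (hnm : n < m)
    {e e' : Fin 6 × ℤ} (he : (exceptionalZ (min d 13))[n]? = some e)
    (he' : (exceptionalZ (min d 13))[m]? = some e') : β e.1 < β e'.1 := by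
  have h1 := (abs_lt.1 (hβ n e he).2.1).2
  have h2 := (abs_lt.1 (hβ m e' he').2.1).1
  have h := List.all_eq_true.1 exceptionalZ_pairwise _ (min_mem_decks hd)
  rw [decide_eq_true_eq, List.pairwise_iff_getElem] at h
  obtain ⟨hn', rfl⟩ := List.getElem?_eq_some_iff.1 he
  obtain ⟨hm', rfl⟩ := List.getElem?_eq_some_iff.1 he'
  have h3 := h n m hn' hm' hnm
  have h4 : ((exceptionalZ (min d 13))[n].2 : ℝ) + 1 ≤ (exceptionalZ (min d 13))[m].2 := by
    exact_mod_cast h3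
  linarith

theorem IsCrossing.mixAdvantage_eq_zero_iff (hβ : IsCrossing d β) {n : ℕ} {e : Fin 6 × ℤ}
    (he : (exceptionalZ (min d 13))[n]? = some e) {α : ℝ}
    (hα : α ∈ Set.Icc (0 : ℝ) (1 / 10)) :
    mixAdvantage d α (crossing e.1).2 = 0 ↔ α = β e.1 := by
  obtain ⟨-, -, h0, h1, h2⟩ := hβ n e he
  refine ⟨fun h => ?_, fun h => h ▸ h0⟩
  rcases lt_trichotomy α (β e.1) with h3 | h3 | h3
  · have := h1 α hα h3
    rw [h] at this; simp at this
  · exact h3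
  · have := h2 α hα h3
    rw [h] at this; simp at this

/-- Row `n` is Banker's strict preference at each set that does not cross at `α`. -/
theorem IsCrossing.drawSign_mul_pos (hβ : IsCrossing d β) (hd : 1 ≤ d) {α : ℝ}
    (hα : α ∈ Set.Icc (0 : ℝ) (1 / 10)) {n : ℕ} (hn : n ≤ (exceptionalZ (min d 13)).length)
    {l : InfoSet} (hl : l ≠ mixCell (min d 13))
    (h : ∀ (m : ℕ) (e : Fin 6 × ℤ), (exceptionalZ (min d 13))[m]? = some e →
      l = (crossing e.1).2 → (m < n → β e.1 < α) ∧ (n ≤ m → α < β e.1)) :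
    0 < drawSign (entry (patZ (min d 13) n) l) * mixAdvantage d α l := by
  by_cases hc : ∃ e ∈ exceptionalZ (min d 13), l = (crossing e.1).2
  · obtain ⟨e, he, rfl⟩ := hc
    obtain ⟨m, he⟩ := List.mem_iff_getElem?.1 he
    obtain ⟨h1, h2⟩ := h m e he rfl
    have hf := (crossing_facts hd he).2.2 n hn
    obtain ⟨-, -, -, hpos, hneg⟩ := hβ m e he
    rcases lt_or_ge m n with hmn | hmn
    · have h3 := hneg α hα (h1 hmn)
      have h4 : entry (patZ (min d 13) n) (crossing e.1).2 = D
          ↔ ¬ entry (patZ (min d 13) m) (crossing e.1).2 = D := by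
        rw [hf]; simp [not_le.2 hmn]
      rw [drawSign_congr_neg h4]
      push_cast
      linarith
    · have h4 : entry (patZ (min d 13) n) (crossing e.1).2 = D
          ↔ entry (patZ (min d 13) m) (crossing e.1).2 = D := by
        rw [hf]; simp [hmn]
      rw [drawSign_congr h4]
      exact hpos α hα (h2 hmn)
  · push Not at hc
    exact drawSign_mul_mixAdvantage_pos hd hα hn hl hc

theorem IsCrossing.drawSign_mul_nonneg (hβ : IsCrossing d β) (hd : 1 ≤ d) {α : ℝ}
    (hα : α ∈ Set.Icc (0 : ℝ) (1 / 10)) {n : ℕ} (hn : n ≤ (exceptionalZ (min d 13)).length)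
    (h : ∀ (m : ℕ) (e : Fin 6 × ℤ), (exceptionalZ (min d 13))[m]? = some e →
      (m < n → β e.1 ≤ α) ∧ (n ≤ m → α ≤ β e.1))
    (l : InfoSet) (hl : l ≠ mixCell (min d 13)) :
    0 ≤ drawSign (entry (patZ (min d 13) n) l) * mixAdvantage d α l := by
  by_cases h0 : mixAdvantage d α l = 0
  · simp [h0]
  · refine (hβ.drawSign_mul_pos hd hα hn hl fun m e he hle => ?_).le
    have hne : α ≠ β e.1 := fun h1 => h0 (hle ▸ (hβ.mixAdvantage_eq_zero_iff he hα).2 h1)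
    exact ⟨fun h1 => lt_of_le_of_ne ((h m e he).1 h1) hne.symm,
      fun h1 => lt_of_le_of_ne ((h m e he).2 h1) hne⟩

end Tables

/-! ### Equilibria between and at the exceptional commission rates -/

theorem eq_mixture_of_support {I : Type*} [Fintype I] [DecidableEq I] {q : I → ℝ}
    (hq : q ∈ stdSimplex ℝ I) {x y : I} (hxy : x ≠ y) (h : Function.support q = {x, y}) :
    0 < q y ∧ q y < 1 ∧ q = mixture x y (q y) := by
  have h0 : ∀ z, z ≠ x → z ≠ y → q z = 0 := by
    intro z hx hy
    by_contra hz
    have : z ∈ Function.support q := hz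
    rw [h] at this
    rcases this with h1 | h1
    exacts [hx h1, hy h1]
  have hpos : ∀ z ∈ ({x, y} : Set I), 0 < q z := by
    intro z hz
    rw [← h] at hz
    exact lt_of_le_of_ne (hq.1 z) (Ne.symm hz)
  have hsum : q x + q y = 1 := by
    rw [← hq.2, ← Finset.sum_pair hxy]
    refine Finset.sum_subset (Finset.subset_univ _) fun z _ hz => ?_
    simp only [Finset.mem_insert, Finset.mem_singleton, not_or] at hz
    exact h0 z hz.1 hz.2
  have hx := hpos x (by simp)
  have hy := hpos y (by simp)
  refine ⟨hy, by linarith, funext fun z => ?_⟩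
  by_cases hzx : z = x
  · rw [hzx, mixture_left hxy]; linarith
  by_cases hzy : z = y
  · rw [hzy, mixture_right hxy]
  · rw [mixture_other hzx hzy, h0 z hzx hzy]

section Equilibria

variable {d : ℕ}

theorem gapCheck_self (hd : 1 ≤ d) {n : ℕ} (hn : n ≤ (exceptionalZ (min d 13)).length) :
    gapCheck (min d 13) (patZ (min d 13) n) (patZ (min d 13) n) = true := by
  obtain ⟨r, hr⟩ := exists_row hd hn
  have h := List.all_eq_true.1 playerCheck_all _ (min_mem_decks hd)
  simp only [playerCheck, Bool.and_eq_true, List.all_eq_true] at h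
  rw [patZ_eq hr]
  exact (h.1 r (List.mem_of_getElem? hr)).2

theorem gapCheck_succ (hd : 1 ≤ d) {n : ℕ} (hn : n < (exceptionalZ (min d 13)).length) :
    gapCheck (min d 13) (patZ (min d 13) n) (patZ (min d 13) (n + 1)) = true ∧
      gapCheck (min d 13) (patZ (min d 13) (n + 1)) (patZ (min d 13) n) = true := by
  have h := List.all_eq_true.1 playerCheck_all _ (min_mem_decks hd)
  simp only [playerCheck, Bool.and_eq_true, List.all_eq_true] at h
  exact h.2 n (List.mem_range.2 hn)

/-- The tabulated mixing probability makes Player indifferent at `(1,4)`. -/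
theorem mixGap_bankerStrategy (hd : 1 ≤ d) {n : ℕ}
    {r : List (List Entry) × List ℤ × List ℤ} (hr : (rowsZ (min d 13))[n]? = some r)
    (hn : n ≤ (exceptionalZ (min d 13)).length) :
    (1 - (realRow d r).2) * playerGap d (five 1 4) (lowSet (patZ (min d 13) n))
      + (realRow d r).2 * playerGap d (five 1 4) (highSet (patZ (min d 13) n)) = 0 := by
  have h := List.all_eq_true.1 playerCheck_all _ (min_mem_decks hd)
  simp only [playerCheck, Bool.and_eq_true, List.all_eq_true] at h
  have h1 := (h.1 r (List.mem_of_getElem? hr)).1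
  simp only [mixProbCheck, Bool.and_eq_true] at h1
  have h2 := peval_pos_of_posAt h1.1
  have h3 := peval_eq_zero_of_zeroAt h1.2
  obtain ⟨κ, -, hg⟩ := playerGap_row hd gapBase_one_four
  rw [(hg n hn).1, (hg n hn).2, patZ_eq hr]
  simp only [peval_padd, peval_pmul, peval_psmul] at h3
  push_cast at h3
  simp only [realRow]
  have h4 := h2.ne'
  field_simp
  linear_combination κ * h3

variable {β : Fin 6 → ℝ}

theorem IsCrossing.isNash_bankerStrategy (hβ : IsCrossing d β) (hd : 1 ≤ d) {α : ℝ}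
    (hα : α ∈ Set.Icc (0 : ℝ) (1 / 10)) {n : ℕ} {r : List (List Entry) × List ℤ × List ℤ}
    (hr : (rowsZ (min d 13))[n]? = some r)
    (h : ∀ (m : ℕ) (e : Fin 6 × ℤ), (exceptionalZ (min d 13))[m]? = some e →
      (m < n → β e.1 ≤ α) ∧ (n ≤ m → α ≤ β e.1)) :
    IsNash (playerPayoff d) (bankerPayoff d α) (playerStrategy d α)
      (bankerStrategy (realRow d r).1 (realRow d r).2) := by
  have hn : n ≤ (exceptionalZ (min d 13)).length := by
    have h1 := (List.getElem?_eq_some_iff.1 hr).1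
    rw [length_rowsZ hd] at h1
    omega
  have hB := hβ.drawSign_mul_nonneg hd hα hn h
  have h2 := (isNash_mixture hd hα hn hn (gapCheck_self hd hn)
    (mixGap_bankerStrategy hd hr hn) hB hB).2.2
  rw [patZ_eq hr] at h2
  exact h2

theorem curve_mixCell (hd : 1 ≤ d) {α : ℝ} (hα : α ∈ Set.Icc (0 : ℝ) (1 / 10)) :
    curve d α (mixCell (min d 13)) = playerProb d α :=
  (curve_eq_iff hd hα (lineNonzeroCheck_mixCell hd)).2 (mixAdvantage_mixCell hd hα)

theorem IsCrossing.curve_eq_curve_iff (hβ : IsCrossing d β) (hd : 1 ≤ d) {α : ℝ}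
    (hα : α ∈ Set.Icc (0 : ℝ) (1 / 10)) {n : ℕ} {e : Fin 6 × ℤ}
    (he : (exceptionalZ (min d 13))[n]? = some e) :
    curve d α (crossing e.1).1 = curve d α (crossing e.1).2 ↔ α = β e.1 := by
  have hc := crossCheck_of hd he
  simp only [crossCheck, Bool.and_eq_true] at hc
  rw [(crossing_facts hd he).1, curve_mixCell hd hα, eq_comm, curve_eq_iff hd hα hc.2,
    hβ.mixAdvantage_eq_zero_iff he hα]

/-- At an exceptional commission rate, the rows on both sides of it are weakly optimal. -/
theorem IsCrossing.le_of_adjacent (hβ : IsCrossing d β) (hd : 1 ≤ d) {n : ℕ} {e : Fin 6 × ℤ}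
    (he : (exceptionalZ (min d 13))[n]? = some e) (i : Fin 2) (m : ℕ) (e' : Fin 6 × ℤ)
    (he' : (exceptionalZ (min d 13))[m]? = some e') :
    (m < n + i → β e'.1 ≤ β e.1) ∧ (n + i ≤ m → β e.1 ≤ β e'.1) := by
  have hi := i.isLt
  rcases lt_trichotomy m n with h | rfl | h
  · exact ⟨fun _ => (hβ.lt hd h he' he).le, fun h' => by omega⟩
  · obtain rfl : e = e' := Option.some_injective _ (he.symm.trans he')
    exact ⟨fun _ => le_rfl, fun _ => le_rfl⟩
  · exact ⟨fun h' => by omega, fun _ => (hβ.lt hd h he he').le⟩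

theorem add_le_length {n : ℕ} {e : Fin 6 × ℤ} (he : (exceptionalZ (min d 13))[n]? = some e)
    (i : Fin 2) : n + i ≤ (exceptionalZ (min d 13)).length := by
  have h := (List.getElem?_eq_some_iff.1 he).1
  have hi := i.isLt
  omega

theorem gapCheck_adjacent (hd : 1 ≤ d) {n : ℕ} {e : Fin 6 × ℤ}
    (he : (exceptionalZ (min d 13))[n]? = some e) (i j : Fin 2) :
    gapCheck (min d 13) (patZ (min d 13) (n + i)) (patZ (min d 13) (n + j)) = true := by
  have h := gapCheck_succ hd (List.getElem?_eq_some_iff.1 he).1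
  fin_cases i <;> fin_cases j
  exacts [gapCheck_self hd (add_le_length he 0), h.1, h.2, gapCheck_self hd (add_le_length he 1)]

/-- The two rows adjacent to an exceptional commission rate differ at the crossing set. -/
theorem entry_succ_crossing (hd : 1 ≤ d) {n : ℕ} {e : Fin 6 × ℤ}
    (he : (exceptionalZ (min d 13))[n]? = some e) :
    entry (patZ (min d 13) (n + 1)) (crossing e.1).2 = D
      ↔ ¬ entry (patZ (min d 13) n) (crossing e.1).2 = D := by
  rw [(crossing_facts hd he).2.2 (n + 1) (add_le_length he 1)]
  simp

theorem eq_of_entry_crossing_iff (hd : 1 ≤ d) {n : ℕ} {e : Fin 6 × ℤ}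
    (he : (exceptionalZ (min d 13))[n]? = some e) {i j : Fin 2}
    (h : entry (patZ (min d 13) (n + i)) (crossing e.1).2 = D
      ↔ entry (patZ (min d 13) (n + j)) (crossing e.1).2 = D) : i = j := by
  have h' := entry_succ_crossing hd he
  fin_cases i <;> fin_cases j <;> first | rfl | (exfalso; simp at h; tauto)

/-- A best reply of Banker at an exceptional commission rate follows the table away from the two
information sets whose curves cross. -/
theorem IsCrossing.mem_iff_of_bestReply (hβ : IsCrossing d β) (hd : 1 ≤ d) {n : ℕ}
    {e : Fin 6 × ℤ} (he : (exceptionalZ (min d 13))[n]? = some e) {T : BankerPure}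
    (hT : ∀ T', ∑ u, playerStrategy d (β e.1) u * bankerPayoff d (β e.1) u T'
      ≤ ∑ u, playerStrategy d (β e.1) u * bankerPayoff d (β e.1) u T) (i : Fin 2) {l : InfoSet}
    (hl : l ≠ mixCell (min d 13)) (hl' : l ≠ (crossing e.1).2) :
    l ∈ T ↔ entry (patZ (min d 13) (n + i)) l = D := by
  have hα : β e.1 ∈ Set.Icc (0 : ℝ) (1 / 10) := Set.Ioo_subset_Icc_self (hβ n e he).1
  have hpos := hβ.drawSign_mul_pos hd hα (add_le_length he i) hl fun m e' he' hle => by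
    have hmn : m ≠ n := by
      rintro rfl
      obtain rfl : e = e' := Option.some_injective _ (he.symm.trans he')
      exact hl' hle
    have hi := i.isLt
    rcases lt_or_gt_of_ne hmn with h | h
    · exact ⟨fun _ => hβ.lt hd h he' he, fun h' => by omega⟩
    · exact ⟨fun h' => by omega, fun _ => hβ.lt hd h he he'⟩
  obtain ⟨h1, h2⟩ := (banker_bestReply_iff hd _ T).1 hT l
  by_cases h : entry (patZ (min d 13) (n + i)) l = D
  · simp only [drawSign, h, if_true, Int.cast_one, one_mul] at hpos
    simp only [h, h1 hpos]
  · simp only [drawSign, h, if_false] at hpos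
    push_cast at hpos
    simp only [h, h2 (by linarith)]

/-- Banker has four best replies at an exceptional commission rate. -/
theorem IsCrossing.eq_of_bestReply (hβ : IsCrossing d β) (hd : 1 ≤ d) {n : ℕ}
    {e : Fin 6 × ℤ} (he : (exceptionalZ (min d 13))[n]? = some e) {T : BankerPure}
    (hT : ∀ T', ∑ u, playerStrategy d (β e.1) u * bankerPayoff d (β e.1) u T'
      ≤ ∑ u, playerStrategy d (β e.1) u * bankerPayoff d (β e.1) u T) :
    ∃ i : Fin 2, T = lowSet (patZ (min d 13) (n + i)) ∨ T = highSet (patZ (min d 13) (n + i)) := by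
  obtain ⟨i, hi⟩ : ∃ i : Fin 2, (crossing e.1).2 ∈ T
      ↔ entry (patZ (min d 13) (n + i)) (crossing e.1).2 = D := by
    have h := entry_succ_crossing hd he
    by_cases h1 : (crossing e.1).2 ∈ T ↔ entry (patZ (min d 13) n) (crossing e.1).2 = D
    · exact ⟨0, h1⟩
    · exact ⟨1, show _ ↔ entry (patZ (min d 13) (n + 1)) _ = D by rw [h]; tauto⟩
  have hn := add_le_length he i
  have key : ∀ l, l ≠ mixCell (min d 13) →
      (l ∈ T ↔ entry (patZ (min d 13) (n + i)) l = D) := by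
    intro l hl
    by_cases hl' : l = (crossing e.1).2
    · rw [hl']; exact hi
    · exact hβ.mem_iff_of_bestReply hd he hT i hl hl'
  refine ⟨i, ?_⟩
  by_cases hm : mixCell (min d 13) ∈ T
  · refine Or.inr (Finset.ext fun l => ?_)
    rw [mem_highSet hd hn]
    by_cases hl : l = mixCell (min d 13)
    · simp [hl, hm]
    · simp [hl, key l hl]
  · refine Or.inl (Finset.ext fun l => ?_)
    rw [mem_lowSet]
    by_cases hl : l = mixCell (min d 13)
    · rw [hl]; simp [hm, entry_mixCell_ne hd hn]
    · exact key l hl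

theorem mixGap_one_four_eq_zero (hd : 1 ≤ d) {α : ℝ} (hα : α ∈ Set.Icc (0 : ℝ) (1 / 10))
    {q : BankerPure → ℝ}
    (h : IsNash (playerPayoff d) (bankerPayoff d α) (playerStrategy d α) q) :
    mixGap d q (five 1 4) = 0 := by
  have hs := support_playerStrategy hd hα
  have h0 : pureDSSDD ∈ Function.support (playerStrategy d α) := by rw [hs]; exact Or.inl rfl
  have h1 : pureDDSDD ∈ Function.support (playerStrategy d α) := by rw [hs]; exact Or.inr rfl
  have h2 := ((player_bestReply_iff hd q _).1 fun u => h.row_le h0 u) (five 1 4)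
  have h3 := ((player_bestReply_iff hd q _).1 fun u => h.row_le h1 u) (five 1 4)
  have hn : five 1 4 ∉ pureDSSDD := by decide
  have hy : five 1 4 ∈ pureDDSDD := by decide
  exact le_antisymm (not_lt.1 fun h => h3.2 h hy) (not_lt.1 fun h => hn (h2.1 h))

/-- The mixture of the low set of row `n + i.1` and the high set of row `n + i.2` that makes Player
indifferent at `(1,4)`. -/
noncomputable def crossMixture (d n : ℕ) (i : Fin 2 × Fin 2) : BankerPure → ℝ :=
  mixture (lowSet (patZ (min d 13) (n + i.1))) (highSet (patZ (min d 13) (n + i.2)))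
    (playerGap d (five 1 4) (lowSet (patZ (min d 13) (n + i.1)))
      / (playerGap d (five 1 4) (lowSet (patZ (min d 13) (n + i.1)))
        - playerGap d (five 1 4) (highSet (patZ (min d 13) (n + i.2)))))

theorem IsCrossing.crossMixture_facts (hβ : IsCrossing d β) (hd : 1 ≤ d) {n : ℕ}
    {e : Fin 6 × ℤ} (he : (exceptionalZ (min d 13))[n]? = some e) (i : Fin 2 × Fin 2) :
    IsNash (playerPayoff d) (bankerPayoff d (β e.1)) (playerStrategy d (β e.1))
        (crossMixture d n i) ∧
      Function.support (crossMixture d n i)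
        = {lowSet (patZ (min d 13) (n + i.1)), highSet (patZ (min d 13) (n + i.2))} := by
  have hα : β e.1 ∈ Set.Icc (0 : ℝ) (1 / 10) := Set.Ioo_subset_Icc_self (hβ n e he).1
  have h1 := add_le_length he i.1
  have h2 := add_le_length he i.2
  have hg := gapCheck_adjacent hd he i.1 i.2
  obtain ⟨hneg, hpos, -⟩ := gapCheck_facts hd h1 h2 hg
  obtain ⟨hq0, hq1, hN⟩ := isNash_mixture hd hα h1 h2 hg
    (q := playerGap d (five 1 4) (lowSet (patZ (min d 13) (n + i.1)))
      / (playerGap d (five 1 4) (lowSet (patZ (min d 13) (n + i.1)))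
        - playerGap d (five 1 4) (highSet (patZ (min d 13) (n + i.2)))))
    (by
      have : playerGap d (five 1 4) (lowSet (patZ (min d 13) (n + i.1)))
        - playerGap d (five 1 4) (highSet (patZ (min d 13) (n + i.2))) ≠ 0 := by linarith
      field_simp
      ring)
    (hβ.drawSign_mul_nonneg hd hα h1 (hβ.le_of_adjacent hd he i.1))
    (hβ.drawSign_mul_nonneg hd hα h2 (hβ.le_of_adjacent hd he i.2))
  exact ⟨hN, support_mixture (lowSet_ne_highSet hd h1 h2) hq0 hq1⟩

theorem lowSet_injective (hd : 1 ≤ d) {n : ℕ} {e : Fin 6 × ℤ}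
    (he : (exceptionalZ (min d 13))[n]? = some e) {i j : Fin 2}
    (h : lowSet (patZ (min d 13) (n + i)) = lowSet (patZ (min d 13) (n + j))) : i = j := by
  refine eq_of_entry_crossing_iff hd he ?_
  rw [← mem_lowSet, ← mem_lowSet, h]

theorem highSet_injective (hd : 1 ≤ d) {n : ℕ} {e : Fin 6 × ℤ}
    (he : (exceptionalZ (min d 13))[n]? = some e) {i j : Fin 2}
    (h : highSet (patZ (min d 13) (n + i)) = highSet (patZ (min d 13) (n + j))) : i = j := by
  refine eq_of_entry_crossing_iff hd he ?_
  have h1 : (crossing e.1).2 ∈ highSet (patZ (min d 13) (n + i))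
    ↔ (crossing e.1).2 ∈ highSet (patZ (min d 13) (n + j)) := by rw [h]
  rw [mem_highSet hd (add_le_length he i), mem_highSet hd (add_le_length he j)] at h1
  simpa [(crossing_facts hd he).2.1] using h1

theorem IsCrossing.crossMixture_injective (hβ : IsCrossing d β) (hd : 1 ≤ d) {n : ℕ}
    {e : Fin 6 × ℤ} (he : (exceptionalZ (min d 13))[n]? = some e) :
    Function.Injective (crossMixture d n) := by
  intro i j hij
  have h : Function.support (crossMixture d n i) = Function.support (crossMixture d n j) := by
    rw [hij]
  rw [(hβ.crossMixture_facts hd he i).2, (hβ.crossMixture_facts hd he j).2] at h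
  have h1 : lowSet (patZ (min d 13) (n + i.1)) ∈ ({lowSet (patZ (min d 13) (n + j.1)),
      highSet (patZ (min d 13) (n + j.2))} : Set BankerPure) := h ▸ Or.inl rfl
  have h2 : highSet (patZ (min d 13) (n + i.2)) ∈ ({lowSet (patZ (min d 13) (n + j.1)),
      highSet (patZ (min d 13) (n + j.2))} : Set BankerPure) := h ▸ Or.inr rfl
  refine Prod.ext (lowSet_injective hd he (h1.resolve_right ?_))
    (highSet_injective hd he (h2.resolve_left ?_))
  · exact lowSet_ne_highSet hd (add_le_length he i.1) (add_le_length he j.2)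
  · exact (lowSet_ne_highSet hd (add_le_length he j.1) (add_le_length he i.2)).symm

/-- The equilibrium strategies of Banker of support size two at an exceptional commission rate. -/
theorem IsCrossing.setOf_isNash_eq (hβ : IsCrossing d β) (hd : 1 ≤ d) {n : ℕ}
    {e : Fin 6 × ℤ} (he : (exceptionalZ (min d 13))[n]? = some e) :
    {q : BankerPure → ℝ | IsNash (playerPayoff d) (bankerPayoff d (β e.1))
        (playerStrategy d (β e.1)) q ∧ (Function.support q).ncard = 2}
      = Set.range (crossMixture d n) := by
  have hα : β e.1 ∈ Set.Icc (0 : ℝ) (1 / 10) := Set.Ioo_subset_Icc_self (hβ n e he).1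
  refine Set.Subset.antisymm ?_ ?_
  · rintro q ⟨hN, hc⟩
    have h0 := mixGap_one_four_eq_zero hd hα hN
    have hgap : ∀ i j : Fin 2,
        playerGap d (five 1 4) (lowSet (patZ (min d 13) (n + i))) < 0 ∧
        0 < playerGap d (five 1 4) (highSet (patZ (min d 13) (n + j))) := by
      intro i j
      obtain ⟨h1, h2, -⟩ := gapCheck_facts hd (add_le_length he i) (add_le_length he j)
        (gapCheck_adjacent hd he i j)
      exact ⟨h1, h2⟩
    have hpair : ∀ T T' : BankerPure, T ≠ T' → Function.support q = {T, T'} →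
        ∃ t, 0 < t ∧ t < 1 ∧ q = mixture T T' t ∧
          (1 - t) * playerGap d (five 1 4) T + t * playerGap d (five 1 4) T' = 0 := by
      intro T T' hne hs
      obtain ⟨ht0, ht1, hq⟩ := eq_mixture_of_support hN.2.1 hne hs
      refine ⟨_, ht0, ht1, hq, ?_⟩
      rw [← mixGap_mixture, ← hq]
      exact h0
    have hmain : ∀ i j : Fin 2, Function.support q
        = {lowSet (patZ (min d 13) (n + i)), highSet (patZ (min d 13) (n + j))} →
        q ∈ Set.range (crossMixture d n) := by
      intro i j hs
      obtain ⟨t, -, -, hq, ht⟩ := hpair _ _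
        (lowSet_ne_highSet hd (add_le_length he i) (add_le_length he j)) hs
      refine ⟨(i, j), ?_⟩
      rw [hq, crossMixture]
      refine congrArg (mixture _ _) ?_
      obtain ⟨h1, h2⟩ := hgap i j
      rw [div_eq_iff (by linarith)]
      linarith
    obtain ⟨T, T', hne, hs⟩ := Set.ncard_eq_two.1 hc
    have hbest : ∀ S ∈ ({T, T'} : Set BankerPure), ∃ i : Fin 2,
        S = lowSet (patZ (min d 13) (n + i)) ∨ S = highSet (patZ (min d 13) (n + i)) := by
      intro S hS
      rw [← hs] at hS
      exact hβ.eq_of_bestReply hd he fun S' => hN.col_le hS S'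
    obtain ⟨t, ht0, ht1, -, ht⟩ := hpair T T' hne hs
    obtain ⟨i, hi⟩ := hbest T (Or.inl rfl)
    obtain ⟨j, hj⟩ := hbest T' (Or.inr rfl)
    obtain ⟨h1, h2⟩ := hgap i j
    obtain ⟨h3, h4⟩ := hgap j i
    have ht1' : 0 < 1 - t := by linarith
    -- two strategies that agree at M cannot leave Player indifferent
    rcases hi with rfl | rfl <;> rcases hj with rfl | rfl
    · exact absurd ht (add_neg (mul_neg_of_pos_of_neg ht1' h1) (mul_neg_of_pos_of_neg ht0 h3)).ne
    · exact hmain i j hs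
    · exact hmain j i (hs.trans (Set.pair_comm _ _))
    · exact absurd ht (add_pos (mul_pos ht1' h4) (mul_pos ht0 h2)).ne'
  · rintro _ ⟨i, rfl⟩
    obtain ⟨h1, h2⟩ := hβ.crossMixture_facts hd he i
    refine ⟨h1, ?_⟩
    rw [h2, Set.ncard_pair (lowSet_ne_highSet hd (add_le_length he i.1) (add_le_length he i.2))]

theorem IsCrossing.ncard_setOf_isNash (hβ : IsCrossing d β) (hd : 1 ≤ d) {n : ℕ}
    {e : Fin 6 × ℤ} (he : (exceptionalZ (min d 13))[n]? = some e) :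
    {q : BankerPure → ℝ | IsNash (playerPayoff d) (bankerPayoff d (β e.1))
        (playerStrategy d (β e.1)) q ∧ (Function.support q).ncard = 2}.ncard = 4 := by
  rw [hβ.setOf_isNash_eq hd he, ← Set.image_univ,
    Set.ncard_image_of_injective _ (hβ.crossMixture_injective hd he), Set.ncard_univ]
  simp

theorem IsCrossing.pairwise (hβ : IsCrossing d β) (hd : 1 ≤ d) :
    (exceptionalZ (min d 13)).Pairwise fun e e' => β e.1 < β e'.1 :=
  List.pairwise_iff_getElem.2 fun _ _ hi hj hij =>
    hβ.lt hd hij (List.getElem?_eq_getElem hi) (List.getElem?_eq_getElem hj)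

theorem IsCrossing.ncard_values (hβ : IsCrossing d β) (hd : 1 ≤ d) :
    {α : ℝ | ∃ e ∈ exceptional d, α = β e.1}.ncard = exceptionalCount d := by
  have h1 : {α : ℝ | ∃ e ∈ exceptional d, α = β e.1}
      = (((exceptionalZ (min d 13)).map fun e => β e.1).toFinset : Set ℝ) := by
    ext α
    simp [exceptional_eq, realValue, eq_comm]
  have h2 : ((exceptionalZ (min d 13)).map fun e => β e.1).Nodup :=
    (List.pairwise_map.2 (hβ.pairwise hd)).imp fun h => h.ne
  have h3 := List.all_eq_true.1 length_exceptionalZ _ (min_mem_decks hd)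
  rw [decide_eq_true_eq] at h3
  rw [h1, Set.ncard_coe_finset, List.toFinset_card_of_nodup h2, List.length_map, h3,
    exceptionalCount_min]

end Equilibria

end Baccara

theorem theorem2 (d : ℕ) (hd : 1 ≤ d) :
    -- Player's mixing probability is the ordinate of the curve at the set where Banker mixes
    (∀ α ∈ Set.Icc (0 : ℝ) (1 / 10),
      Baccara.curve d α
        (if d = 1 then (Baccara.live 8 8, none) else (Baccara.live 0 6, none))
        = Baccara.playerProb d α) ∧
    ∃ β : Fin 6 → ℝ,
      -- the exceptional values are well defined, have the stated approximate values and order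
      (∀ e ∈ Baccara.exceptional d,
        β e.1 ∈ Set.Ioo (0 : ℝ) (1 / 10) ∧
        (∀ α ∈ Set.Ioo (0 : ℝ) (1 / 10),
          Baccara.curve d α (Baccara.crossing e.1).1 = Baccara.curve d α (Baccara.crossing e.1).2 ↔
            α = β e.1) ∧
        |β e.1 - e.2| ≤ 5 / 10 ^ 8) ∧
      (Baccara.exceptional d).Pairwise (fun e e' => β e.1 < β e'.1) ∧
      -- their number
      {α : ℝ | ∃ e ∈ Baccara.exceptional d, α = β e.1}.ncard = Baccara.exceptionalCount d ∧
      -- between them, the strategies of the n-th row (n = 0, 1, ...) form a Nash equilibrium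
      (Baccara.rows d).length = (Baccara.exceptional d).length + 1 ∧
      (∀ (n : ℕ) (row : List (List Baccara.Entry) × ℝ), (Baccara.rows d)[n]? = some row →
        ∀ α ∈ Set.Icc (0 : ℝ) (1 / 10),
          (∀ e ∈ (Baccara.exceptional d).take n, β e.1 < α) →
          (∀ e ∈ (Baccara.exceptional d).drop n, α < β e.1) →
          Baccara.IsNash (Baccara.playerPayoff d) (Baccara.bankerPayoff d α)
            (Baccara.playerStrategy d α) (Baccara.bankerStrategy row.1 row.2)) ∧
      -- at them, exactly four Banker strategies of support size 2 are in equilibrium with Player's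
      -- strategy, and these follow the table except at the two information sets whose curves cross
      (∀ (n : ℕ) (row : List (List Baccara.Entry) × ℝ) (e : Fin 6 × ℝ),
        (Baccara.rows d)[n]? = some row → (Baccara.exceptional d)[n]? = some e →
        {q : Baccara.BankerPure → ℝ |
          Baccara.IsNash (Baccara.playerPayoff d) (Baccara.bankerPayoff d (β e.1))
            (Baccara.playerStrategy d (β e.1)) q ∧ (Function.support q).ncard = 2}.ncard = 4 ∧
        ∀ q : Baccara.BankerPure → ℝ,
          Baccara.IsNash (Baccara.playerPayoff d) (Baccara.bankerPayoff d (β e.1))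
            (Baccara.playerStrategy d (β e.1)) q →
          (Function.support q).ncard = 2 →
          ∀ T : Baccara.BankerPure, q T ≠ 0 → ∀ l : Baccara.InfoSet,
            l ≠ (Baccara.crossing e.1).1 → l ≠ (Baccara.crossing e.1).2 →
            (l ∈ T ↔ Baccara.entry row.1 l = Baccara.Entry.D)) := by
  refine ⟨fun α hα => ?_, ?_⟩
  · rw [← Baccara.mixCell_min]
    exact Baccara.curve_mixCell hd hα
  obtain ⟨β, hβ⟩ := Baccara.exists_isCrossing hd
  have hex := Baccara.exceptional_eq d
  have hrows := Baccara.rows_eq hd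
  refine ⟨β, fun e he => ?_, ?_, hβ.ncard_values hd, ?_, fun n row hrow α hα hlt hgt => ?_,
    fun n row e hrow he => ?_⟩
  · rw [hex] at he
    obtain ⟨e, hmem, rfl⟩ := List.mem_map.1 he
    obtain ⟨n, he⟩ := List.mem_iff_getElem?.1 hmem
    exact ⟨(hβ n e he).1, fun α hα =>
      hβ.curve_eq_curve_iff hd (Set.Ioo_subset_Icc_self hα) he, (hβ n e he).2.1.le⟩
  · rw [hex]
    exact List.pairwise_map.2 (hβ.pairwise hd)
  · rw [hrows, hex, List.length_map, List.length_map, Baccara.length_rowsZ hd]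
  · rw [hrows, List.getElem?_map, Option.map_eq_some_iff] at hrow
    obtain ⟨r, hr, rfl⟩ := hrow
    refine hβ.isNash_bankerStrategy hd hα hr fun m e he => ?_
    have he' : (Baccara.exceptional d)[m]? = some (Baccara.realValue e) := by
      rw [hex, List.getElem?_map, he]; rfl
    refine ⟨fun hm => (hlt (Baccara.realValue e) (List.mem_of_getElem? (i := m) ?_)).le,
      fun hm => (hgt (Baccara.realValue e) (List.mem_of_getElem? (i := m - n) ?_)).le⟩
    · rw [List.getElem?_take_of_lt hm, he']
    · rw [List.getElem?_drop, Nat.add_sub_cancel' hm, he']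
  · rw [hrows, List.getElem?_map, Option.map_eq_some_iff] at hrow
    obtain ⟨r, hr, rfl⟩ := hrow
    rw [hex, List.getElem?_map, Option.map_eq_some_iff] at he
    obtain ⟨e, he, rfl⟩ := he
    refine ⟨hβ.ncard_setOf_isNash hd he, fun q hN _ T hT l hl hl' => ?_⟩
    rw [show (Baccara.realRow d r).1 = r.1 from rfl, ← Baccara.patZ_eq hr]
    exact hβ.mem_iff_of_bestReply hd he (fun T' => hN.col_le hT T') 0
      ((Baccara.crossing_facts hd he).1 ▸ hl) hl'
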